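/- Let $K$ be a field of characteristic $0$, let $L\supseteq K$ be an extension field (for example $K=\mathbf Q$, $L=\mathbf C$), and let $f_1,\dots,f_d\in K[x]=K[x_1,\dots,x_n]$ be nonzero polynomials. Let $A_{n+d}=K\langle x,t,\partial_x,\partial_t\rangle$ be the Weyl algebra in $x=(x_1,\dots,x_n)$, $t=(t_1,\dots,t_d)$, let $A_{n+d}[u,v]$ be obtained from it by adjoining commuting central indeterminates $u=(u_1,\dots,u_d)$, $v=(v_1,\dots,v_d)$, and let $A_n[s]=K[s_1,\dots,s_d]\langle x,\partial_x\rangle$. Let $I$ be the left ideal of $A_{n+d}[u,v]$ generated by $$t_j-u_jf_j,\qquad \partial_{x_i}+\sum_{j=1}^d\frac{\partial f_j}{\partial x_i}u_j\partial_{t_j},\qquad 1-u_jv_j\qquad(1\le i\le n,\ 1\le j\le d).$$ Let $<$ be a term order (on the monomials of the associated commutative polynomial ring) for eliminating $u,v$, that is, every monomial containing some $u_j$ or $v_j$ is greater than every monomial containing none. Let $G$ be a Gröbner basis of $I$ with respect to $<$ (a finite subset of $I$ whose initial monomials generate the initial ideal of $I$), and put $G_0=G\cap A_{n+d}$. For $1\le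 j\le d$ let $\mathcal W_j$ be the weight that gives $t_j,u_j$ weight $-1$, $\partial_{t_j},v_j$ weight $1$, and all other variables weight $0$. For $\nu\in\mathbf Z$ put $S_{j,\nu}=\partial_{t_j}^{\nu}$ if $\nu\ge0$ and $S_{j,\nu}=t_j^{-\nu}$ otherwise. (1) Suppose that $G$ is the reduced Gröbner basis, or, more generally, that every element of $G_0$ is homogeneous with respect to each of $\mathcal W_1,\dots,\mathcal W_d$. Then for each $P\in G_0$ there are $\nu\in\mathbf Z^d$ and $Q\in A_n[s]$ such that $$S_{1,\nu_1}\cdots S_{d,\nu_d}\,P=Q(x,\partial_x,t_1\partial_{t_1},\dots,t_d\partial_{t_d}).$$ (2) For each $P\in G_0$ let $\nu_P\in\mathbf Z^d$ and $Q_P\in A_n[s]$ be such that $S_{1,\nu_{P,1}}\cdots S_{d,\nu_{P,d}}P=Q_P(x,\partial_x,t_1\partial_{t_1},\dots,t_d\partial_{t_d})$. Then the operators $Q_P(x,\partial_x,-s_1-1,\dots,-s_d-1)$, $P\in G_0$, generate the sheaf $\mathcal I(s)$ of left ideals of $\mathcal D_X[s]$, $X=L^n$, formed by the operators that annihilate $f_1^{s_1}\cdots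 f_d^{s_d}$. That is: for every multiplicative submonoid $T$ of $L[x]$, with $R=T^{-1}L[x]$ and $f=f_1\cdots f_d$, they generate the left ideal $$\{p\in R\langle\partial_{x}\rangle[s] : p\cdot f_1^{s_1}\cdots f_d^{s_d}=0\}$$ of $R\langle\partial_x\rangle[s]$, where $R\langle\partial_x\rangle$ is the ring of differential operators with coefficients in $R$ and the action is the usual one on the free $R[s,1/f]$-module $R[s,1/f]\,f_1^{s_1}\cdots f_d^{s_d}$, in which $\partial_{x_i}(h f_1^{s_1}\cdots f_d^{s_d})=\bigl(\frac{\partial h}{\partial x_i}+h\sum_j \frac{s_j}{f_j}\frac{\partial f_j}{\partial x_i}\bigr)f_1^{s_1}\cdots f_d^{s_d}$. In particular ($T=\{1\}$) they generate the annihilator of $f_1^{s_1}\cdots f_d^{s_d}$ in $L[s]\langle x,\partial_x\rangle$; the complements of maximal ideals as $T$ give the stalks of $\mathcal I(s)$, and the powers of $h$ give its sections over $\{h\ne0\}$. -/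

import Mathlib

open scoped MonomialOrder

noncomputable section

/-! ### Rings of differential operators -/

namespace DiffOp

variable {k R : Type*} [CommRing k] [CommRing R] [Algebra k R] {ι : Type*}
  (δ : ι → Derivation k R R) (τ : Type*)

/-- Generators of the ring `R⟨∂_i⟩[z_j]`: the elements of the commutative ring `R`, the
differentiation symbols `∂_i` (`i : ι`), and the central indeterminates `z_j` (`j : τ`). -/
inductive Gen (R ι τ : Type*)
  | coeff (r : R) : Gen R ι τ
  | der (i : ι) : Gen R ι τ
  | central (j : τ) : Gen R ι τ

/-- Defining relations: `R` is a subring, `∂_i r = r ∂_i + δ_i(r)`, the `∂_i` commute with each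
other, and the `z_j` commute with everything. -/
inductive Rel : FreeAlgebra ℤ (Gen R ι τ) → FreeAlgebra ℤ (Gen R ι τ) → Prop
  | coeff_one : Rel (FreeAlgebra.ι ℤ (.coeff 1)) 1
  | coeff_add (r r' : R) : Rel (FreeAlgebra.ι ℤ (.coeff (r + r')))
      (FreeAlgebra.ι ℤ (.coeff r) + FreeAlgebra.ι ℤ (.coeff r'))
  | coeff_mul (r r' : R) : Rel (FreeAlgebra.ι ℤ (.coeff (r * r')))
      (FreeAlgebra.ι ℤ (.coeff r) * FreeAlgebra.ι ℤ (.coeff r'))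
  | der_coeff (i : ι) (r : R) : Rel (FreeAlgebra.ι ℤ (.der i) * FreeAlgebra.ι ℤ (.coeff r))
      (FreeAlgebra.ι ℤ (.coeff r) * FreeAlgebra.ι ℤ (.der i) + FreeAlgebra.ι ℤ (.coeff (δ i r)))
  | der_der (i l : ι) : Rel (FreeAlgebra.ι ℤ (.der i) * FreeAlgebra.ι ℤ (.der l))
      (FreeAlgebra.ι ℤ (.der l) * FreeAlgebra.ι ℤ (.der i))
  | central_coeff (j : τ) (r : R) :
      Rel (FreeAlgebra.ι ℤ (.central j) * FreeAlgebra.ι ℤ (.coeff r))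
        (FreeAlgebra.ι ℤ (.coeff r) * FreeAlgebra.ι ℤ (.central j))
  | central_der (j : τ) (i : ι) :
      Rel (FreeAlgebra.ι ℤ (.central j) * FreeAlgebra.ι ℤ (.der i))
        (FreeAlgebra.ι ℤ (.der i) * FreeAlgebra.ι ℤ (.central j))
  | central_central (j k : τ) :
      Rel (FreeAlgebra.ι ℤ (.central j) * FreeAlgebra.ι ℤ (.central k))
        (FreeAlgebra.ι ℤ (.central k) * FreeAlgebra.ι ℤ (.central j))

end DiffOp

/-- The ring `R⟨∂_i (i : ι)⟩[z_j (j : τ)]` of differential operators with coefficients in the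
commutative ring `R`, where `∂_i` differentiates `R` by the (commuting) derivation `δ i`, with the
commuting central indeterminates `z_j` adjoined. -/
def DiffOp {k R : Type*} [CommRing k] [CommRing R] [Algebra k R] {ι : Type*}
    (δ : ι → Derivation k R R) (τ : Type*) : Type _ :=
  RingQuot (DiffOp.Rel δ τ)

namespace DiffOp

variable {k R : Type*} [CommRing k] [CommRing R] [Algebra k R] {ι : Type*}
  {δ : ι → Derivation k R R} {τ : Type*}

instance : Ring (DiffOp δ τ) := inferInstanceAs (Ring (RingQuot (DiffOp.Rel δ τ)))

variable (δ τ) in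
/-- The class of a generator. -/
def of (g : Gen R ι τ) : DiffOp δ τ := RingQuot.mkRingHom (Rel δ τ) (FreeAlgebra.ι ℤ g)

variable (δ τ) in
/-- A coefficient `r`, as an operator of order zero. -/
def coeff : R →+* DiffOp δ τ :=
  RingHom.mk'
    { toFun := fun r => of δ τ (.coeff r)
      map_one' := (RingQuot.mkRingHom_rel Rel.coeff_one).trans (map_one _)
      map_mul' := fun r r' => (RingQuot.mkRingHom_rel (Rel.coeff_mul r r')).trans (map_mul _ _ _) }
    fun r r' => (RingQuot.mkRingHom_rel (Rel.coeff_add r r')).trans (map_add _ _ _)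

variable (δ τ) in
/-- The operator `∂_i`. -/
def der (i : ι) : DiffOp δ τ := of δ τ (.der i)

variable (δ τ) in
/-- The central indeterminate `z_j`. -/
def central (j : τ) : DiffOp δ τ := of δ τ (.central j)

theorem der_coeff (i : ι) (r : R) :
    der δ τ i * coeff δ τ r = coeff δ τ r * der δ τ i + coeff δ τ (δ i r) := by
  have h := RingQuot.mkRingHom_rel (Rel.der_coeff (δ := δ) (τ := τ) i r)
  rw [map_add, map_mul, map_mul] at h
  exact h

theorem der_comm (i l : ι) : Commute (der δ τ i) (der δ τ l) := by
  have h := RingQuot.mkRingHom_rel (Rel.der_der (δ := δ) (τ := τ) i l)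
  rw [map_mul, map_mul] at h
  exact h

theorem central_coeff (j : τ) (r : R) : Commute (central δ τ j) (coeff δ τ r) := by
  have h := RingQuot.mkRingHom_rel (Rel.central_coeff (δ := δ) (τ := τ) j r)
  rw [map_mul, map_mul] at h
  exact h

theorem central_der (j : τ) (i : ι) : Commute (central δ τ j) (der δ τ i) := by
  have h := RingQuot.mkRingHom_rel (Rel.central_der (δ := δ) (τ := τ) j i)
  rw [map_mul, map_mul] at h
  exact h

theorem central_central (j k : τ) : Commute (central δ τ j) (central δ τ k) := by
  have h := RingQuot.mkRingHom_rel (Rel.central_central (δ := δ) (τ := τ) j k)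
  rw [map_mul, map_mul] at h
  exact h

/-- The universal property: a ring homomorphism out of `R⟨∂⟩[z]` is given by images of the
coefficients, of the `∂_i` and of the `z_j` that satisfy the defining relations. -/
def lift {E : Type*} [Ring E] (φ : R →+* E) (d : ι → E) (z : τ → E)
    (hdr : ∀ i r, d i * φ r = φ r * d i + φ (δ i r))
    (hdd : ∀ i k, Commute (d i) (d k))
    (hzr : ∀ j r, Commute (z j) (φ r))
    (hzd : ∀ j i, Commute (z j) (d i))
    (hzz : ∀ j k, Commute (z j) (z k)) : DiffOp δ τ →+* E :=
  RingQuot.lift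
    ⟨(FreeAlgebra.lift ℤ (fun g : Gen R ι τ => match g with
        | .coeff r => φ r
        | .der i => d i
        | .central j => z j) : FreeAlgebra ℤ (Gen R ι τ) →ₐ[ℤ] E).toRingHom, by
      intro a b h
      cases h with
      | coeff_one => simp
      | coeff_add r r' => simp
      | coeff_mul r r' => simp
      | der_coeff i r => simpa using hdr i r
      | der_der i k => simpa using (hdd i k).eq
      | central_coeff j r => simpa using (hzr j r).eq
      | central_der j i => simpa using (hzd j i).eq
      | central_central j k => simpa using (hzz j k).eq⟩

section lift

variable {E : Type*} [Ring E] (φ : R →+* E) (d : ι → E) (z : τ → E)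
    (hdr : ∀ i r, d i * φ r = φ r * d i + φ (δ i r))
    (hdd : ∀ i k, Commute (d i) (d k))
    (hzr : ∀ j r, Commute (z j) (φ r))
    (hzd : ∀ j i, Commute (z j) (d i))
    (hzz : ∀ j k, Commute (z j) (z k))

@[simp] theorem lift_coeff (r : R) :
    lift φ d z hdr hdd hzr hzd hzz (coeff δ τ r) = φ r := by
  exact (RingQuot.lift_mkRingHom_apply _ _ _).trans (by simp)

@[simp] theorem lift_der (i : ι) :
    lift φ d z hdr hdd hzr hzd hzz (der δ τ i) = d i := by
  exact (RingQuot.lift_mkRingHom_apply _ _ _).trans (by simp)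

@[simp] theorem lift_central (j : τ) :
    lift φ d z hdr hdd hzr hzd hzz (central δ τ j) = z j := by
  exact (RingQuot.lift_mkRingHom_apply _ _ _).trans (by simp)

end lift

/-- Base change `R⟨∂⟩[z] → R'⟨∂⟩[z]` along a ring homomorphism compatible with the derivations. -/
def map {k' R' : Type*} [CommRing k'] [CommRing R'] [Algebra k' R'] {δ' : ι → Derivation k' R' R'}
    (φ : R →+* R')
    (h : ∀ i r, φ (δ i r) = δ' i (φ r)) : DiffOp δ τ →+* DiffOp δ' τ :=
  lift ((coeff δ' τ).comp φ) (der δ' τ) (central δ' τ)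
    (fun i r => by simp [der_coeff, h]) der_comm (fun j r => central_coeff j _)
    central_der central_central

end DiffOp

/-! ### Extending derivations to localizations and to polynomial rings -/

namespace DerExt

variable {k : Type*} [CommRing k]

/-- The derivation `b ↦ (second component of φ b)`, where `φ` is a homomorphism to the dual
numbers whose first component is the identity. -/
def ofDual {B : Type*} [CommRing B] [Algebra k B] (φ : B →ₐ[k] DualNumber B)
    (h : ∀ b, (φ b).fst = b) : Derivation k B B :=
  Derivation.mk'
    { toFun := fun b => (φ b).snd
      map_add' := fun a b => by simp
      map_smul' := fun c b => by simp }
    (fun a b => by simp [TrivSqZeroExt.snd_mul, h, mul_comm])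

/-- `a ↦ a + D(a) ε`. -/
def toDual {A B : Type*} [CommRing A] [CommRing B] [Algebra k A] [Algebra k B] (ψ : A →ₐ[k] B)
    (D : Derivation k A A) : A →ₐ[k] DualNumber B where
  toFun a := TrivSqZeroExt.inl (ψ a) + TrivSqZeroExt.inr (ψ (D a))
  map_one' := by ext <;> simp
  map_mul' a b := by ext <;> simp [mul_comm, add_comm]
  map_zero' := by ext <;> simp
  map_add' a b := by ext <;> simp
  commutes' c := by ext <;> simp [TrivSqZeroExt.algebraMap_eq_inl']

variable {A : Type*} [CommRing A] [Algebra k A]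

/-- The homomorphism `M⁻¹A → M⁻¹A[ε]` extending `a ↦ a + D(a) ε`. -/
def locDual (M : Submonoid A) (D : Derivation k A A) :
    Localization M →ₐ[k] DualNumber (Localization M) :=
  IsLocalization.liftAlgHom (M := M) (f := toDual (IsScalarTower.toAlgHom k A (Localization M)) D)
    (by
      intro y
      rw [TrivSqZeroExt.isUnit_iff_isUnit_fst]
      simpa [toDual] using IsLocalization.map_units (Localization M) y)

theorem locDual_algebraMap (M : Submonoid A) (D : Derivation k A A) (a : A) :
    locDual M D (algebraMap A (Localization M) a) =
      toDual (IsScalarTower.toAlgHom k A (Localization M)) D a := by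
  simp [locDual]

theorem locDual_fst (M : Submonoid A) (D : Derivation k A A) (b : Localization M) :
    (locDual M D b).fst = b := by
  have : ((TrivSqZeroExt.fstHom k (Localization M) (Localization M)).comp
      (locDual M D)).toRingHom = RingHom.id (Localization M) := by
    apply IsLocalization.ringHom_ext M
    ext a
    simp [locDual_algebraMap, toDual]
  exact congrArg (fun g => g b) this

/-- The unique extension of a derivation of `A` to the localization of `A` at `M`. -/
def loc (M : Submonoid A) (D : Derivation k A A) :
    Derivation k (Localization M) (Localization M) :=
  ofDual (locDual M D) (locDual_fst M D)

@[simp] theorem loc_algebraMap (M : Submonoid A) (D : Derivation k A A) (a : A) :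
    loc M D (algebraMap A (Localization M) a) = algebraMap A (Localization M) (D a) := by
  change TrivSqZeroExt.snd (locDual M D _) = _
  rw [locDual_algebraMap]
  simp only [toDual, AlgHom.coe_mk, RingHom.coe_mk, MonoidHom.coe_mk, OneHom.coe_mk,
    TrivSqZeroExt.snd_add, TrivSqZeroExt.snd_inl, TrivSqZeroExt.snd_inr, zero_add]
  rfl

/-- A derivation of a localization is determined by its values on the image of `A`. -/
theorem loc_ext (M : Submonoid A) {D D' : Derivation k (Localization M) (Localization M)}
    (h : ∀ a : A, D (algebraMap A (Localization M) a) = D' (algebraMap A (Localization M) a)) :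
    D = D' := by
  ext b
  obtain ⟨⟨a, m⟩, hm⟩ := IsLocalization.surj M b
  have e := congrArg D hm
  have e' := congrArg D' hm
  simp only [Derivation.leibniz, smul_eq_mul, h] at e e'
  have hu := IsLocalization.map_units (Localization M) m
  have : algebraMap A (Localization M) m * D b = algebraMap A (Localization M) m * D' b := by
    linear_combination e - e'
  exact hu.mul_left_cancel this

theorem loc_comm (M : Submonoid A) {D D' : Derivation k A A} (h : ∀ a, D (D' a) = D' (D a))
    (b : Localization M) : loc M D (loc M D' b) = loc M D' (loc M D b) := by
  have : ⁅loc M D, loc M D'⁆ = 0 := by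
    apply loc_ext M
    intro a
    simp [Derivation.commutator_apply, h]
  have h2 := congrArg (fun E => E b) this
  simpa [Derivation.commutator_apply, sub_eq_zero] using h2

/-- The homomorphism `A[z] → A[z][ε]` extending `a ↦ a + D(a) ε` by `z_j ↦ z_j`. -/
def polyDual (τ : Type*) (D : Derivation k A A) :
    MvPolynomial τ A →ₐ[k] DualNumber (MvPolynomial τ A) where
  toRingHom := MvPolynomial.eval₂Hom
    (toDual (IsScalarTower.toAlgHom k A (MvPolynomial τ A)) D).toRingHom
    (fun j => TrivSqZeroExt.inl (MvPolynomial.X j))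
  commutes' c := by
    simp [IsScalarTower.algebraMap_apply k A (MvPolynomial τ A), MvPolynomial.algebraMap_eq, toDual,
      TrivSqZeroExt.algebraMap_eq_inl']

theorem polyDual_C (τ : Type*) (D : Derivation k A A) (a : A) :
    polyDual τ D (MvPolynomial.C a) = toDual (IsScalarTower.toAlgHom k A (MvPolynomial τ A)) D a :=
  MvPolynomial.eval₂_C _ _ _

theorem polyDual_X (τ : Type*) (D : Derivation k A A) (j : τ) :
    polyDual τ D (MvPolynomial.X j) = TrivSqZeroExt.inl (MvPolynomial.X j) :=
  MvPolynomial.eval₂_X _ _ _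

theorem polyDual_fst (τ : Type*) (D : Derivation k A A) (b : MvPolynomial τ A) :
    (polyDual τ D b).fst = b := by
  have : ((TrivSqZeroExt.fstHom k (MvPolynomial τ A) (MvPolynomial τ A)).comp
      (polyDual τ D)).toRingHom = RingHom.id _ := by
    apply MvPolynomial.ringHom_ext
    · intro a
      simp [polyDual_C, toDual, MvPolynomial.algebraMap_eq]
    · intro j
      simp [polyDual_X]
  exact congrArg (fun g => g b) this

/-- The extension of a derivation of `A` to `A[z_j (j : τ)]` that acts on the coefficients and
kills the indeterminates. -/
def poly (τ : Type*) (D : Derivation k A A) :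
    Derivation k (MvPolynomial τ A) (MvPolynomial τ A) :=
  ofDual (polyDual τ D) (polyDual_fst τ D)

@[simp] theorem poly_C (τ : Type*) (D : Derivation k A A) (a : A) :
    poly τ D (MvPolynomial.C a) = MvPolynomial.C (D a) := by
  change TrivSqZeroExt.snd (polyDual τ D _) = _
  rw [polyDual_C]
  simp [toDual, MvPolynomial.algebraMap_eq]

@[simp] theorem poly_X (τ : Type*) (D : Derivation k A A) (j : τ) :
    poly τ D (MvPolynomial.X j) = 0 := by
  change TrivSqZeroExt.snd (polyDual τ D _) = _
  rw [polyDual_X]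
  simp

theorem poly_ext {τ : Type*} {D D' : Derivation k (MvPolynomial τ A) (MvPolynomial τ A)}
    (hC : ∀ a, D (MvPolynomial.C a) = D' (MvPolynomial.C a))
    (hX : ∀ j, D (MvPolynomial.X j) = D' (MvPolynomial.X j)) : D = D' := by
  apply Derivation.ext
  intro p
  induction p using MvPolynomial.induction_on with
  | C a => exact hC a
  | add p q hp hq => rw [map_add, map_add, hp, hq]
  | mul_X p j hp => rw [Derivation.leibniz, Derivation.leibniz, hp, hX]

theorem poly_comm (τ : Type*) {D D' : Derivation k A A} (h : ∀ a, D (D' a) = D' (D a))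
    (p : MvPolynomial τ A) : poly τ D (poly τ D' p) = poly τ D' (poly τ D p) := by
  have : ⁅poly τ D, poly τ D'⁆ = 0 := by
    apply poly_ext
    · intro a
      simp [Derivation.commutator_apply, h]
    · intro j
      simp [Derivation.commutator_apply]
  have h2 := congrArg (fun E => E p) this
  simpa [Derivation.commutator_apply, sub_eq_zero] using h2

end DerExt

/-! ### The module generated by `f_1^{s_1} ⋯ f_d^{s_d}` -/

namespace ComplexPower

variable {k R : Type*} [CommRing k] [CommRing R] [Algebra k R] {ι : Type*}
  (δ : ι → Derivation k R R) {d : ℕ} (g : Fin d → R)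

/-- `R[1/g]` with `g = g_1 ⋯ g_d`. -/
abbrev Coeff : Type _ := Localization (Submonoid.powers (∏ j, g j))

/-- The free module `R[s, 1/g] ⋅ g_1^{s_1} ⋯ g_d^{s_d}` of rank one; the polynomial `h` stands for
the element `h ⋅ g_1^{s_1} ⋯ g_d^{s_d}`. -/
abbrev Mod : Type _ := MvPolynomial (Fin d) (Coeff g)

/-- The logarithmic derivative `δ_i(g_j) / g_j` in `R[1/g]`. -/
def logDer (i : ι) (j : Fin d) : Coeff g :=
  algebraMap R (Coeff g) (δ i (g j)) * Ring.inverse (algebraMap R (Coeff g) (g j))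

/-- `∑_j s_j δ_i(g_j) / g_j`. -/
def twist (i : ι) : Mod g := ∑ j, MvPolynomial.X j * MvPolynomial.C (logDer δ g i j)

/-- The action of `∂_i`:
`∂_i (h g^s) = (δ_i(h) + h ∑_j s_j δ_i(g_j) / g_j) g^s`, where `δ_i(s_j) = 0`. -/
def nabla (i : ι) : Module.End k (Mod g) :=
  (DerExt.poly (Fin d) (DerExt.loc (Submonoid.powers (∏ j, g j)) (δ i)) : Mod g →ₗ[k] Mod g) +
    LinearMap.mulLeft k (twist δ g i)

theorem nabla_apply (i : ι) (h : Mod g) :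
    nabla δ g i h = DerExt.poly (Fin d) (DerExt.loc (Submonoid.powers (∏ j, g j)) (δ i)) h +
      twist δ g i * h := rfl

theorem isUnit_algebraMap (j : Fin d) : IsUnit (algebraMap R (Coeff g) (g j)) := by
  have h : IsUnit (algebraMap R (Coeff g) (∏ j, g j)) :=
    IsLocalization.map_units (Coeff g) (⟨_, Submonoid.mem_powers _⟩ : Submonoid.powers (∏ j, g j))
  exact isUnit_of_dvd_unit (map_dvd _ (Finset.dvd_prod_of_mem g (Finset.mem_univ j))) h

/-- Integrability: `δ_i (δ_l(g_j) / g_j) = δ_l (δ_i(g_j) / g_j)`. -/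
theorem logDer_symm (hδ : ∀ i l r, δ i (δ l r) = δ l (δ i r)) (i l : ι) (j : Fin d) :
    DerExt.loc (Submonoid.powers (∏ j, g j)) (δ i) (logDer δ g l j) =
      DerExt.loc (Submonoid.powers (∏ j, g j)) (δ l) (logDer δ g i j) := by
  have hu := isUnit_algebraMap g j
  have h1 : Ring.inverse (algebraMap R (Coeff g) (g j)) * algebraMap R (Coeff g) (g j) = 1 :=
    Ring.inverse_mul_cancel _ hu
  simp only [logDer, Derivation.leibniz, Derivation.leibniz_of_mul_eq_one _ h1,
    DerExt.loc_algebraMap, hδ i l, smul_eq_mul]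
  ring

theorem nabla_comm (hδ : ∀ i l r, δ i (δ l r) = δ l (δ i r)) (i l : ι) :
    Commute (nabla δ g i) (nabla δ g l) := by
  have key : ∀ i l, DerExt.poly (Fin d) (DerExt.loc (Submonoid.powers (∏ j, g j)) (δ i))
      (twist δ g l) = DerExt.poly (Fin d) (DerExt.loc (Submonoid.powers (∏ j, g j)) (δ l))
      (twist δ g i) := by
    intro i l
    simp only [twist, map_sum, Derivation.leibniz, DerExt.poly_X, DerExt.poly_C, smul_zero,
      add_zero, logDer_symm δ g hδ i l]
  apply LinearMap.ext
  intro h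
  simp only [Module.End.mul_apply, nabla_apply, map_add, Derivation.leibniz, smul_eq_mul,
    key i l, DerExt.poly_comm (Fin d) (DerExt.loc_comm _ (hδ i l)) h]
  ring

/-- The action of `R⟨∂⟩[s]` on `R[s, 1/g] ⋅ g_1^{s_1} ⋯ g_d^{s_d}`. -/
def action (hδ : ∀ i l r, δ i (δ l r) = δ l (δ i r)) :
    DiffOp δ (Fin d) →+* Module.End k (Mod g) :=
  DiffOp.lift
    ((Algebra.lmul k (Mod g)).toRingHom.comp (MvPolynomial.C.comp (algebraMap R (Coeff g))))
    (nabla δ g)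
    (fun j => Algebra.lmul k (Mod g) (MvPolynomial.X j))
    (by
      intro i r
      apply LinearMap.ext
      intro h
      simp [nabla_apply]
      ring)
    (nabla_comm δ g hδ)
    (fun j r => (Commute.all _ _).map (Algebra.lmul k (Mod g)))
    (by
      intro j i
      apply LinearMap.ext
      intro h
      simp [nabla_apply]
      ring)
    (fun j l => (Commute.all _ _).map (Algebra.lmul k (Mod g)))

/-- The annihilator of `g_1^{s_1} ⋯ g_d^{s_d}` in `R⟨∂⟩[s]`, a left ideal. -/
def ann (hδ : ∀ i l r, δ i (δ l r) = δ l (δ i r)) : Ideal (DiffOp δ (Fin d)) where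
  carrier := {p | action δ g hδ p 1 = 0}
  zero_mem' := by simp
  add_mem' {p q} hp hq := by
    change action δ g hδ (p + q) 1 = 0
    rw [map_add, LinearMap.add_apply, show action δ g hδ p 1 = 0 from hp,
      show action δ g hδ q 1 = 0 from hq, add_zero]
  smul_mem' a p hp := by
    change action δ g hδ (a * p) 1 = 0
    rw [map_mul, Module.End.mul_apply, show action δ g hδ p 1 = 0 from hp, map_zero]

end ComplexPower

/-! ### Weyl algebras, normally ordered monomials, Gröbner bases -/

/-- The partial derivatives of `K[x_i (i : ι)]`. -/
abbrev partials (K ι : Type*) [Field K] (i : ι) :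
    Derivation K (MvPolynomial ι K) (MvPolynomial ι K) :=
  MvPolynomial.pderiv i

/-- The Weyl algebra `K[z_j (j : τ)]⟨x_i, ∂_i (i : ι)⟩` with commuting central indeterminates
`z_j` adjoined. -/
abbrev Weyl (K ι τ : Type*) [Field K] : Type _ := DiffOp (partials K ι) τ

namespace Weyl

variable {K ι τ : Type*} [Field K]

/-- A polynomial in `x`, as an operator. -/
abbrev fn (h : MvPolynomial ι K) : Weyl K ι τ := DiffOp.coeff (partials K ι) τ h

/-- The operator `∂_i`. -/
abbrev D (i : ι) : Weyl K ι τ := DiffOp.der (partials K ι) τ i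

/-- The central indeterminate `z_j`. -/
abbrev Z (j : τ) : Weyl K ι τ := DiffOp.central (partials K ι) τ j

/-- The indices of the variables `x_i`, `ξ_i`, `z_j` of the commutative polynomial ring
`gr = K[x, ξ, z]`, in this order. -/
abbrev GrVar (ι τ : Type*) : Type _ := (ι ⊕ ι) ⊕ τ

variable [Fintype ι] [Fintype τ]

/-- The term `k x^a ∂^b z^e` with the exponents `(a, b, e) = m` (normally ordered). -/
def term (m : GrVar ι τ →₀ ℕ) (k : K) : Weyl K ι τ :=
  fn (MvPolynomial.C k * ∏ i, MvPolynomial.X i ^ m (.inl (.inl i))) *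
    Finset.univ.noncommProd (fun i => D i ^ m (.inl (.inr i)))
      (fun i _ k _ _ => (DiffOp.der_comm i k).pow_pow _ _) *
    Finset.univ.noncommProd (fun j => Z j ^ m (.inr j))
      (fun j _ k _ _ => (DiffOp.central_central j k).pow_pow _ _)

/-- `c` lists the coefficients of the normally ordered representation of `p`. -/
def IsRepr (p : Weyl K ι τ) (c : (GrVar ι τ →₀ ℕ) →₀ K) : Prop :=
  c.sum term = p

/-- `m` is the exponent of the initial (highest) monomial in the normally ordered representation
`c`. -/
def IsTop (ord : MonomialOrder (GrVar ι τ)) (c : (GrVar ι τ →₀ ℕ) →₀ K)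
    (m : GrVar ι τ →₀ ℕ) : Prop :=
  m ∈ c.support ∧ ∀ m' ∈ c.support, m' ≼[ord] m

/-- `m` is the exponent of the initial monomial `in_<(p)` (so that `p ≠ 0`). -/
def IsInitial (ord : MonomialOrder (GrVar ι τ)) (p : Weyl K ι τ) (m : GrVar ι τ →₀ ℕ) : Prop :=
  ∃ c, IsRepr p c ∧ IsTop ord c m

/-- The ideal of `K[x, ξ, z]` generated by the initial monomials of the elements of `T`. -/
def initialIdeal (ord : MonomialOrder (GrVar ι τ)) (T : Set (Weyl K ι τ)) :
    Ideal (MvPolynomial (GrVar ι τ) K) :=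
  Ideal.span {q | ∃ p ∈ T, ∃ m, IsInitial ord p m ∧ q = MvPolynomial.monomial m 1}

/-- `G` is a Gröbner basis of the left ideal `I`. -/
def IsGroebner (ord : MonomialOrder (GrVar ι τ)) (I : Ideal (Weyl K ι τ))
    (G : Set (Weyl K ι τ)) : Prop :=
  G.Finite ∧ G ⊆ I ∧ initialIdeal ord G = initialIdeal ord (I : Set (Weyl K ι τ))

/-- `G` is interreduced with monic elements: each `p ∈ G` is nonzero with initial coefficient `1`,
and no monomial of `p` is divisible by the initial monomial of another element of `G`.  A Gröbner
basis with this property is the reduced one. -/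
def IsReduced (ord : MonomialOrder (GrVar ι τ)) (G : Set (Weyl K ι τ)) : Prop :=
  ∀ p ∈ G, ∃ c m, IsRepr p c ∧ IsTop ord c m ∧ c m = 1 ∧
    ∀ q ∈ G, q ≠ p → ∀ k, IsInitial ord q k → ∀ m' ∈ c.support, ¬ k ≤ m'

end Weyl

/-! ### The procedure -/

namespace Procedure

open Weyl

variable {K : Type*} [Field K] {n d : ℕ}

/-- `A_{n+d}`, in the variables `x_i` (index `.inl i`) and `t_j` (index `.inr j`). -/
abbrev A (K : Type*) [Field K] (n d : ℕ) : Type _ := Weyl K (Fin n ⊕ Fin d) Empty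

/-- `A_{n+d}[u, v]`, with `u_j` of index `.inl j` and `v_j` of index `.inr j`. -/
abbrev Auv (K : Type*) [Field K] (n d : ℕ) : Type _ :=
  Weyl K (Fin n ⊕ Fin d) (Fin d ⊕ Fin d)

/-- `A_n[s]`, with the central indeterminates `s_1, …, s_d`. -/
abbrev As (K : Type*) [Field K] (n d : ℕ) : Type _ := Weyl K (Fin n) (Fin d)

/-- The index set of the variables of the commutative ring associated with `A_{n+d}[u, v]`. -/
abbrev Var (n d : ℕ) : Type := GrVar (Fin n ⊕ Fin d) (Fin d ⊕ Fin d)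

/-- The inclusion of `A_{n+d}` into `A_{n+d}[u, v]`. -/
def incl : A K n d →+* Auv K n d :=
  DiffOp.lift (DiffOp.coeff _ _) (DiffOp.der _ _) Empty.elim DiffOp.der_coeff DiffOp.der_comm
    (fun j => j.elim) (fun j => j.elim) (fun j => j.elim)

/-- A polynomial in `x`, viewed as a polynomial in `(x, t)`. -/
abbrev inX (h : MvPolynomial (Fin n) K) : MvPolynomial (Fin n ⊕ Fin d) K :=
  MvPolynomial.rename Sum.inl h

/-- The left ideal `I` of `A_{n+d}[u, v]` generated by
`t_j - u_j f_j`, `∂_{x_i} + ∑_j (∂f_j/∂x_i) u_j ∂_{t_j}` and `1 - u_j v_j`. -/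
def ideal (f : Fin d → MvPolynomial (Fin n) K) : Ideal (Auv K n d) :=
  Ideal.span
    (Set.range (fun j : Fin d =>
        fn (MvPolynomial.X (.inr j)) - Z (.inl j) * fn (inX (f j))) ∪
      Set.range (fun i : Fin n =>
        D (.inl i) + ∑ j, fn (inX (MvPolynomial.pderiv i (f j))) * Z (.inl j) * D (.inr j)) ∪
      Set.range (fun j : Fin d => 1 - Z (.inl j) * Z (.inr j)))

/-- `ord` is an order for eliminating `u, v`: a monomial that contains some `u_j` or `v_j` is
greater than each monomial that contains none. -/
def Eliminates (ord : MonomialOrder (Var n d)) : Prop :=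
  ∀ m m' : Var n d →₀ ℕ, (∀ j, m (.inr j) = 0) → (∃ j, m' (.inr j) ≠ 0) → m ≺[ord] m'

/-- The weight of the monomial with exponents `m` for the `j`-th weight table: `t_j` and `u_j`
have weight `-1`, `∂_{t_j}` and `v_j` have weight `1`, all other variables have weight `0`. -/
def weight (j : Fin d) (m : Var n d →₀ ℕ) : ℤ :=
  -(m (.inl (.inl (.inr j))) : ℤ) + m (.inl (.inr (.inr j))) - m (.inr (.inl j)) +
    m (.inr (.inr j))

/-- All monomials in the normally ordered representation of `P` have the same `j`-th weight, for
every `j`. -/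
def IsHomogeneous (P : Auv K n d) : Prop :=
  ∃ c, IsRepr P c ∧ ∀ j, ∃ w : ℤ, ∀ m ∈ c.support, weight j m = w

/-- `S_{j,ν}`: it is `∂_{t_j}^ν` if `ν ≥ 0` and `t_j^{-ν}` otherwise. -/
def S (j : Fin d) (ν : ℤ) : A K n d :=
  if 0 ≤ ν then D (.inr j) ^ ν.toNat else fn (MvPolynomial.X (.inr j)) ^ (-ν).toNat

/-- `S_{1,ν_1} ⋯ S_{d,ν_d}`. -/
def prodS (ν : Fin d → ℤ) : A K n d := (List.ofFn fun j => S j (ν j)).prod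

theorem D_fn {ι τ : Type*} (i : ι) (h : MvPolynomial ι K) :
    (D i * fn h : Weyl K ι τ) = fn h * D i + fn (MvPolynomial.pderiv i h) :=
  DiffOp.der_coeff i h

theorem D_fn_comm {ι τ : Type*} (i : ι) (h : MvPolynomial ι K) (h0 : MvPolynomial.pderiv i h = 0) :
    Commute (D i : Weyl K ι τ) (fn h) := by
  have e := D_fn (τ := τ) i h
  rw [h0, show (fn 0 : Weyl K ι τ) = 0 from map_zero (DiffOp.coeff (partials K ι) τ),
    add_zero] at e
  exact e

/-- The substitution `Q(x, ∂_x, s) ↦ Q(x, ∂_x, t_1 ∂_{t_1}, …, t_d ∂_{t_d})`. -/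
def euler : As K n d →+* A K n d :=
  DiffOp.lift
    ((DiffOp.coeff _ _).comp (MvPolynomial.rename Sum.inl :
      MvPolynomial (Fin n) K →ₐ[K] MvPolynomial (Fin n ⊕ Fin d) K).toRingHom)
    (fun i => D (.inl i))
    (fun j => fn (MvPolynomial.X (.inr j)) * D (.inr j))
    (by
      intro i r
      have h := D_fn (τ := Empty) (K := K) (.inl i : Fin n ⊕ Fin d) (inX r)
      rw [MvPolynomial.pderiv_rename Sum.inl_injective] at h
      exact h)
    (fun i k => DiffOp.der_comm _ _)
    (by
      intro j r
      have h0 : MvPolynomial.pderiv (.inr j : Fin n ⊕ Fin d) (inX r) = 0 := by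
        apply MvPolynomial.pderiv_eq_zero_of_notMem_vars
        intro hm
        have := MvPolynomial.vars_rename Sum.inl r hm
        simp at this
      refine Commute.mul_left ?_ (D_fn_comm _ _ h0)
      exact (Commute.all _ _).map (DiffOp.coeff (partials K _) Empty))
    (by
      intro j i
      refine Commute.mul_left ?_ (DiffOp.der_comm _ _)
      exact (D_fn_comm _ _ (MvPolynomial.pderiv_X_of_ne (by simp))).symm)
    (by
      intro j k
      by_cases hjk : j = k
      · subst hjk
        exact Commute.refl _
      · have h : ∀ j k : Fin d, j ≠ k → Commute (D (.inr j) : A K n d)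
            (fn (MvPolynomial.X (.inr k))) := by
          intro j k hjk
          exact D_fn_comm _ _ (MvPolynomial.pderiv_X_of_ne (by simpa using Ne.symm hjk))
        refine Commute.mul_left (Commute.mul_right ?_ (h k j (Ne.symm hjk)).symm)
          (Commute.mul_right (h j k hjk) (DiffOp.der_comm _ _))
        exact (Commute.all _ _).map (DiffOp.coeff (partials K _) Empty))

/-- The substitution `Q(x, ∂_x, s) ↦ Q(x, ∂_x, -s_1-1, …, -s_d-1)`. -/
def reflect : As K n d →+* As K n d :=
  DiffOp.lift (DiffOp.coeff _ _) (DiffOp.der _ _) (fun j => -Z j - 1)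
    DiffOp.der_coeff DiffOp.der_comm
    (fun j r => ((DiffOp.central_coeff j r).neg_left).sub_left (Commute.one_left _))
    (fun j i => ((DiffOp.central_der j i).neg_left).sub_left (Commute.one_left _))
    (fun j k => ((((DiffOp.central_central j k).neg_left).sub_left
      (Commute.one_left _)).neg_right).sub_right (Commute.one_right _))

/-! The annihilator is a sheaf on affine `n`-space `X` over `L ⊇ K`.  Its sections over a principal
open set and its stalks are obtained by localizing `L[x]` at a submonoid `T`: `T = {1}` gives the
global sections, the powers of `h` give the sections over `h ≠ 0`, and the complement of a prime
ideal gives the stalk at this prime. -/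

section Local

variable (L : Type*) [Field L]

/-- The partial derivatives of the localization of `L[x]` at `T`. -/
def locPartials (T : Submonoid (MvPolynomial (Fin n) L)) (i : Fin n) :
    Derivation L (Localization T) (Localization T) :=
  DerExt.loc T (partials L (Fin n) i)

theorem partials_comm {ι : Type*} (i k : ι) (h : MvPolynomial ι L) :
    partials L ι i (partials L ι k h) = partials L ι k (partials L ι i h) := by
  have : ⁅partials L ι i, partials L ι k⁆ = 0 := by
    classical
    apply MvPolynomial.derivation_ext
    intro j
    rw [Derivation.commutator_apply]
    simp [MvPolynomial.pderiv_X, Pi.single_apply, apply_ite]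
  have h2 := congrArg (fun E : Derivation L (MvPolynomial ι L) (MvPolynomial ι L) => E h) this
  simpa [Derivation.commutator_apply, sub_eq_zero] using h2

variable {L}

theorem locPartials_comm (T : Submonoid (MvPolynomial (Fin n) L)) (i k : Fin n)
    (h : Localization T) :
    locPartials L T i (locPartials L T k h) = locPartials L T k (locPartials L T i h) :=
  DerExt.loc_comm T (partials_comm L i k) h

/-- The sections of `𝒟_X[s]` over the localization of `L[x]` at `T`. -/
abbrev DXs (T : Submonoid (MvPolynomial (Fin n) L)) (d : ℕ) : Type _ :=
  DiffOp (locPartials L T) (Fin d)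

variable [Algebra K L] (T : Submonoid (MvPolynomial (Fin n) L))

/-- The homomorphism `K[x] → L[x] → T⁻¹ L[x]`. -/
def toLoc : MvPolynomial (Fin n) K →+* Localization T :=
  (algebraMap (MvPolynomial (Fin n) L) (Localization T)).comp
    (MvPolynomial.map (algebraMap K L))

/-- The restriction homomorphism from `A_n[s]` (over `K`) to the sections of `𝒟_X[s]`. -/
def toDXs : As K n d →+* DXs T d :=
  DiffOp.map (toLoc T) (by
    intro i r
    simp [toLoc, locPartials, partials, MvPolynomial.pderiv_map])

/-- The sections of the annihilator `ℐ(s)` of `f_1^{s_1} ⋯ f_d^{s_d}` over the localization of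
`L[x]` at `T`. -/
def annihilator (f : Fin d → MvPolynomial (Fin n) K) : Ideal (DXs T d) :=
  ComplexPower.ann (locPartials L T) (fun j => toLoc T (f j)) (locPartials_comm T)

end Local

end Procedure

end

/-! Malgrange's description of `f^s`: on `R[s, 1/f] f^s` the algebra `A_{n+d}` acts by `t_j h(s) f^s
= h(s + e_j) f_j f^s` and `∂_{t_j} h(s) f^s = -s_j h(s - e_j) f_j⁻¹ f^s`, so that `t_j ∂_{t_j}` acts
as `-s_j - 1`. The generators `t_j - f_j` and `∂_{x_i} + ∑_j (∂f_j/∂x_i) ∂_{t_j}` of `graphIdeal f`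
kill `f^s`. Every `P ∈ G_0` lies in the graph ideal (put `u = v = 1`), hence so does `S_ν P = Q_P(x,
∂_x, t ∂_t)`, and `Q_P(x, ∂_x, -s - 1)` annihilates `f^s` (`map_reflect_mem_ann`).

Conversely, let `p` annihilate `f^s`. (a) Descent to `K[x]` (`exists_eq_sum_of_mem_ann`). Write `p =
∑ r_i b_i` with `r_i ∈ R` and `b_i ∈ A_n[s]`. Modulo the graph ideal each `b_i`, with `-t_j ∂_{t_j}
- 1` put for `s_j`, is congruent to some `H_i ∈ K[x][∂_t]`. In characteristic zero `R[∂_t]` acts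
faithfully on `f^s`, whence `∑ r_i H_i = 0`. Since `K[x] → R` is flat, this relation comes from
relations over `K[x]`, and `p` becomes an `R`-combination of operators over `K` whose substitutions
lie in the graph ideal. (b) Homogenization (`incl_euler_mem`). An element of the graph ideal that is
a polynomial in `x, ∂_x, t_j ∂_{t_j}` lies in `I`: modulo `I` the substitution `t_j ↦ t_j v_j`,
`∂_{t_j} ↦ ∂_{t_j} u_j` leaves it alone and turns the graph relations into those of `I`. (c)
Elimination (`mem_span_of_incl_mem`). By division, `G_0` generates `I ∩ A_{n+d}`. (d) Weight zero
(`mem_span_of_euler_mem_span`). Each `P ∈ G_0` has weight `-ν_P`, so in `∑ a_P P` of weight zero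
only the components of the `a_P` of weight `ν_P` count. These are `b_P(x, ∂_x, t ∂_t) S_{ν_P}` by
`exists_component_eq`, and the sum becomes `∑ b_P Q_P`. The substitution `s_j ↦ t_j ∂_{t_j}` is
injective (`euler_injective`), so the identity holds in `A_n[s]`.

For (1), an operator of weight `g` becomes one of weight zero after multiplication by `S_{-g}`. The
reduced basis is homogeneous because `I` has homogeneous generators, so the part of `P ∈ G` of
weight other than that of its initial monomial lies in `I` and has to vanish by interreduction.

The division arguments rest on the Poincaré–Birkhoff–Witt theorem, obtained from the action of the
Weyl algebra on the polynomial ring of full symbols. -/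

open scoped MonomialOrder

noncomputable section

/-! ### Induction principles and homomorphisms -/

namespace DiffOp

variable {k R : Type*} [CommRing k] [CommRing R] [Algebra k R] {ι : Type*}
  {δ : ι → Derivation k R R} {τ : Type*}

/-- A property of operators that is additive and stable under left multiplication by the
generators holds for all operators if it holds for `1`. -/
theorem induction_left {motive : DiffOp δ τ → Prop} (one : motive 1)
    (add : ∀ p q, motive p → motive q → motive (p + q))
    (coeff_mul : ∀ r p, motive p → motive (coeff δ τ r * p))
    (der_mul : ∀ i p, motive p → motive (der δ τ i * p))
    (central_mul : ∀ j p, motive p → motive (central δ τ j * p)) (p : DiffOp δ τ) : motive p := by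
  let π : FreeAlgebra ℤ (Gen R ι τ) →+* DiffOp δ τ := RingQuot.mkRingHom (Rel δ τ)
  -- Quantifying over the right factor `q` makes the product case of the induction on words a
  -- composition of left multiplications.
  suffices h : ∀ a : FreeAlgebra ℤ (Gen R ι τ), ∀ q : DiffOp δ τ, motive q → motive (π a * q) by
    obtain ⟨a, rfl⟩ : ∃ a, π a = p := RingQuot.mkRingHom_surjective (Rel δ τ) p
    have h1 := h a 1 one
    rwa [mul_one] at h1
  intro a
  induction a using FreeAlgebra.induction with
  | grade0 n =>
    intro q hq
    have h1 := coeff_mul n q hq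
    rwa [map_intCast, ← map_intCast π, ← eq_intCast (algebraMap ℤ (FreeAlgebra ℤ (Gen R ι τ)))]
      at h1
  | grade1 g =>
    intro q hq
    cases g with
    | coeff r => exact coeff_mul r q hq
    | der i => exact der_mul i q hq
    | central j => exact central_mul j q hq
  | mul a b ha hb =>
    intro q hq
    rw [map_mul, mul_assoc]
    exact ha _ (hb q hq)
  | add a b ha hb =>
    intro q hq
    rw [map_add, add_mul]
    exact add _ _ (ha q hq) (hb q hq)

theorem ringHom_ext {E : Type*} [Ring E] {f g : DiffOp δ τ →+* E}
    (hr : ∀ r, f (coeff δ τ r) = g (coeff δ τ r)) (hd : ∀ i, f (der δ τ i) = g (der δ τ i))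
    (hz : ∀ j, f (central δ τ j) = g (central δ τ j)) : f = g := by
  ext p
  induction p using induction_left with
  | one => simp
  | add p q hp hq => rw [map_add, map_add, hp, hq]
  | coeff_mul r p hp => rw [map_mul, map_mul, hr, hp]
  | der_mul i p hp => rw [map_mul, map_mul, hd, hp]
  | central_mul j p hp => rw [map_mul, map_mul, hz, hp]

end DiffOp

/-- Evaluation of polynomials at commuting elements of a ring. -/
theorem MvPolynomial.exists_ringHom_of_commute {R E σ : Type*} [CommRing R] [Ring E]
    (φ : R →+* E) (x : σ → E) (hφ : ∀ i r, Commute (x i) (φ r))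
    (hx : ∀ i k, Commute (x i) (x k)) :
    ∃ Ψ : MvPolynomial σ R →+* E, (∀ r, Ψ (MvPolynomial.C r) = φ r) ∧
      ∀ i, Ψ (MvPolynomial.X i) = x i := by
  have hcomm : ∀ a ∈ Set.range φ ∪ Set.range x, ∀ b ∈ Set.range φ ∪ Set.range x,
      a * b = b * a := by
    rintro _ (⟨r, rfl⟩ | ⟨i, rfl⟩) _ (⟨r', rfl⟩ | ⟨i', rfl⟩)
    · rw [← map_mul, ← map_mul, mul_comm]
    · exact (hφ i' r).eq.symm
    · exact (hφ i r').eq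
    · exact (hx i i').eq
  -- Pairwise commuting elements generate a commutative subring, where the usual evaluation
  -- homomorphism exists.
  let _ : CommRing (Subring.closure (Set.range φ ∪ Set.range x)) :=
    { (inferInstance : Ring (Subring.closure (Set.range φ ∪ Set.range x))) with
      mul_comm := (Subring.isMulCommutative_closure hcomm).is_comm.comm }
  let φ' : R →+* Subring.closure (Set.range φ ∪ Set.range x) :=
    φ.codRestrict _ fun r => Subring.subset_closure (Or.inl ⟨r, rfl⟩)
  let x' : σ → Subring.closure (Set.range φ ∪ Set.range x) :=
    fun i => ⟨x i, Subring.subset_closure (Or.inr ⟨i, rfl⟩)⟩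
  refine ⟨(Subring.subtype _).comp (MvPolynomial.eval₂Hom φ' x'), fun r => ?_, fun i => ?_⟩
  · rw [RingHom.comp_apply, MvPolynomial.coe_eval₂Hom, MvPolynomial.eval₂_C]
    rfl
  · rw [RingHom.comp_apply, MvPolynomial.coe_eval₂Hom, MvPolynomial.eval₂_X]
    rfl

namespace Weyl

variable {K ι τ : Type*} [Field K]

theorem fn_one : (fn 1 : Weyl K ι τ) = 1 := map_one _

theorem fn_zero : (fn 0 : Weyl K ι τ) = 0 := map_zero _

theorem fn_add (r r' : MvPolynomial ι K) : (fn (r + r') : Weyl K ι τ) = fn r + fn r' :=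
  map_add _ _ _

theorem fn_mul (r r' : MvPolynomial ι K) : (fn (r * r') : Weyl K ι τ) = fn r * fn r' :=
  map_mul _ _ _

theorem fn_comm (r r' : MvPolynomial ι K) : Commute (fn r : Weyl K ι τ) (fn r') :=
  (Commute.all r r').map (DiffOp.coeff _ _)

theorem induction_left {motive : Weyl K ι τ → Prop} (one : motive 1)
    (add : ∀ p q, motive p → motive q → motive (p + q))
    (C_mul : ∀ k p, motive p → motive (fn (MvPolynomial.C k) * p))
    (X_mul : ∀ i p, motive p → motive (fn (MvPolynomial.X i) * p))
    (D_mul : ∀ i p, motive p → motive (D i * p))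
    (Z_mul : ∀ j p, motive p → motive (Z j * p)) (p : Weyl K ι τ) : motive p := by
  induction p using DiffOp.induction_left with
  | one => exact one
  | add p q hp hq => exact add p q hp hq
  | coeff_mul r p hp =>
    induction r using MvPolynomial.induction_on generalizing p with
    | C k => exact C_mul k p hp
    | add r r' h h' =>
      rw [map_add, add_mul]
      exact add _ _ (h p hp) (h' p hp)
    | mul_X r i h =>
      rw [map_mul, mul_assoc]
      exact h _ (X_mul i p hp)
  | der_mul i p hp => exact D_mul i p hp
  | central_mul j p hp => exact Z_mul j p hp

/-- Universal property of the Weyl algebra in terms of the canonical commutation relations. -/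
theorem exists_ringHom {E : Type*} [Ring E] (κ : K →+* E) (x d : ι → E) (z : τ → E)
    (hxκ : ∀ i c, Commute (x i) (κ c)) (hdκ : ∀ i c, Commute (d i) (κ c))
    (hzκ : ∀ j c, Commute (z j) (κ c))
    (hxx : ∀ i k, Commute (x i) (x k)) (hdd : ∀ i k, Commute (d i) (d k))
    (hdx : ∀ i, d i * x i = x i * d i + 1) (hdx' : ∀ i k, i ≠ k → Commute (d i) (x k))
    (hzx : ∀ j i, Commute (z j) (x i)) (hzd : ∀ j i, Commute (z j) (d i))
    (hzz : ∀ j k, Commute (z j) (z k)) :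
    ∃ Ψ : Weyl K ι τ →+* E, (∀ c, Ψ (fn (MvPolynomial.C c)) = κ c) ∧
      (∀ i, Ψ (fn (MvPolynomial.X i)) = x i) ∧ (∀ i, Ψ (D i) = d i) ∧ ∀ j, Ψ (Z j) = z j := by
  classical
  obtain ⟨φ, hφC, hφX⟩ := MvPolynomial.exists_ringHom_of_commute κ x hxκ hxx
  refine ⟨DiffOp.lift φ d z ?_ hdd ?_ hzd hzz, ?_, ?_, ?_, ?_⟩
  -- The relation for a general coefficient follows from those for the variables by Leibniz's rule.
  · intro i r
    induction r using MvPolynomial.induction_on with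
    | C c => rw [hφC, (hdκ i c).eq]; simp
    | add r r' h h' => simp only [map_add, mul_add, add_mul, h, h']; abel
    | mul_X r k h =>
      rw [Derivation.leibniz, MvPolynomial.pderiv_X, map_mul, hφX, ← mul_assoc, h, map_add,
        smul_eq_mul, smul_eq_mul, map_mul, mul_comm (MvPolynomial.X k), map_mul, hφX, add_mul]
      by_cases hik : i = k
      · subst hik
        rw [mul_assoc, hdx]
        simp [mul_add, mul_assoc, add_assoc]
      · rw [mul_assoc, (hdx' i k hik).eq]
        simp [Ne.symm hik, mul_assoc]
  · intro j r
    induction r using MvPolynomial.induction_on with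
    | C c => rw [hφC]; exact hzκ j c
    | add r r' h h' => rw [map_add]; exact h.add_right h'
    | mul_X r k h => rw [map_mul, hφX]; exact h.mul_right (hzx j k)
  · intro c; rw [DiffOp.lift_coeff, hφC]
  · intro i; rw [DiffOp.lift_coeff, hφX]
  · intro i; rw [DiffOp.lift_der]
  · intro j; rw [DiffOp.lift_central]

end Weyl

/-! ### The symbol of an operator and the Poincaré–Birkhoff–Witt theorem -/

namespace Weyl

variable {K ι τ : Type*} [Field K]

theorem partials_comm' {σ : Type*} (i k : σ) (h : MvPolynomial σ K) :
    MvPolynomial.pderiv i (MvPolynomial.pderiv k h) =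
      MvPolynomial.pderiv k (MvPolynomial.pderiv i h) :=
  Procedure.partials_comm K i k h

/-- The Weyl algebra acts on `K[x, ξ, z]`: `x_i` and `z_j` by multiplication and `∂_i` by
`ξ_i + ∂/∂x_i`. -/
def rep : Weyl K ι τ →+* Module.End K (MvPolynomial (GrVar ι τ) K) :=
  DiffOp.lift
    ((Algebra.lmul K (MvPolynomial (GrVar ι τ) K)).toRingHom.comp
      (MvPolynomial.rename (fun i => .inl (.inl i)) :
        MvPolynomial ι K →ₐ[K] MvPolynomial (GrVar ι τ) K).toRingHom)
    (fun i => LinearMap.mulLeft K (MvPolynomial.X (.inl (.inr i)) : MvPolynomial (GrVar ι τ) K) +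
      (MvPolynomial.pderiv (.inl (.inl i)) :
        Derivation K (MvPolynomial (GrVar ι τ) K) (MvPolynomial (GrVar ι τ) K)).toLinearMap)
    (fun j => LinearMap.mulLeft K (MvPolynomial.X (.inr j) : MvPolynomial (GrVar ι τ) K))
    (by
      intro i r
      apply LinearMap.ext
      intro h
      have hinj : Function.Injective (fun i : ι => (.inl (.inl i) : GrVar ι τ)) :=
        fun a b hab => by simpa using hab
      have := MvPolynomial.pderiv_rename hinj i r
      simp [this]
      ring)
    (by
      intro i k
      apply LinearMap.ext
      intro h
      have := partials_comm' (K := K) (.inl (.inl i) : GrVar ι τ) (.inl (.inl k)) h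
      simp [Module.End.mul_apply, MvPolynomial.pderiv_X_of_ne, this]
      ring)
    (by
      intro j r
      apply LinearMap.ext
      intro h
      simp
      ring)
    (by
      intro j i
      apply LinearMap.ext
      intro h
      simp [Module.End.mul_apply, MvPolynomial.pderiv_X_of_ne]
      ring)
    (by
      intro j k
      apply LinearMap.ext
      intro h
      simp
      ring)

theorem rep_fn (r : MvPolynomial ι K) (h : MvPolynomial (GrVar ι τ) K) :
    rep (fn r) h = MvPolynomial.rename (fun i => .inl (.inl i)) r * h :=
  LinearMap.congr_fun (DiffOp.lift_coeff _ _ _ _ _ _ _ _ r) h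

theorem rep_D (i : ι) (h : MvPolynomial (GrVar ι τ) K) :
    rep (D i) h = MvPolynomial.X (.inl (.inr i)) * h + MvPolynomial.pderiv (.inl (.inl i)) h :=
  LinearMap.congr_fun (DiffOp.lift_der _ _ _ _ _ _ _ _ i) h

theorem rep_Z (j : τ) (h : MvPolynomial (GrVar ι τ) K) :
    rep (Z j) h = MvPolynomial.X (.inr j) * h :=
  LinearMap.congr_fun (DiffOp.lift_central _ _ _ _ _ _ _ _ j) h

/-- The full symbol: `x^a ∂^b z^e ↦ x^a ξ^b z^e`. -/
def symbol : Weyl K ι τ →+ MvPolynomial (GrVar ι τ) K where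
  toFun p := rep p 1
  map_zero' := by simp
  map_add' p q := by simp

theorem symbol_apply (p : Weyl K ι τ) : symbol p = rep p 1 := rfl

theorem symbol_mul (p q : Weyl K ι τ) : symbol (p * q) = rep p (symbol q) := by
  rw [symbol_apply, map_mul, Module.End.mul_apply, symbol_apply]

section Fintype

variable [Fintype ι] [Fintype τ]

/-- `∂^a`. -/
def dprod (a : ι → ℕ) : Weyl K ι τ :=
  Finset.univ.noncommProd (fun i => D i ^ a i)
      (fun i _ k _ _ => (DiffOp.der_comm i k).pow_pow _ _)

/-- `z^a`. -/
def zprod (a : τ → ℕ) : Weyl K ι τ :=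
  Finset.univ.noncommProd (fun j => Z j ^ a j)
      (fun j _ k _ _ => (DiffOp.central_central j k).pow_pow _ _)

theorem term_eq (m : GrVar ι τ →₀ ℕ) (k : K) :
    term m k = fn (MvPolynomial.C k * ∏ i, MvPolynomial.X i ^ m (.inl (.inl i))) *
      dprod (fun i => m (.inl (.inr i))) * zprod (fun j => m (.inr j)) := rfl

/-- Both sides are images of ordinary monomials under the evaluation `ℤ[X] → E` at the commuting
`y_k`, so the identity may be checked in a commutative ring. -/
theorem noncommProd_pow_add_single {E κ : Type*} [Ring E] [Fintype κ] [DecidableEq κ] (y : κ → E)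
    (hy : ∀ i k, Commute (y i) (y k)) (a : κ → ℕ) (i : κ)
    (h : (↑(Finset.univ : Finset κ) : Set κ).Pairwise
      (Function.onFun Commute fun k => y k ^ (a + (Pi.single i 1 : κ → ℕ)) k))
    (h' : (↑(Finset.univ : Finset κ) : Set κ).Pairwise
      (Function.onFun Commute fun k => y k ^ a k)) :
    Finset.univ.noncommProd (fun k => y k ^ (a + (Pi.single i 1 : κ → ℕ)) k) h =
      y i * Finset.univ.noncommProd (fun k => y k ^ a k) h' := by
  obtain ⟨Ψ, -, hΨ⟩ := MvPolynomial.exists_ringHom_of_commute (Int.castRingHom E) y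
    (fun i r => (Int.commute_cast (y i) r)) hy
  have key : ∀ (b : κ → ℕ) (h : (↑(Finset.univ : Finset κ) : Set κ).Pairwise
      (Function.onFun Commute fun k => y k ^ b k)),
      Finset.univ.noncommProd (fun k => y k ^ b k) h = Ψ (∏ k, MvPolynomial.X k ^ b k) := by
    intro b h
    have h1 := Finset.map_noncommProd Finset.univ
      (fun k => (MvPolynomial.X k : MvPolynomial κ ℤ) ^ b k) (fun _ _ _ _ _ => Commute.all _ _) Ψ
    rw [Finset.noncommProd_eq_prod] at h1
    rw [h1]
    simp only [map_pow, hΨ]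
  rw [key, key, ← hΨ, ← map_mul]
  congr 1
  simp only [Pi.add_apply, pow_add, Finset.prod_mul_distrib]
  rw [mul_comm]
  congr 1
  rw [Finset.prod_eq_single i] <;> simp +contextual

theorem dprod_zero : (dprod 0 : Weyl K ι τ) = 1 := by
  refine (Finset.noncommProd_congr rfl (fun i _ => pow_zero _) _).trans ?_
  exact (Finset.noncommProd_eq_pow_card _ _ _ 1 (fun _ _ => rfl)).trans (one_pow _)

theorem zprod_zero : (zprod 0 : Weyl K ι τ) = 1 := by
  refine (Finset.noncommProd_congr rfl (fun i _ => pow_zero _) _).trans ?_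
  exact (Finset.noncommProd_eq_pow_card _ _ _ 1 (fun _ _ => rfl)).trans (one_pow _)

theorem D_mul_dprod [DecidableEq ι] (i : ι) (a : ι → ℕ) :
    (D i * dprod a : Weyl K ι τ) = dprod (a + Pi.single i 1) :=
  (noncommProd_pow_add_single _ DiffOp.der_comm a i _ _).symm

theorem Z_mul_zprod [DecidableEq τ] (j : τ) (a : τ → ℕ) :
    (Z j * zprod a : Weyl K ι τ) = zprod (a + Pi.single j 1) :=
  (noncommProd_pow_add_single _ DiffOp.central_central a j _ _).symm

theorem Z_comm_dprod (j : τ) (a : ι → ℕ) : Commute (Z j : Weyl K ι τ) (dprod a) :=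
  Finset.noncommProd_commute _ _ _ _ fun i _ => (DiffOp.central_der j i).pow_right _

theorem term_add (m : GrVar ι τ →₀ ℕ) (k k' : K) :
    (term m (k + k') : Weyl K ι τ) = term m k + term m k' := by
  simp only [term_eq, map_add, add_mul]

theorem term_zero (m : GrVar ι τ →₀ ℕ) : (term m (0 : K) : Weyl K ι τ) = 0 := by
  simp [term_eq]

/-- The additive map `c ↦ ∑ c_m x^a ∂^b z^e`. -/
def ofRepr : ((GrVar ι τ →₀ ℕ) →₀ K) →+ Weyl K ι τ where
  toFun c := c.sum term
  map_zero' := Finsupp.sum_zero_index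
  map_add' _ _ := Finsupp.sum_add_index' term_zero term_add

theorem fn_mul_dprod_mul_zprod_mem (r : MvPolynomial ι K) (a : ι → ℕ) (e : τ → ℕ) :
    (fn r * dprod a * zprod e : Weyl K ι τ) ∈ (ofRepr (K := K) (ι := ι) (τ := τ)).range := by
  induction r using MvPolynomial.induction_on' with
  | monomial u k =>
    refine ⟨Finsupp.single (Finsupp.sumElim (Finsupp.sumElim u (Finsupp.equivFunOnFinite.symm a))
      (Finsupp.equivFunOnFinite.symm e)) k, ?_⟩
    change Finsupp.sum _ _ = _
    rw [Finsupp.sum_single_index (term_zero _), term_eq, MvPolynomial.monomial_eq,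
      Finsupp.prod_fintype _ _ (by simp)]
    simp
  | add p q hp hq =>
    rw [show (fn (p + q) : Weyl K ι τ) = fn p + fn q from map_add _ _ _, add_mul, add_mul]
    exact add_mem hp hq

/-- Existence half of the Poincaré–Birkhoff–Witt theorem: the additive group spanned by the normally
ordered products `r ∂^a z^e` contains `1` and is stable under left multiplication by the generators.
-/
theorem exists_isRepr (p : Weyl K ι τ) : ∃ c, IsRepr p c := by
  classical
  suffices h : p ∈ AddSubgroup.closure {q : Weyl K ι τ | ∃ r a e, q = fn r * dprod a * zprod e} by
    have h1 : AddSubgroup.closure {q : Weyl K ι τ | ∃ r a e, q = fn r * dprod a * zprod e} ≤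
        (ofRepr (K := K) (ι := ι) (τ := τ)).range := by
      rw [AddSubgroup.closure_le]
      rintro _ ⟨r, a, e, rfl⟩
      exact fn_mul_dprod_mul_zprod_mem r a e
    exact h1 h
  have key : ∀ g : Weyl K ι τ, (∀ r a e, g * (fn r * dprod a * zprod e) ∈
      AddSubgroup.closure {q : Weyl K ι τ | ∃ r a e, q = fn r * dprod a * zprod e}) →
      ∀ p ∈ AddSubgroup.closure {q : Weyl K ι τ | ∃ r a e, q = fn r * dprod a * zprod e},
      g * p ∈ AddSubgroup.closure {q : Weyl K ι τ | ∃ r a e, q = fn r * dprod a * zprod e} := by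
    intro g hg p hp
    induction hp using AddSubgroup.closure_induction with
    | mem x hx => obtain ⟨r, a, e, rfl⟩ := hx; exact hg r a e
    | zero => simp
    | add x y _ _ hx hy => rw [mul_add]; exact add_mem hx hy
    | neg x _ hx => rw [mul_neg]; exact neg_mem hx
  induction p using DiffOp.induction_left with
  | one =>
    refine AddSubgroup.subset_closure ⟨1, 0, 0, ?_⟩
    rw [dprod_zero, zprod_zero, fn_one, mul_one, mul_one]
  | add p q hp hq => exact add_mem hp hq
  | coeff_mul r p hp =>
    refine key _ (fun r' a e => AddSubgroup.subset_closure ⟨r * r', a, e, ?_⟩) p hp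
    simp [mul_assoc]
  | der_mul i p hp =>
    refine key _ (fun r a e => ?_) p hp
    rw [← mul_assoc, ← mul_assoc, DiffOp.der_coeff, add_mul, mul_assoc (fn r), D_mul_dprod,
      add_mul]
    exact add_mem (AddSubgroup.subset_closure ⟨_, _, _, rfl⟩)
      (AddSubgroup.subset_closure ⟨_, _, _, rfl⟩)
  | central_mul j p hp =>
    refine key _ (fun r a e => AddSubgroup.subset_closure ⟨r, a, e + Pi.single j 1, ?_⟩) p hp
    rw [← Z_mul_zprod, ← mul_assoc, ← mul_assoc, ← mul_assoc, DiffOp.central_coeff,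
      mul_assoc (fn r), (Z_comm_dprod j a).eq, ← mul_assoc]

/-- The exponent of `x^a ξ^b z^e` as a sum over the variables. -/
theorem exponent_eq_sum (m : GrVar ι τ →₀ ℕ) :
    ∑ i, Finsupp.single (.inl (.inl i)) (m (.inl (.inl i))) +
      ∑ i, Finsupp.single (.inl (.inr i)) (m (.inl (.inr i))) +
      ∑ j, Finsupp.single (.inr j) (m (.inr j)) = m := by
  rw [← Fintype.sum_sum_type (fun v : ι ⊕ ι => Finsupp.single (.inl v : GrVar ι τ) (m (.inl v))),
    ← Fintype.sum_sum_type (fun v : GrVar ι τ => Finsupp.single v (m v))]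
  exact Finsupp.univ_sum_single m

theorem rename_prod_X (k : K) (m : GrVar ι τ →₀ ℕ) :
    MvPolynomial.rename (fun i => .inl (.inl i) : ι → GrVar ι τ)
      (MvPolynomial.C k * ∏ i, MvPolynomial.X i ^ m (.inl (.inl i))) =
    MvPolynomial.monomial (∑ i, Finsupp.single (.inl (.inl i)) (m (.inl (.inl i)))) k := by
  simp only [map_mul, MvPolynomial.rename_C, map_prod, map_pow, MvPolynomial.rename_X]
  simp only [MvPolynomial.X_pow_eq_monomial]
  rw [← MvPolynomial.monomial_sum_one, MvPolynomial.C_mul_monomial, mul_one]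

/-- Multiplication by `ξ_i` keeps the `x_i`-derivative zero, so the summand `∂/∂x_i` of `rep (D i)`
never contributes. -/
theorem rep_D_pow_of_pderiv_eq_zero (i : ι) (b : ℕ) (h : MvPolynomial (GrVar ι τ) K)
    (hh : MvPolynomial.pderiv (.inl (.inl i)) h = 0) :
    rep (D i ^ b) h = MvPolynomial.monomial (Finsupp.single (.inl (.inr i)) b) 1 * h := by
  rw [← MvPolynomial.X_pow_eq_monomial]
  induction b with
  | zero => simp
  | succ b ih =>
    rw [pow_succ', map_mul, Module.End.mul_apply, ih, rep_D, Derivation.leibniz, hh,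
      Derivation.leibniz_pow, MvPolynomial.pderiv_X_of_ne (by simp)]
    simp
    ring

theorem rep_noncommProd_D (s : Finset ι) (a : ι → ℕ) (h : MvPolynomial (GrVar ι τ) K)
    (hh : ∀ i, MvPolynomial.pderiv (.inl (.inl i)) h = 0)
    (comm : (↑s : Set ι).Pairwise
      (Function.onFun Commute fun i => (D i : Weyl K ι τ) ^ a i)) :
    rep (s.noncommProd (fun i => D i ^ a i) comm) h =
    MvPolynomial.monomial (∑ i ∈ s, Finsupp.single (.inl (.inr i)) (a i)) 1 * h := by
  classical
  induction s using Finset.induction_on generalizing h with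
  | empty => rw [Finset.noncommProd_empty]; simp
  | insert i s hi ih =>
    rw [Finset.noncommProd_insert_of_notMem' _ _ _ _ hi, map_mul, Module.End.mul_apply,
      rep_D_pow_of_pderiv_eq_zero i _ h (hh i), Finset.sum_insert hi, ih, ← mul_assoc,
      MvPolynomial.monomial_mul, one_mul, add_comm]
    intro k
    rw [Derivation.leibniz, hh, ← MvPolynomial.X_pow_eq_monomial, Derivation.leibniz_pow,
      MvPolynomial.pderiv_X_of_ne (by simp)]
    simp

theorem rep_noncommProd_Z (s : Finset τ) (a : τ → ℕ) (h : MvPolynomial (GrVar ι τ) K)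
    (comm : (↑s : Set τ).Pairwise
      (Function.onFun Commute fun j => (Z j : Weyl K ι τ) ^ a j)) :
    rep (s.noncommProd (fun j => Z j ^ a j) comm) h =
    MvPolynomial.monomial (∑ j ∈ s, Finsupp.single (.inr j) (a j)) 1 * h := by
  classical
  have hZ : ∀ j b (h : MvPolynomial (GrVar ι τ) K), rep (Z j ^ b) h =
      MvPolynomial.monomial (Finsupp.single (.inr j) b) 1 * h := by
    intro j b h
    rw [← MvPolynomial.X_pow_eq_monomial]
    induction b with
    | zero => simp
    | succ b ih =>
      rw [pow_succ', map_mul, Module.End.mul_apply, ih, rep_Z]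
      ring
  induction s using Finset.induction_on generalizing h with
  | empty => rw [Finset.noncommProd_empty]; simp
  | insert i s hi ih =>
    rw [Finset.noncommProd_insert_of_notMem' _ _ _ _ hi, map_mul, Module.End.mul_apply,
      hZ, Finset.sum_insert hi, ih, ← mul_assoc,
      MvPolynomial.monomial_mul, one_mul, add_comm]

/-- Normal order matters here: `z^e` acts on `1` first, then `∂^b`, then `x^a`. No `x_i` is present
when the derivations act, hence there are no correction terms. -/
theorem symbol_term (m : GrVar ι τ →₀ ℕ) (k : K) :
    symbol (term m k : Weyl K ι τ) = MvPolynomial.monomial m k := by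
  rw [term_eq, symbol_mul, symbol_apply, map_mul, Module.End.mul_apply, rep_fn, rename_prod_X]
  have hz := rep_noncommProd_Z (K := K) (ι := ι) Finset.univ (fun j => m (.inr j)) 1
    (fun j _ k _ _ => (DiffOp.central_central j k).pow_pow _ _)
  have hd := rep_noncommProd_D Finset.univ (fun i => m (.inl (.inr i)))
    (MvPolynomial.monomial (∑ j : τ, Finsupp.single (.inr j) (m (.inr j))) (1 : K)) (by
      classical
      intro i
      rw [MvPolynomial.pderiv_monomial]
      simp)
    (fun i _ k _ _ => (DiffOp.der_comm i k).pow_pow _ _)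
  rw [mul_one] at hz
  rw [zprod, hz, dprod, hd]
  conv_rhs => rw [← exponent_eq_sum m]
  rw [MvPolynomial.monomial_mul, MvPolynomial.monomial_mul, ← add_assoc, mul_one,
    mul_one]

/-- Uniqueness half of the Poincaré–Birkhoff–Witt theorem: the symbol reads off the coefficients of
any normal form. It turns every statement about representations into one about ordinary polynomials.
-/
theorem symbol_eq_of_isRepr {p : Weyl K ι τ} {c : (GrVar ι τ →₀ ℕ) →₀ K} (h : IsRepr p c) :
    ∀ m, (symbol p).coeff m = c m := by
  classical
  intro m
  rw [← h, Finsupp.sum, map_sum]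
  simp only [symbol_term, MvPolynomial.coeff_sum, MvPolynomial.coeff_monomial]
  simp +contextual [eq_comm]

theorem symbol_injective : Function.Injective (symbol : Weyl K ι τ → _) := by
  rw [injective_iff_map_eq_zero]
  intro p hp
  obtain ⟨c, hc⟩ := exists_isRepr p
  have h := symbol_eq_of_isRepr hc
  have : c = 0 := by
    ext m
    rw [← h, hp]
    rfl
  rw [← hc, this, Finsupp.sum_zero_index]

theorem mem_support_symbol {p : Weyl K ι τ} {c : (GrVar ι τ →₀ ℕ) →₀ K} (h : IsRepr p c)
    (m : GrVar ι τ →₀ ℕ) : m ∈ (symbol p).support ↔ m ∈ c.support := by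
  rw [MvPolynomial.mem_support_iff, Finsupp.mem_support_iff, symbol_eq_of_isRepr h]

/-! ### Leading terms of products -/

/-- Every monomial of `q` is properly smaller than `x^a` times some monomial of `h`. -/
def Lower {σ : Type*} (a : σ →₀ ℕ) (h q : MvPolynomial σ K) : Prop :=
  ∀ s ∈ q.support, ∃ s' ∈ h.support, s < a + s'

/-- Left multiplication by `p` is multiplication of symbols by `x^a` up to lower terms. -/
def HasSymbol (p : Weyl K ι τ) (a : GrVar ι τ →₀ ℕ) : Prop :=
  ∀ h, Lower a h (rep p h - MvPolynomial.monomial a 1 * h)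

theorem HasSymbol.one : HasSymbol (1 : Weyl K ι τ) 0 := by
  intro h s hs
  simp at hs

/-- The error of the product is the error of `p` on `rep q h` plus `x^a` times the error of `q` on
`h`. The comparison uses the componentwise order of exponents, so it is valid for all monomial
orders at once. -/
theorem HasSymbol.mul {p q : Weyl K ι τ} {a b : GrVar ι τ →₀ ℕ} (hp : HasSymbol p a)
    (hq : HasSymbol q b) : HasSymbol (p * q) (a + b) := by
  classical
  intro h s hs
  have hsupp : ∀ (c : GrVar ι τ →₀ ℕ) (r : MvPolynomial (GrVar ι τ) K),
      ∀ s ∈ (MvPolynomial.monomial c 1 * r).support, ∃ s' ∈ r.support, s = c + s' := by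
    intro c r s hs
    have := MvPolynomial.support_mul _ _ hs
    obtain ⟨x, hx, y, hy, rfl⟩ := Finset.mem_add.mp this
    have := MvPolynomial.support_monomial_subset hx
    rw [Finset.mem_singleton] at this
    exact ⟨y, hy, by rw [this]⟩
  have e : rep (p * q) h - MvPolynomial.monomial (a + b) 1 * h =
      (rep p (rep q h) - MvPolynomial.monomial a 1 * rep q h) +
      MvPolynomial.monomial a 1 * (rep q h - MvPolynomial.monomial b 1 * h) := by
    rw [map_mul, Module.End.mul_apply, mul_sub, ← mul_assoc, MvPolynomial.monomial_mul, one_mul]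
    ring
  rw [e] at hs
  rcases Finset.mem_union.mp (MvPolynomial.support_add hs) with hs | hs
  · obtain ⟨s', hs', hlt⟩ := hp _ _ hs
    have e' : rep q h = (rep q h - MvPolynomial.monomial b 1 * h) +
      MvPolynomial.monomial b 1 * h := by ring
    rw [e'] at hs'
    rcases Finset.mem_union.mp (MvPolynomial.support_add hs') with hs' | hs'
    · obtain ⟨s'', hs'', hlt'⟩ := hq _ _ hs'
      refine ⟨s'', hs'', hlt.trans ?_⟩
      rw [add_assoc]
      exact add_lt_add_right hlt' a
    · obtain ⟨s'', hs'', rfl⟩ := hsupp _ _ _ hs'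
      exact ⟨s'', hs'', by rwa [add_assoc]⟩
  · obtain ⟨s', hs', rfl⟩ := hsupp _ _ _ hs
    obtain ⟨s'', hs'', hlt'⟩ := hq _ _ hs'
    refine ⟨s'', hs'', ?_⟩
    rw [add_assoc]
    exact add_lt_add_right hlt' a

theorem HasSymbol.pow {p : Weyl K ι τ} {a : GrVar ι τ →₀ ℕ} (hp : HasSymbol p a) (n : ℕ) :
    HasSymbol (p ^ n) (n • a) := by
  induction n with
  | zero => simpa using HasSymbol.one
  | succ n ih => rw [pow_succ, succ_nsmul]; exact ih.mul hp

theorem HasSymbol.noncommProd {κ : Type*} (s : Finset κ) {y : κ → Weyl K ι τ}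
    {a : κ → GrVar ι τ →₀ ℕ} (h : ∀ i, HasSymbol (y i) (a i))
    (comm : (↑s : Set κ).Pairwise (Function.onFun Commute y)) :
    HasSymbol (s.noncommProd y comm) (∑ i ∈ s, a i) := by
  classical
  induction s using Finset.induction_on with
  | empty => rw [Finset.noncommProd_empty]; exact HasSymbol.one
  | insert i s hi ih =>
    rw [Finset.noncommProd_insert_of_notMem _ _ _ _ hi, Finset.sum_insert hi]
    exact (h i).mul (ih _)

/-- The error is `∂h/∂x_i`: each of its monomials comes from a monomial of `h` by dropping one
`x_i`, and it also lacks the factor `ξ_i`. -/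
theorem hasSymbol_D (i : ι) :
    HasSymbol (D i : Weyl K ι τ) (Finsupp.single (.inl (.inr i)) 1) := by
  classical
  intro h s hs
  rw [rep_D, show (MvPolynomial.X (.inl (.inr i)) : MvPolynomial (GrVar ι τ) K) =
    MvPolynomial.monomial (Finsupp.single (.inl (.inr i)) 1) 1 from rfl, add_sub_cancel_left,
    MvPolynomial.mem_support_iff, MvPolynomial.coeff_pderiv] at hs
  refine ⟨s + Finsupp.single (.inl (.inl i)) 1, ?_, ?_⟩
  · rw [MvPolynomial.mem_support_iff]
    exact left_ne_zero_of_mul hs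
  · rw [← add_assoc, add_comm _ s, add_assoc]
    refine lt_add_of_pos_right s (pos_iff_ne_zero.mpr fun h0 => ?_)
    have := DFunLike.congr_fun h0 (.inl (.inl i))
    simp at this

theorem hasSymbol_Z (j : τ) : HasSymbol (Z j : Weyl K ι τ) (Finsupp.single (.inr j) 1) := by
  intro h s hs
  rw [rep_Z, show (MvPolynomial.X (.inr j) : MvPolynomial (GrVar ι τ) K) =
    MvPolynomial.monomial (Finsupp.single (.inr j) 1) 1 from rfl, sub_self] at hs
  simp at hs

theorem hasSymbol_term (m : GrVar ι τ →₀ ℕ) : HasSymbol (term m 1 : Weyl K ι τ) m := by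
  rw [term_eq]
  conv => arg 2; rw [← exponent_eq_sum m]
  refine HasSymbol.mul (HasSymbol.mul ?_ ?_) ?_
  · intro h s hs
    rw [rep_fn, rename_prod_X, sub_self] at hs
    simp at hs
  · refine HasSymbol.noncommProd _ (fun i => ?_) _
    simpa using (hasSymbol_D i).pow (m (.inl (.inr i)))
  · refine HasSymbol.noncommProd _ (fun j => ?_) _
    simpa using (hasSymbol_Z j).pow (m (.inr j))

end Fintype

end Weyl

/-! ### Gradings of the Weyl algebra -/

namespace Weyl

variable {K ι τ G : Type*} [Field K] [AddCommGroup G]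

/-- A grading by `G` is encoded as a homomorphism to the group algebra. The relation `∂_i x_i = x_i
∂_i + 1` is respected because the weights of `x_i` and `∂_i` cancel; all other relations are
commutations. -/
theorem exists_gradeHom (w : ι → G) (η : τ → G) :
    ∃ Ψ : Weyl K ι τ →+* AddMonoidAlgebra (Weyl K ι τ) G,
      (∀ c, Ψ (fn (MvPolynomial.C c)) = .single 0 (fn (MvPolynomial.C c))) ∧
      (∀ i, Ψ (fn (MvPolynomial.X i)) = .single (w i) (fn (MvPolynomial.X i))) ∧
      (∀ i, Ψ (D i) = .single (-w i) (D i)) ∧ ∀ j, Ψ (Z j) = .single (η j) (Z j) := by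
  have hs : ∀ (g g' : G) (a b : Weyl K ι τ), Commute a b →
      Commute (AddMonoidAlgebra.single g a) (AddMonoidAlgebra.single g' b) := by
    intro g g' a b h
    rw [Commute, SemiconjBy, AddMonoidAlgebra.single_mul_single,
      AddMonoidAlgebra.single_mul_single, add_comm, h.eq]
  obtain ⟨κ, hκ⟩ : ∃ κ : K →+* AddMonoidAlgebra (Weyl K ι τ) G,
      ∀ c, κ c = .single 0 (fn (MvPolynomial.C c)) :=
    ⟨AddMonoidAlgebra.singleZeroRingHom.comp ((DiffOp.coeff _ _).comp MvPolynomial.C),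
      fun _ => rfl⟩
  simp only [← hκ]
  apply exists_ringHom κ
  · exact fun i c => hκ c ▸ hs _ _ _ _ (fn_comm _ _)
  · exact fun i c => hκ c ▸ hs _ _ _ _ (Procedure.D_fn_comm _ _ MvPolynomial.pderiv_C)
  · exact fun j c => hκ c ▸ hs _ _ _ _ (DiffOp.central_coeff _ _)
  · exact fun i k => hs _ _ _ _ (fn_comm _ _)
  · exact fun i k => hs _ _ _ _ (DiffOp.der_comm _ _)
  · intro i
    rw [AddMonoidAlgebra.single_mul_single, AddMonoidAlgebra.single_mul_single, Procedure.D_fn,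
      MvPolynomial.pderiv_X_self, fn_one, neg_add_cancel, add_neg_cancel,
      AddMonoidAlgebra.single_add, AddMonoidAlgebra.one_def]
  · exact fun i k hik =>
      hs _ _ _ _ (Procedure.D_fn_comm _ _ (MvPolynomial.pderiv_X_of_ne hik.symm))
  · exact fun j i => hs _ _ _ _ (DiffOp.central_coeff _ _)
  · exact fun j i => hs _ _ _ _ (DiffOp.central_der _ _)
  · exact fun j k => hs _ _ _ _ (DiffOp.central_central _ _)

/-- The homomorphism `p ↦ ∑_g p_g T^g`, where `p_g` is the homogeneous component of weight `g`,
for the weights `w i` of `x_i`, `-w i` of `∂_i` and `η j` of `z_j`. -/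
def gradeHom (w : ι → G) (η : τ → G) : Weyl K ι τ →+* AddMonoidAlgebra (Weyl K ι τ) G :=
  (exists_gradeHom w η).choose

/-- `p` is homogeneous of weight `g`. -/
def HasWeight (w : ι → G) (η : τ → G) (g : G) (p : Weyl K ι τ) : Prop :=
  gradeHom w η p = .single g p

section

variable (w : ι → G) (η : τ → G)

theorem hasWeight_C (c : K) : HasWeight w η 0 (fn (MvPolynomial.C c) : Weyl K ι τ) :=
  (exists_gradeHom w η).choose_spec.1 c

theorem hasWeight_X (i : ι) : HasWeight w η (w i) (fn (MvPolynomial.X i) : Weyl K ι τ) :=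
  (exists_gradeHom w η).choose_spec.2.1 i

theorem hasWeight_D (i : ι) : HasWeight w η (-w i) (D i : Weyl K ι τ) :=
  (exists_gradeHom w η).choose_spec.2.2.1 i

theorem hasWeight_Z (j : τ) : HasWeight w η (η j) (Z j : Weyl K ι τ) :=
  (exists_gradeHom w η).choose_spec.2.2.2 j

theorem hasWeight_one : HasWeight w η 0 (1 : Weyl K ι τ) := map_one _

end

variable {w : ι → G} {η : τ → G}

theorem HasWeight.mul {g g' : G} {p q : Weyl K ι τ} (hp : HasWeight w η g p)
    (hq : HasWeight w η g' q) : HasWeight w η (g + g') (p * q) := by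
  rw [HasWeight, map_mul, hp, hq, AddMonoidAlgebra.single_mul_single]

theorem HasWeight.add {g : G} {p q : Weyl K ι τ} (hp : HasWeight w η g p)
    (hq : HasWeight w η g q) : HasWeight w η g (p + q) := by
  rw [HasWeight, map_add, hp, hq, AddMonoidAlgebra.single_add]

theorem HasWeight.sub {g : G} {p q : Weyl K ι τ} (hp : HasWeight w η g p)
    (hq : HasWeight w η g q) : HasWeight w η g (p - q) := by
  rw [HasWeight, map_sub, hp, hq, AddMonoidAlgebra.single_sub]

theorem HasWeight.zero (g : G) : HasWeight w η g (0 : Weyl K ι τ) := by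
  rw [HasWeight, map_zero, AddMonoidAlgebra.single_zero]

theorem HasWeight.sum {κ : Type*} {g : G} (s : Finset κ) {p : κ → Weyl K ι τ}
    (hp : ∀ i ∈ s, HasWeight w η g (p i)) : HasWeight w η g (∑ i ∈ s, p i) :=
  Finset.sum_induction _ (HasWeight w η g) (fun _ _ => HasWeight.add) (HasWeight.zero g) hp

theorem HasWeight.pow {g : G} {p : Weyl K ι τ} (hp : HasWeight w η g p) (n : ℕ) :
    HasWeight w η (n • g) (p ^ n) := by
  rw [HasWeight, map_pow, hp, AddMonoidAlgebra.single_pow]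

theorem HasWeight.noncommProd {κ : Type*} (s : Finset κ) {y : κ → Weyl K ι τ}
    {a : κ → G} (h : ∀ i, HasWeight w η (a i) (y i))
    (comm : (↑s : Set κ).Pairwise (Function.onFun Commute y)) :
    HasWeight w η (∑ i ∈ s, a i) (s.noncommProd y comm) := by
  classical
  induction s using Finset.induction_on with
  | empty => rw [Finset.noncommProd_empty]; exact hasWeight_one w η
  | insert i s hi ih =>
    rw [Finset.noncommProd_insert_of_notMem _ _ _ _ hi, Finset.sum_insert hi]
    exact (h i).mul (ih _)

theorem HasWeight.fn_prod {κ : Type*} (s : Finset κ) {y : κ → MvPolynomial ι K}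
    {a : κ → G} (h : ∀ i, HasWeight w η (a i) (fn (y i) : Weyl K ι τ)) :
    HasWeight w η (∑ i ∈ s, a i) (fn (∏ i ∈ s, y i) : Weyl K ι τ) := by
  classical
  induction s using Finset.induction_on with
  | empty => rw [Finset.prod_empty, fn_one]; exact hasWeight_one w η
  | insert i s hi ih =>
    rw [Finset.prod_insert hi, Finset.sum_insert hi, fn_mul]
    exact (h i).mul ih

theorem fn_pow (r : MvPolynomial ι K) (k : ℕ) : (fn (r ^ k) : Weyl K ι τ) = fn r ^ k :=
  map_pow _ _ _

/-- The homogeneous component of weight `g`. -/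
def component (w : ι → G) (η : τ → G) (g : G) (p : Weyl K ι τ) : Weyl K ι τ :=
  (gradeHom w η p).coeff g

theorem component_add (g : G) (p q : Weyl K ι τ) :
    component w η g (p + q) = component w η g p + component w η g q := by
  simp [component]

theorem HasWeight.component_mul {g : G} {p : Weyl K ι τ} (hp : HasWeight w η g p) (g' : G)
    (q : Weyl K ι τ) : component w η g' (p * q) = p * component w η (-g + g') q := by
  rw [component, map_mul, hp, AddMonoidAlgebra.coeff_single_mul_apply, component]

theorem HasWeight.component_eq {g : G} {p : Weyl K ι τ} (hp : HasWeight w η g p) :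
    component w η g p = p := by
  rw [component, hp, AddMonoidAlgebra.coeff_single, Finsupp.single_eq_same]

theorem HasWeight.component_of_ne {g g' : G} {p : Weyl K ι τ} (hp : HasWeight w η g p)
    (h : g' ≠ g) : component w η g' p = 0 := by
  rw [component, hp, AddMonoidAlgebra.coeff_single, Finsupp.single_eq_of_ne h]

theorem HasWeight.component_mul_right {g : G} {q : Weyl K ι τ} (hq : HasWeight w η g q) (g' : G)
    (p : Weyl K ι τ) : component w η g' (p * q) = component w η (g' - g) p * q := by
  rw [component, map_mul, hq, AddMonoidAlgebra.coeff_mul_single_apply, component, sub_eq_add_neg]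

theorem hasWeight_of_component_eq_zero {g : G} {p : Weyl K ι τ}
    (h : ∀ g', g' ≠ g → component w η g' p = 0) (h' : component w η g p = p) :
    HasWeight w η g p := by
  rw [HasWeight]
  ext g'
  by_cases hg : g' = g
  · subst hg
    rw [AddMonoidAlgebra.coeff_single, Finsupp.single_eq_same]
    exact h'
  · rw [AddMonoidAlgebra.coeff_single, Finsupp.single_eq_of_ne hg]
    exact h g' hg

/-- A left ideal generated by homogeneous elements contains the homogeneous components of its
elements. -/
theorem component_mem_span {S : Set (Weyl K ι τ)} (hS : ∀ s ∈ S, ∃ g, HasWeight w η g s)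
    {p : Weyl K ι τ} (hp : p ∈ Ideal.span S) (g : G) : component w η g p ∈ Ideal.span S := by
  induction hp using Submodule.span_induction generalizing g with
  | mem s hs =>
    obtain ⟨g', hg'⟩ := hS s hs
    by_cases h : g = g'
    · rw [h, hg'.component_eq]
      exact Ideal.subset_span hs
    · rw [hg'.component_of_ne h]
      exact zero_mem _
  | zero => simp [component]
  | add p q _ _ hp hq => rw [component_add]; exact add_mem (hp g) (hq g)
  | smul a p _ hp =>
    rw [smul_eq_mul, component, map_mul]
    -- Only additivity in the left factor is needed, so it may be any element of the group algebra,
    -- and by linearity a single homogeneous term.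
    generalize gradeHom w η a = α
    induction α using AddMonoidAlgebra.induction_linear with
    | zero => simp
    | add α β hα hβ =>
      rw [add_mul, AddMonoidAlgebra.coeff_add, Finsupp.add_apply]
      exact add_mem hα hβ
    | single g' b =>
      rw [AddMonoidAlgebra.coeff_single_mul_apply]
      exact Ideal.mul_mem_left _ _ (hp _)

section Fintype

variable [Fintype ι] [Fintype τ]

/-- The weight of the monomial with exponents `m`. -/
def monomialWeight (w : ι → G) (η : τ → G) (m : GrVar ι τ →₀ ℕ) : G :=
  ∑ i, m (.inl (.inl i)) • w i + ∑ i, m (.inl (.inr i)) • -w i + ∑ j, m (.inr j) • η j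

theorem hasWeight_term (m : GrVar ι τ →₀ ℕ) (k : K) :
    HasWeight w η (monomialWeight w η m) (term m k : Weyl K ι τ) := by
  rw [term_eq, fn_mul, monomialWeight]
  refine HasWeight.mul (HasWeight.mul ?_ ?_) ?_
  · rw [← zero_add (∑ i, m (.inl (.inl i)) • w i)]
    refine (hasWeight_C w η k).mul (HasWeight.fn_prod _ fun i => ?_)
    rw [fn_pow]
    exact (hasWeight_X w η i).pow _
  · exact HasWeight.noncommProd _ (fun i => (hasWeight_D w η i).pow _) _
  · exact HasWeight.noncommProd _ (fun j => (hasWeight_Z w η j).pow _) _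

theorem isRepr_component [DecidableEq G] {p : Weyl K ι τ} {c : (GrVar ι τ →₀ ℕ) →₀ K}
    (hc : IsRepr p c) (g : G) :
    IsRepr (component w η g p) (c.filter fun m => monomialWeight w η m = g) := by
  have h : ∀ c : (GrVar ι τ →₀ ℕ) →₀ K, component w η g (ofRepr c) =
      ofRepr (c.filter fun m => monomialWeight w η m = g) := by
    intro c
    induction c using Finsupp.induction_linear with
    | zero => rw [Finsupp.filter_zero]; simp [component]
    | add c c' h h' => rw [map_add, component_add, h, h', Finsupp.filter_add, map_add]
    | single m k =>
      have e : ofRepr (Finsupp.single m k) = (term m k : Weyl K ι τ) :=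
        Finsupp.sum_single_index (term_zero _)
      rw [e]
      by_cases hm : monomialWeight w η m = g
      · rw [Finsupp.filter_single_of_pos (fun m => monomialWeight w η m = g) hm, e, ← hm,
          (hasWeight_term m k).component_eq]
      · rw [Finsupp.filter_single_of_neg (fun m => monomialWeight w η m = g) hm, map_zero,
          (hasWeight_term m k).component_of_ne (Ne.symm hm)]
  rw [← hc]
  exact (h c).symm

end Fintype

end Weyl

/-! ### Division and elimination -/

namespace Weyl

variable {K ι τ : Type*} [Field K] [Fintype ι] [Fintype τ]

/-- Identifies the initial monomial of an operator with the leading exponent of its symbol; after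
this, division takes place on symbols. -/
theorem isInitial_iff {ord : MonomialOrder (GrVar ι τ)} {p : Weyl K ι τ} {m : GrVar ι τ →₀ ℕ} :
    IsInitial ord p m ↔ symbol p ≠ 0 ∧ ord.degree (symbol p) = m := by
  constructor
  · rintro ⟨c, hc, hm, hmax⟩
    have hm' := (mem_support_symbol hc m).mpr hm
    have h0 : symbol p ≠ 0 := fun h => by simp [h] at hm'
    refine ⟨h0, ord.toSyn.injective (le_antisymm ?_ (ord.le_degree hm'))⟩
    exact hmax _ ((mem_support_symbol hc _).mp (ord.degree_mem_support h0))
  · rintro ⟨h0, rfl⟩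
    obtain ⟨c, hc⟩ := exists_isRepr p
    exact ⟨c, hc, (mem_support_symbol hc _).mp (ord.degree_mem_support h0),
      fun m' hm' => ord.le_degree ((mem_support_symbol hc _).mpr hm')⟩

/-- One step of the division algorithm. -/
theorem exists_division_step (ord : MonomialOrder (GrVar ι τ)) (p q : Weyl K ι τ)
    (hq : symbol q ≠ 0) (hle : ord.degree (symbol q) ≤ ord.degree (symbol p)) :
    ∃ c : K, ∀ s ∈ (symbol (p - fn (MvPolynomial.C c) *
        (term (ord.degree (symbol p) - ord.degree (symbol q)) 1 * q))).support,
      s ≺[ord] ord.degree (symbol p) := by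
  classical
  set m := ord.degree (symbol p)
  set k := ord.degree (symbol q)
  have hk : (symbol q).coeff k ≠ 0 := ord.coeff_degree_ne_zero_iff.mpr hq
  -- The quotient of the leading coefficients.
  refine ⟨(symbol p).coeff m / (symbol q).coeff k, fun s hs => ?_⟩
  set c := (symbol p).coeff m / (symbol q).coeff k
  obtain ⟨r, hr⟩ : ∃ r, r = symbol (term (m - k) 1 * q) -
    MvPolynomial.monomial (m - k) 1 * symbol q := ⟨_, rfl⟩
  -- The noncommutative error `r` is strictly lower componentwise, hence strictly lower for `ord`.
  have hlow : ∀ s ∈ r.support, s ≺[ord] m := by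
    intro s hs
    rw [hr, symbol_mul] at hs
    obtain ⟨s', hs', hlt⟩ := hasSymbol_term (m - k) _ s hs
    refine lt_of_lt_of_le (ord.toSyn_strictMono hlt) ?_
    rw [map_add]
    refine (add_le_add_right (ord.le_degree hs') _).trans ?_
    rw [← map_add, tsub_add_cancel_of_le hle]
  have e : symbol (p - fn (MvPolynomial.C c) * (term (m - k) 1 * q)) =
      symbol p - MvPolynomial.monomial (m - k) c * symbol q - MvPolynomial.C c * r := by
    rw [map_sub, symbol_mul (fn _), rep_fn, MvPolynomial.rename_C, hr, mul_sub, ← mul_assoc,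
      MvPolynomial.C_mul_monomial, mul_one]
    ring
  rw [e] at hs
  rcases Finset.mem_union.mp (MvPolynomial.support_sub _ _ _ hs) with hs | hs
  · have hsm : s ≠ m := by
      rintro rfl
      rw [MvPolynomial.mem_support_iff, MvPolynomial.coeff_sub] at hs
      apply hs
      have h := MvPolynomial.coeff_monomial_mul k (m - k) c (symbol q)
      rw [tsub_add_cancel_of_le hle] at h
      rw [h, div_mul_cancel₀ _ hk, sub_self]
    refine lt_of_le_of_ne ?_ (fun h => hsm (ord.toSyn.injective h))
    rcases Finset.mem_union.mp (MvPolynomial.support_sub _ _ _ hs) with hs | hs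
    · exact ord.le_degree hs
    · obtain ⟨x, hx, y, hy, rfl⟩ := Finset.mem_add.mp (MvPolynomial.support_mul _ _ hs)
      rw [Finset.mem_singleton.mp (MvPolynomial.support_monomial_subset hx), map_add]
      refine (add_le_add_right (ord.le_degree hy) _).trans ?_
      rw [← map_add, tsub_add_cancel_of_le hle]
  · refine hlow s ?_
    rw [MvPolynomial.mem_support_iff, MvPolynomial.coeff_C_mul] at hs
    exact MvPolynomial.mem_support_iff.mpr (right_ne_zero_of_mul hs)

/-- An ideal generated by monomials contains a monomial only if a generator divides it. Zero
elements of `G` have no initial monomial and contribute no generator. -/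
theorem IsGroebner.exists_degree_le {ord : MonomialOrder (GrVar ι τ)} {I : Ideal (Weyl K ι τ)}
    {G : Set (Weyl K ι τ)} (hG : IsGroebner ord I G) {p : Weyl K ι τ} (hp : p ∈ I)
    (h0 : symbol p ≠ 0) :
    ∃ q ∈ G, symbol q ≠ 0 ∧ ord.degree (symbol q) ≤ ord.degree (symbol p) := by
  classical
  have h1 : MvPolynomial.monomial (ord.degree (symbol p)) (1 : K) ∈ initialIdeal ord G := by
    rw [hG.2.2]
    exact Ideal.subset_span ⟨p, hp, _, isInitial_iff.mpr ⟨h0, rfl⟩, rfl⟩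
  have h2 : initialIdeal ord G = Ideal.span ((fun s => MvPolynomial.monomial s (1 : K)) ''
      {m | ∃ q ∈ G, IsInitial ord q m}) := by
    rw [initialIdeal]
    congr 1
    ext r
    constructor
    · rintro ⟨q, hq, m, hm, rfl⟩
      exact ⟨m, ⟨q, hq, hm⟩, rfl⟩
    · rintro ⟨m, ⟨q, hq, hm⟩, rfl⟩
      exact ⟨q, hq, m, hm, rfl⟩
  rw [h2, MvPolynomial.mem_ideal_span_monomial_image] at h1
  obtain ⟨k, ⟨q, hq, hk⟩, hle⟩ := h1 (ord.degree (symbol p)) (by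
    rw [MvPolynomial.mem_support_iff, MvPolynomial.coeff_monomial, if_pos rfl]
    exact one_ne_zero)
  obtain ⟨hq0, rfl⟩ := isInitial_iff.mp hk
  exact ⟨q, hq, hq0, hle⟩

end Weyl

namespace Procedure

open Weyl

variable {K : Type*} [Field K] {n d : ℕ}

theorem incl_fn (r : MvPolynomial (Fin n ⊕ Fin d) K) :
    incl (fn r : A K n d) = fn r := DiffOp.lift_coeff _ _ _ _ _ _ _ _ r

theorem incl_D (i : Fin n ⊕ Fin d) : incl (D i : A K n d) = D i :=
  DiffOp.lift_der _ _ _ _ _ _ _ _ i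

/-- The specialization `u_j, v_j ↦ 1`. -/
def specialize : Auv K n d →+* A K n d :=
  DiffOp.lift (DiffOp.coeff _ _) (DiffOp.der _ _) (fun _ => 1) DiffOp.der_coeff DiffOp.der_comm
    (fun _ _ => Commute.one_left _) (fun _ _ => Commute.one_left _) (fun _ _ => Commute.one_left _)

theorem specialize_fn (r : MvPolynomial (Fin n ⊕ Fin d) K) :
    specialize (fn r : Auv K n d) = fn r := DiffOp.lift_coeff _ _ _ _ _ _ _ _ r

theorem specialize_D (i : Fin n ⊕ Fin d) : specialize (D i : Auv K n d) = D i :=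
  DiffOp.lift_der _ _ _ _ _ _ _ _ i

theorem specialize_Z (j : Fin d ⊕ Fin d) : specialize (Z j : Auv K n d) = 1 :=
  DiffOp.lift_central _ _ _ _ _ _ _ _ j

theorem specialize_incl (P : A K n d) : specialize (incl P) = P := by
  have h : (specialize.comp incl : A K n d →+* A K n d) = RingHom.id _ := by
    refine DiffOp.ringHom_ext (fun r => ?_) (fun i => ?_) (fun j => j.elim)
    · exact (congrArg specialize (incl_fn r)).trans (specialize_fn r)
    · exact (congrArg specialize (incl_D i)).trans (specialize_D i)
  exact congrArg (fun F => F P) h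

theorem incl_injective : Function.Injective (incl : A K n d →+* Auv K n d) :=
  Function.LeftInverse.injective specialize_incl

theorem eq_zero_of_symbol_incl_eq_zero {P : A K n d} (h : symbol (incl P) = 0) : P = 0 :=
  incl_injective (symbol_injective (by rw [h, map_zero, map_zero]))

/-- The exponents of a monomial of `A_{n+d}`, as exponents of a monomial of `A_{n+d}[u, v]`. -/
def embed (m : GrVar (Fin n ⊕ Fin d) Empty →₀ ℕ) : Var n d →₀ ℕ :=
  Finsupp.equivFunOnFinite.symm (Sum.elim (fun v => m (.inl v)) 0)

theorem incl_term (m : GrVar (Fin n ⊕ Fin d) Empty →₀ ℕ) (k : K) :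
    incl (term m k : A K n d) = term (embed m) k := by
  have hd : incl (dprod (fun i => m (.inl (.inr i))) : A K n d) =
      dprod (fun i => m (.inl (.inr i))) := by
    refine (Finset.map_noncommProd _ _ _ _).trans ?_
    refine Finset.noncommProd_congr rfl (fun i _ => ?_) _
    rw [map_pow, incl_D]
  have hz : (zprod (fun j => m (.inr j)) : A K n d) = 1 := by
    rw [← zprod_zero]
    congr 1
    exact Subsingleton.elim _ _
  rw [term_eq, term_eq, map_mul, map_mul, incl_fn, hd, hz, map_one]
  have hz' : (zprod (fun j => embed m (.inr j)) : Auv K n d) = 1 := zprod_zero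
  rw [hz']
  rfl

theorem exists_embed_eq {m : Var n d →₀ ℕ} (hm : ∀ j, m (.inr j) = 0) :
    ∃ m', embed m' = m := by
  refine ⟨Finsupp.equivFunOnFinite.symm (Sum.elim (fun v => m (.inl v)) 0), ?_⟩
  ext (v | j)
  · rfl
  · exact (hm j).symm

theorem eq_zero_of_mem_support_symbol_incl (P : A K n d) :
    ∀ m ∈ (symbol (incl P)).support, ∀ j, m (.inr j) = 0 := by
  classical
  obtain ⟨c, rfl⟩ := exists_isRepr P
  intro m hm j
  rw [Finsupp.sum, map_sum, map_sum] at hm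
  obtain ⟨m', -, hm'⟩ := Finset.mem_biUnion.mp (MvPolynomial.support_sum hm)
  rw [incl_term, symbol_term] at hm'
  rw [Finset.mem_singleton.mp (MvPolynomial.support_monomial_subset hm')]
  rfl

/-- Converse to `eq_zero_of_mem_support_symbol_incl`: freeness from `u, v` can be tested on the
symbol. This keeps the division algorithm inside `A_{n+d}`. -/
theorem exists_incl_eq {p : Auv K n d} (hp : ∀ m ∈ (symbol p).support, ∀ j, m (.inr j) = 0) :
    ∃ P, incl P = p := by
  obtain ⟨c, hc⟩ := exists_isRepr p
  suffices h : p ∈ (incl (K := K) (n := n) (d := d)).range from h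
  rw [← hc]
  refine Subring.sum_mem _ fun m hm => ?_
  obtain ⟨m', rfl⟩ := exists_embed_eq (hp m ((mem_support_symbol hc m).mpr hm))
  exact ⟨_, incl_term m' _⟩

/-- The part of a Gröbner basis that does not involve `u, v` generates the elimination ideal. -/
theorem mem_span_of_incl_mem {ord : MonomialOrder (Var n d)} (hord : Eliminates ord)
    {I : Ideal (Auv K n d)} {G : Set (Auv K n d)} (hG : IsGroebner ord I G) {P : A K n d}
    (hP : incl P ∈ I) : P ∈ Ideal.span {P : A K n d | incl P ∈ G} := by
  generalize hb : ord.toSyn (ord.degree (symbol (incl P))) = b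
  induction b using WellFoundedLT.induction generalizing P with
  | ind b ih =>
    by_cases h0 : symbol (incl P) = 0
    · rw [eq_zero_of_symbol_incl_eq_zero h0]
      exact zero_mem _
    · obtain ⟨q, hq, hq0, hle⟩ := hG.exists_degree_le hP h0
      obtain ⟨c, hc⟩ := exists_division_step ord (incl P) q hq0 hle
      have hP0 := eq_zero_of_mem_support_symbol_incl P _ (ord.degree_mem_support h0)
      -- The divisor is free of `u, v`: its initial monomial divides one that is, and for an
      -- elimination order a monomial of `q` containing some `u_j` or `v_j` would exceed that
      -- initial monomial.
      obtain ⟨Q, rfl⟩ : ∃ Q, incl Q = q := by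
        refine exists_incl_eq fun m hm => ?_
        by_contra! hne
        have h1 := hord (ord.degree (symbol q)) m
          (fun j => Nat.eq_zero_of_le_zero ((hle _).trans (hP0 j).le)) hne
        exact absurd (ord.le_degree hm) (not_le_of_gt h1)
      obtain ⟨a, ha⟩ := exists_embed_eq (m := ord.degree (symbol (incl P)) -
        ord.degree (symbol (incl Q))) (fun j => by rw [Finsupp.tsub_apply, hP0 j, Nat.zero_sub])
      rw [← ha, ← incl_term, ← incl_fn, ← map_mul, ← map_mul, ← map_sub] at hc
      have hmem : fn (MvPolynomial.C c) * (term a 1 * Q) ∈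
          Ideal.span {P : A K n d | incl P ∈ G} :=
        Ideal.mul_mem_left _ _ (Ideal.mul_mem_left _ _ (Ideal.subset_span hq))
      rw [← sub_add_cancel P (fn (MvPolynomial.C c) * (term a 1 * Q))]
      refine add_mem ?_ hmem
      have hI : incl (P - fn (MvPolynomial.C c) * (term a 1 * Q)) ∈ I := by
        rw [map_sub, map_mul, map_mul]
        exact sub_mem hP (Ideal.mul_mem_left _ _ (Ideal.mul_mem_left _ _ (hG.2.1 hq)))
      by_cases hs : symbol (incl (P - fn (MvPolynomial.C c) * (term a 1 * Q))) = 0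
      · rw [eq_zero_of_symbol_incl_eq_zero hs]
        exact zero_mem _
      · refine ih _ ?_ hI rfl
        rw [← hb]
        exact hc _ (ord.degree_mem_support hs)

end Procedure

namespace Procedure

open Weyl

variable {K : Type*} [Field K] {n d : ℕ}

/-! ### The weights `𝒲_1, …, 𝒲_d` -/

/-- The weights of `x_i` and `t_j`. -/
def wt : Fin n ⊕ Fin d → Fin d → ℤ := Sum.elim 0 (fun j => -Pi.single j 1)

/-- The weights of `u_j` and `v_j`. -/
def wtuv : Fin d ⊕ Fin d → Fin d → ℤ :=
  Sum.elim (fun j => -Pi.single j 1) (fun j => Pi.single j 1)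

/-- `P ∈ A_{n+d}` is homogeneous of weight `g`. -/
abbrev HasWt (g : Fin d → ℤ) (P : A K n d) : Prop := HasWeight wt Empty.elim g P

theorem component_incl (g : Fin d → ℤ) (P : A K n d) :
    component wt wtuv g (incl P) = incl (component wt Empty.elim g P) := by
  induction P using Weyl.induction_left generalizing g with
  | one =>
    rw [map_one]
    by_cases hg : g = 0
    · rw [hg, (hasWeight_one _ _).component_eq, (hasWeight_one _ _).component_eq, map_one]
    · rw [(hasWeight_one _ _).component_of_ne hg, (hasWeight_one _ _).component_of_ne hg, map_zero]
  | add p q hp hq => rw [map_add, component_add, component_add, hp, hq, map_add]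
  | C_mul c p hp =>
    rw [map_mul, incl_fn, (hasWeight_C _ _ c).component_mul, (hasWeight_C _ _ c).component_mul, hp,
      map_mul, incl_fn]
  | X_mul i p hp =>
    rw [map_mul, incl_fn, (hasWeight_X _ _ i).component_mul, (hasWeight_X _ _ i).component_mul, hp,
      map_mul, incl_fn]
  | D_mul i p hp =>
    rw [map_mul, incl_D, (hasWeight_D _ _ i).component_mul, (hasWeight_D _ _ i).component_mul, hp,
      map_mul, incl_D]
  | Z_mul j p hp => exact j.elim

theorem hasWt_of_incl {g : Fin d → ℤ} {P : A K n d} (h : HasWeight wt wtuv g (incl P)) :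
    HasWt g P := by
  refine hasWeight_of_component_eq_zero (fun g' hg' => ?_) ?_
  · apply incl_injective
    rw [← component_incl, h.component_of_ne hg', map_zero]
  · apply incl_injective
    rw [← component_incl, h.component_eq]

theorem monomialWeight_apply (m : Var n d →₀ ℕ) (j : Fin d) :
    monomialWeight wt wtuv m j = weight j m := by
  simp only [monomialWeight, wt, wtuv, Fintype.sum_sum_type, Pi.add_apply, Finset.sum_apply,
    Pi.smul_apply, Sum.elim_inl, Sum.elim_inr, Pi.neg_apply, Pi.zero_apply, Pi.single_apply]
  simp [weight]
  ring

theorem IsHomogeneous.hasWt {P : A K n d} (h : IsHomogeneous (incl P)) : ∃ g, HasWt g P := by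
  obtain ⟨c, hc, hw⟩ := h
  choose w hw using hw
  refine ⟨w, hasWt_of_incl ?_⟩
  rw [← hc]
  refine HasWeight.sum _ fun m hm => ?_
  have : w = monomialWeight wt wtuv m := by
    ext j
    rw [monomialWeight_apply, hw j m hm]
  rw [this]
  exact hasWeight_term m _

theorem hasWeight_fn_inX {τ : Type*} (η : τ → Fin d → ℤ) (h : MvPolynomial (Fin n) K) :
    HasWeight wt η 0 (fn (inX h) : Weyl K (Fin n ⊕ Fin d) τ) := by
  induction h using MvPolynomial.induction_on with
  | C c => rw [inX, MvPolynomial.rename_C]; exact hasWeight_C _ _ c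
  | add p q hp hq => rw [inX, map_add, fn_add]; exact hp.add hq
  | mul_X p i hp =>
    rw [inX, map_mul, fn_mul, MvPolynomial.rename_X]
    simpa [wt] using hp.mul (hasWeight_X wt η (.inl i))

/-- This is the purpose of `u` and `v`: `u_j f_j` has the weight of `t_j`, while `u_j ∂_{t_j}` and
`u_j v_j` have weight zero. -/
theorem exists_hasWeight_generator (f : Fin d → MvPolynomial (Fin n) K) :
    ∀ s ∈ (Set.range (fun j : Fin d =>
        fn (MvPolynomial.X (.inr j)) - Z (.inl j) * fn (inX (f j))) ∪
      Set.range (fun i : Fin n =>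
        D (.inl i) + ∑ j, fn (inX (MvPolynomial.pderiv i (f j))) * Z (.inl j) * D (.inr j)) ∪
      Set.range (fun j : Fin d => 1 - Z (.inl j) * Z (.inr j)) : Set (Auv K n d)),
      ∃ g, HasWeight wt wtuv g s := by
  rintro _ ((⟨j, rfl⟩ | ⟨i, rfl⟩) | ⟨j, rfl⟩)
  · refine ⟨wt (n := n) (.inr j), (hasWeight_X wt wtuv (.inr j)).sub ?_⟩
    simpa [wtuv, wt] using (hasWeight_Z wt wtuv (.inl j)).mul (hasWeight_fn_inX wtuv (f j))
  · refine ⟨0, HasWeight.add (by simpa [wt] using hasWeight_D wt wtuv (.inl i)) ?_⟩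
    refine HasWeight.sum _ fun j _ => ?_
    simpa [wt, wtuv] using ((hasWeight_fn_inX wtuv (MvPolynomial.pderiv i (f j))).mul
      (hasWeight_Z wt wtuv (.inl j))).mul (hasWeight_D wt wtuv (.inr j))
  · refine ⟨0, (hasWeight_one wt wtuv).sub ?_⟩
    simpa [wtuv] using (hasWeight_Z wt wtuv (.inl j)).mul (hasWeight_Z wt wtuv (.inr j))

/-- The elements of the reduced Gröbner basis are homogeneous. -/
theorem hasWt_of_isReduced {f : Fin d → MvPolynomial (Fin n) K} {ord : MonomialOrder (Var n d)}
    {G : Set (Auv K n d)} (hG : IsGroebner ord (ideal f) G) (hred : IsReduced ord G) {P : A K n d}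
    (hP : incl P ∈ G) : ∃ g, HasWt g P := by
  obtain ⟨c, m, hc, hm, -, hcm⟩ := hred _ hP
  obtain ⟨g, hg⟩ : ∃ g, g = monomialWeight (wt (n := n)) wtuv m := ⟨_, rfl⟩
  have hp := isRepr_component (w := wt) (η := wtuv) hc g
  have hq : IsRepr (incl P - component wt wtuv g (incl P))
      (c.filter fun m => ¬ monomialWeight wt wtuv m = g) := by
    have h1 : ofRepr (c.filter fun m => monomialWeight wt wtuv m = g) =
      component wt wtuv g (incl P) := hp
    have h2 : ofRepr c = incl P := hc
    rw [IsRepr, ← h1, ← h2]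
    nth_rewrite 2 [← Finsupp.filter_add_filter_not c
      (fun m => monomialWeight wt wtuv m = g)]
    rw [map_add, add_sub_cancel_left]
    rfl
  have hI : incl P - component wt wtuv g (incl P) ∈ ideal f :=
    sub_mem (hG.2.1 hP) (component_mem_span (exists_hasWeight_generator f) (hG.2.1 hP) g)
  -- The difference lies in `I` and consists of the monomials of `P` of weight other than `g`. If it
  -- were nonzero, the initial monomial of some `q ∈ G` would divide one of them. For `q ≠ P` this
  -- contradicts interreduction. For `q = P` the initial monomial `m` of `P` would divide a monomial
  -- that is at most `m`, hence equal it, although `m` has weight `g`.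
  have h0 : symbol (incl P - component wt wtuv g (incl P)) = 0 := by
    by_contra h0
    obtain ⟨q, hqG, hq0, hle⟩ := hG.exists_degree_le hI h0
    have hm' := (mem_support_symbol hq _).mp (ord.degree_mem_support h0)
    rw [Finsupp.support_filter, Finset.mem_filter] at hm'
    by_cases hqP : q = incl P
    · have h1 : IsInitial ord (incl P) m := ⟨c, hc, hm⟩
      rw [hqP, (isInitial_iff.mp h1).2] at hle
      have h2 := le_antisymm (ord.toSyn_monotone hle) (hm.2 _ hm'.1)
      exact hm'.2 ((congrArg _ (ord.toSyn.injective h2)).symm.trans hg.symm)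
    · exact hcm q hqG hqP _ (isInitial_iff.mpr ⟨hq0, rfl⟩) _ hm'.1 hle
  have h1 : incl P = component wt wtuv g (incl P) := by
    rw [← sub_eq_zero]
    exact symbol_injective (by rw [h0, map_zero])
  refine ⟨g, hasWt_of_incl ?_⟩
  rw [h1, ← hp]
  refine HasWeight.sum _ fun m' hm' => ?_
  rw [Finsupp.support_filter, Finset.mem_filter] at hm'
  rw [← hm'.2]
  exact hasWeight_term m' _

/-! ### The operators `S_{1,ν_1} ⋯ S_{d,ν_d}` and `t_j ∂_{t_j}` -/

theorem euler_fn (r : MvPolynomial (Fin n) K) : euler (fn r : As K n d) = fn (inX r) :=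
  DiffOp.lift_coeff _ _ _ _ _ _ _ _ r

theorem euler_D (i : Fin n) : euler (D i : As K n d) = D (.inl i) :=
  DiffOp.lift_der _ _ _ _ _ _ _ _ i

theorem euler_Z (j : Fin d) :
    euler (Z j : As K n d) = fn (MvPolynomial.X (.inr j)) * D (.inr j) :=
  DiffOp.lift_central _ _ _ _ _ _ _ _ j

theorem hasWt_S (j : Fin d) (ν : ℤ) : HasWt (Pi.single j ν) (S j ν : A K n d) := by
  rw [S]
  split_ifs with h
  · have := (hasWeight_D (K := K) (wt (n := n)) (Empty.elim : Empty → Fin d → ℤ)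
      (.inr j)).pow ν.toNat
    convert this using 1
    simp only [wt, Sum.elim_inr, neg_neg, ← Pi.single_smul]
    congr 1
    simp [h]
  · have := (hasWeight_X (K := K) (wt (n := n)) (Empty.elim : Empty → Fin d → ℤ)
      (.inr j)).pow (-ν).toNat
    convert this using 1
    simp only [wt, Sum.elim_inr, ← Pi.single_neg, ← Pi.single_smul]
    congr 1
    simp
    omega

theorem hasWt_prod_ofFn {k : ℕ} (F : Fin k → A K n d) (g : Fin k → Fin d → ℤ)
    (h : ∀ j, HasWt (g j) (F j)) : HasWt (∑ j, g j) (List.ofFn F).prod := by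
  induction k with
  | zero => simpa using hasWeight_one _ _
  | succ k ih =>
    rw [Fin.sum_univ_succ, List.ofFn_succ, List.prod_cons]
    exact (h 0).mul (ih _ _ fun j => h j.succ)

theorem hasWt_prodS (ν : Fin d → ℤ) : HasWt ν (prodS ν : A K n d) := by
  have := hasWt_prod_ofFn (K := K) (n := n) (fun j => S j (ν j)) _ (fun j => hasWt_S j (ν j))
  rwa [Finset.univ_sum_single] at this

theorem D_inr_comm_X {j k : Fin d} (h : j ≠ k) :
    Commute (D (.inr j) : A K n d) (fn (MvPolynomial.X (.inr k))) :=
  D_fn_comm _ _ (MvPolynomial.pderiv_X_of_ne (by simpa using h.symm))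

/-- `S_{j,ν}` commutes with everything that commutes with `t_j` and `∂_{t_j}`. -/
theorem commute_S {a : A K n d} (j : Fin d) (ν : ℤ) (hD : Commute a (D (.inr j)))
    (hX : Commute a (fn (MvPolynomial.X (.inr j)))) : Commute a (S j ν) := by
  rw [S]
  split_ifs
  · exact hD.pow_right _
  · exact hX.pow_right _

theorem commute_S_of_ne {j k : Fin d} (h : j ≠ k) (ν μ : ℤ) :
    Commute (S j ν : A K n d) (S k μ) := by
  refine commute_S k μ ?_ ?_
  · exact (commute_S j ν (DiffOp.der_comm _ _) (D_inr_comm_X h.symm)).symm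
  · exact (commute_S j ν (D_inr_comm_X h).symm (fn_comm _ _)).symm

/-- A factor of a product of commuting elements can be moved to the end. -/
theorem prod_ofFn_eq {M : Type*} [Monoid M] {k : ℕ} (F : Fin k → M)
    (hF : ∀ i j, i ≠ j → Commute (F i) (F j)) (j : Fin k) :
    (List.ofFn F).prod = (List.ofFn (Function.update F j 1)).prod * F j := by
  induction k with
  | zero => exact j.elim0
  | succ k ih =>
    rw [List.ofFn_succ, List.prod_cons, List.ofFn_succ (f := Function.update F j 1),
      List.prod_cons]
    cases j using Fin.cases with
    | zero =>
      rw [Function.update_self, one_mul]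
      have h1 : (fun i : Fin k => Function.update F 0 1 i.succ) = fun i => F i.succ := by
        ext i
        exact Function.update_of_ne (Fin.succ_ne_zero i) _ _
      rw [h1]
      refine (Commute.list_prod_right _ _ fun x hx => ?_).eq
      obtain ⟨i, rfl⟩ := List.mem_ofFn.mp hx
      exact hF _ _ (Fin.succ_ne_zero i).symm
    | succ j =>
      have h1 : (fun i : Fin k => Function.update F j.succ 1 i.succ) =
          Function.update (fun i => F i.succ) j 1 := by
        ext i
        by_cases hij : i = j
        · subst hij; simp
        · rw [Function.update_of_ne (by simpa using hij), Function.update_of_ne hij]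
      rw [h1, ih (fun i => F i.succ) (fun i j hij => hF _ _ (by simpa using hij)) j,
        Function.update_of_ne (Fin.succ_ne_zero j).symm, mul_assoc]

/-- Isolates the `j`-th factor: factors with different indices commute, so it can be moved to the
end and varied there, while the remaining product `ρ` commutes with `t_j` and `∂_{t_j}`. -/
theorem exists_prodS_eq (ν : Fin d → ℤ) (j : Fin d) :
    ∃ ρ : A K n d, Commute ρ (D (.inr j)) ∧ Commute ρ (fn (MvPolynomial.X (.inr j))) ∧
      ∀ μ, prodS (Function.update ν j μ) = ρ * S j μ := by
  refine ⟨(List.ofFn (Function.update (fun i => S i (ν i)) j 1)).prod, ?_, ?_, fun μ => ?_⟩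
  · refine (Commute.list_prod_right _ _ fun x hx => ?_).symm
    obtain ⟨i, rfl⟩ := List.mem_ofFn.mp hx
    by_cases hij : i = j
    · subst hij; simp
    · rw [Function.update_of_ne hij]
      exact commute_S i _ (DiffOp.der_comm _ _) (D_inr_comm_X (Ne.symm hij))
  · refine (Commute.list_prod_right _ _ fun x hx => ?_).symm
    obtain ⟨i, rfl⟩ := List.mem_ofFn.mp hx
    by_cases hij : i = j
    · subst hij; simp
    · rw [Function.update_of_ne hij]
      exact commute_S i _ (D_inr_comm_X hij).symm (fn_comm _ _)
  · rw [prodS, prod_ofFn_eq _ (fun i k hik => commute_S_of_ne hik _ _) j, Function.update_self]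
    congr 3
    ext i
    by_cases hij : i = j
    · subst hij; simp
    · rw [Function.update_of_ne hij, Function.update_of_ne hij, Function.update_of_ne hij]

theorem D_mul_X_self (j : Fin d) :
    (D (.inr j) * fn (MvPolynomial.X (.inr j)) : A K n d) =
      fn (MvPolynomial.X (.inr j)) * D (.inr j) + 1 := by
  rw [D_fn, MvPolynomial.pderiv_X_self, fn_one]

/-- For `ν_j > 0` one has `t_j ∂_{t_j}^{ν_j} = (t_j ∂_{t_j}) ∂_{t_j}^{ν_j - 1}`; otherwise `t_j`
only raises the power of `t_j`. -/
theorem exists_X_mul_prodS (j : Fin d) (ν : Fin d → ℤ) :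
    ∃ b : As K n d, fn (MvPolynomial.X (.inr j)) * prodS ν =
      euler b * prodS (ν - Pi.single j 1) := by
  obtain ⟨ρ, hD, hX, hρ⟩ := exists_prodS_eq (K := K) (n := n) ν j
  have h1 : prodS ν = ρ * S j (ν j) := by rw [← hρ, Function.update_eq_self]
  have h2 : prodS (ν - Pi.single j 1) = ρ * S j (ν j - 1) := by
    rw [← hρ]
    congr 1
    ext i
    by_cases hij : i = j
    · subst hij; simp
    · simp [hij]
  rw [h1, h2]
  by_cases h : 0 < ν j
  · refine ⟨Z j, ?_⟩
    have e : (S j (ν j) : A K n d) = D (.inr j) * S j (ν j - 1) := by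
      rw [S, S, if_pos h.le, if_pos (by omega), ← pow_succ']
      congr 1
      omega
    rw [e, euler_Z, ← mul_assoc, ← mul_assoc, ← mul_assoc, mul_assoc _ ρ, hD.eq, ← mul_assoc]
  · refine ⟨1, ?_⟩
    have e : (S j (ν j - 1) : A K n d) = fn (MvPolynomial.X (.inr j)) * S j (ν j) := by
      rw [S, S, if_neg (by omega)]
      split_ifs with h0
      · rw [show ν j = 0 by omega]; simp
      · rw [← pow_succ']
        congr 1
        omega
    rw [e, map_one, one_mul, ← mul_assoc, ← mul_assoc, hX.eq]

/-- For `ν_j < 0` one factor `t_j` is split off and `∂_{t_j} t_j = t_j ∂_{t_j} + 1`; otherwise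
`∂_{t_j}` only raises the power of `∂_{t_j}`. -/
theorem exists_D_mul_prodS (j : Fin d) (ν : Fin d → ℤ) :
    ∃ b : As K n d, D (.inr j) * prodS ν = euler b * prodS (ν + Pi.single j 1) := by
  obtain ⟨ρ, hD, hX, hρ⟩ := exists_prodS_eq (K := K) (n := n) ν j
  have h1 : prodS ν = ρ * S j (ν j) := by rw [← hρ, Function.update_eq_self]
  have h2 : prodS (ν + Pi.single j 1) = ρ * S j (ν j + 1) := by
    rw [← hρ]
    congr 1
    ext i
    by_cases hij : i = j
    · subst hij; simp
    · simp [hij]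
  rw [h1, h2]
  by_cases h : 0 ≤ ν j
  · refine ⟨1, ?_⟩
    have e : (S j (ν j + 1) : A K n d) = D (.inr j) * S j (ν j) := by
      rw [S, S, if_pos h, if_pos (by omega), ← pow_succ']
      congr 1
      omega
    rw [e, map_one, one_mul, ← mul_assoc, ← mul_assoc, hD.eq]
  · refine ⟨Z j + 1, ?_⟩
    have e : (S j (ν j) : A K n d) = fn (MvPolynomial.X (.inr j)) * S j (ν j + 1) := by
      rw [S, S, if_neg h]
      split_ifs with h0
      · rw [show ν j = -1 by omega]; simp
      · rw [← pow_succ']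
        congr 1
        omega
    rw [e, map_add, euler_Z, map_one, ← D_mul_X_self, ← mul_assoc, ← mul_assoc, ← mul_assoc,
      mul_assoc _ ρ, mul_assoc _ _ ρ, ← hX.eq]

/-- With `θ = t_j ∂_{t_j}` one has `t_j θ = (θ - 1) t_j`: moving `t_j` to the right shifts `s_j` by
`-1`. -/
theorem exists_X_mul_euler (j : Fin d) (b : As K n d) :
    ∃ b' : As K n d, fn (MvPolynomial.X (.inr j)) * euler b =
      euler b' * fn (MvPolynomial.X (.inr j)) := by
  induction b using DiffOp.induction_left with
  | one => exact ⟨1, by rw [map_one, mul_one, one_mul]⟩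
  | add p q hp hq =>
    obtain ⟨p', hp⟩ := hp
    obtain ⟨q', hq⟩ := hq
    exact ⟨p' + q', by rw [map_add, map_add, mul_add, add_mul, hp, hq]⟩
  | coeff_mul r p hp =>
    obtain ⟨p', hp⟩ := hp
    refine ⟨fn r * p', ?_⟩
    rw [map_mul, map_mul, euler_fn, ← mul_assoc, (fn_comm _ _).eq, mul_assoc, hp, mul_assoc]
  | der_mul i p hp =>
    obtain ⟨p', hp⟩ := hp
    refine ⟨D i * p', ?_⟩
    have h : Commute (D (.inl i) : A K n d) (fn (MvPolynomial.X (.inr j))) :=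
      D_fn_comm _ _ (MvPolynomial.pderiv_X_of_ne (by simp))
    rw [map_mul, map_mul, euler_D, ← mul_assoc, ← h.eq, mul_assoc, hp, mul_assoc]
  | central_mul k p hp =>
    obtain ⟨p', hp⟩ := hp
    by_cases hjk : j = k
    · subst hjk
      refine ⟨(Z j - 1) * p', ?_⟩
      have h : (fn (MvPolynomial.X (.inr j)) * (fn (MvPolynomial.X (.inr j)) * D (.inr j)) :
          A K n d) = (fn (MvPolynomial.X (.inr j)) * D (.inr j) - 1) *
            fn (MvPolynomial.X (.inr j)) := by
        rw [sub_mul, mul_assoc _ (D _), D_mul_X_self, mul_add]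
        simp
      rw [map_mul, map_mul, map_sub, map_one, euler_Z, ← mul_assoc, h, mul_assoc, hp, mul_assoc]
    · refine ⟨Z k * p', ?_⟩
      have h : Commute (fn (MvPolynomial.X (.inr k)) * D (.inr k) : A K n d)
          (fn (MvPolynomial.X (.inr j))) :=
        (fn_comm _ _).mul_left (D_inr_comm_X (Ne.symm hjk))
      rw [map_mul, map_mul, euler_Z, ← mul_assoc, ← h.eq, mul_assoc _ _ (euler p), hp, ← mul_assoc]

/-- With `θ = t_j ∂_{t_j}` one has `∂_{t_j} θ = (θ + 1) ∂_{t_j}`. -/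
theorem exists_D_mul_euler (j : Fin d) (b : As K n d) :
    ∃ b' : As K n d, D (.inr j) * euler b = euler b' * D (.inr j) := by
  induction b using DiffOp.induction_left with
  | one => exact ⟨1, by rw [map_one, mul_one, one_mul]⟩
  | add p q hp hq =>
    obtain ⟨p', hp⟩ := hp
    obtain ⟨q', hq⟩ := hq
    exact ⟨p' + q', by rw [map_add, map_add, mul_add, add_mul, hp, hq]⟩
  | coeff_mul r p hp =>
    obtain ⟨p', hp⟩ := hp
    refine ⟨fn r * p', ?_⟩
    have h : Commute (D (.inr j) : A K n d) (fn (inX r)) := by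
      refine D_fn_comm _ _ (MvPolynomial.pderiv_eq_zero_of_notMem_vars fun hm => ?_)
      have := MvPolynomial.vars_rename Sum.inl r hm
      simp at this
    rw [map_mul, map_mul, euler_fn, ← mul_assoc, h.eq, mul_assoc, hp, mul_assoc]
  | der_mul i p hp =>
    obtain ⟨p', hp⟩ := hp
    refine ⟨D i * p', ?_⟩
    rw [map_mul, map_mul, euler_D, ← mul_assoc, (DiffOp.der_comm _ _).eq, mul_assoc, hp, mul_assoc]
  | central_mul k p hp =>
    obtain ⟨p', hp⟩ := hp
    by_cases hjk : j = k
    · subst hjk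
      refine ⟨(Z j + 1) * p', ?_⟩
      rw [map_mul, map_mul, map_add, map_one, euler_Z, ← mul_assoc, ← mul_assoc, D_mul_X_self,
        mul_assoc, hp, mul_assoc]
    · refine ⟨Z k * p', ?_⟩
      have h : Commute (fn (MvPolynomial.X (.inr k)) * D (.inr k) : A K n d) (D (.inr j)) :=
        Commute.mul_left (D_inr_comm_X hjk).symm (DiffOp.der_comm _ _)
      rw [map_mul, map_mul, euler_Z, ← mul_assoc, ← h.eq, mul_assoc _ _ (euler p), hp, ← mul_assoc]

theorem prodS_zero : (prodS 0 : A K n d) = 1 := by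
  rw [prodS]
  refine List.prod_eq_one fun x hx => ?_
  obtain ⟨i, rfl⟩ := List.mem_ofFn.mp hx
  simp [S]

/-- A homogeneous operator of weight `g` is a left multiple of `S_{1,g_1} ⋯ S_{d,g_d}` by a
polynomial in `x, ∂_x, t_1 ∂_{t_1}, …, t_d ∂_{t_d}`. -/
theorem exists_component_eq (P : A K n d) (g : Fin d → ℤ) :
    ∃ b : As K n d, component wt Empty.elim g P = euler b * prodS g := by
  induction P using Weyl.induction_left generalizing g with
  | one =>
    by_cases hg : g = 0
    · exact ⟨1, by rw [hg, (hasWeight_one _ _).component_eq, prodS_zero, map_one, mul_one]⟩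
    · exact ⟨0, by rw [(hasWeight_one _ _).component_of_ne hg, map_zero, zero_mul]⟩
  | add p q hp hq =>
    obtain ⟨p', hp⟩ := hp g
    obtain ⟨q', hq⟩ := hq g
    exact ⟨p' + q', by rw [component_add, map_add, add_mul, hp, hq]⟩
  | C_mul c p hp =>
    obtain ⟨p', hp⟩ := hp g
    refine ⟨fn (MvPolynomial.C c) * p', ?_⟩
    rw [(hasWeight_C _ _ c).component_mul, neg_zero, zero_add, hp, map_mul, euler_fn, inX,
      MvPolynomial.rename_C, mul_assoc]
  | X_mul i p hp =>
    rw [(hasWeight_X _ _ i).component_mul]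
    obtain ⟨p', hp⟩ := hp (-wt i + g)
    rw [hp]
    cases i with
    | inl i =>
      refine ⟨fn (MvPolynomial.X i) * p', ?_⟩
      rw [map_mul, euler_fn, inX, MvPolynomial.rename_X, mul_assoc]
      simp [wt]
    | inr j =>
      -- The factor `t_j` is moved past `euler p'` and then absorbed into the product of the `S`.
      obtain ⟨b, hb⟩ := exists_X_mul_euler j p'
      obtain ⟨b', hb'⟩ := exists_X_mul_prodS (K := K) (n := n) j (-wt (.inr j : Fin n ⊕ Fin d) + g)
      refine ⟨b * b', ?_⟩
      rw [← mul_assoc, hb, mul_assoc, hb', map_mul, mul_assoc]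
      congr 3
      simp [wt]
  | D_mul i p hp =>
    rw [(hasWeight_D _ _ i).component_mul, neg_neg]
    obtain ⟨p', hp⟩ := hp (wt i + g)
    rw [hp]
    cases i with
    | inl i =>
      refine ⟨D i * p', ?_⟩
      rw [map_mul, euler_D, mul_assoc]
      simp [wt]
    | inr j =>
      obtain ⟨b, hb⟩ := exists_D_mul_euler j p'
      obtain ⟨b', hb'⟩ := exists_D_mul_prodS (K := K) (n := n) j (wt (.inr j : Fin n ⊕ Fin d) + g)
      refine ⟨b * b', ?_⟩
      rw [← mul_assoc, hb, mul_assoc, hb', map_mul, mul_assoc]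
      congr 3
      simp [wt]
  | Z_mul j p hp => exact j.elim

/-- The product has weight zero, and in weight zero the factor `prodS` in `exists_component_eq` is
`1`. This carries part (1). -/
theorem HasWt.exists_prodS_mul_eq_euler {g : Fin d → ℤ} {P : A K n d} (h : HasWt g P) :
    ∃ Q : As K n d, prodS (-g) * P = euler Q := by
  obtain ⟨b, hb⟩ := exists_component_eq (prodS (-g) * P) 0
  refine ⟨b, ?_⟩
  have h1 : HasWt 0 (prodS (-g) * P) := by simpa using (hasWt_prodS (-g)).mul h
  rwa [h1.component_eq, prodS_zero, mul_one] at hb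

theorem hasWt_euler (Q : As K n d) : HasWt 0 (euler Q) := by
  induction Q using DiffOp.induction_left with
  | one => rw [map_one]; exact hasWeight_one _ _
  | add p q hp hq => rw [map_add]; exact hp.add hq
  | coeff_mul r p hp =>
    rw [map_mul, euler_fn]
    simpa using (hasWeight_fn_inX _ r).mul hp
  | der_mul i p hp =>
    rw [map_mul, euler_D]
    simpa [wt, HasWt] using (hasWeight_D wt Empty.elim (.inl i)).mul hp
  | central_mul j p hp =>
    rw [map_mul, euler_Z]
    simpa [wt, HasWt] using ((hasWeight_X wt Empty.elim (.inr j)).mul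
      (hasWeight_D wt Empty.elim (.inr j))).mul hp

/-! ### Left multiplication by `S_{1,ν_1} ⋯ S_{d,ν_d}` is injective -/

theorem eq_zero_of_X_mul_eq_zero {i : Fin n ⊕ Fin d} {P : A K n d}
    (h : fn (MvPolynomial.X i) * P = 0) : P = 0 := by
  apply symbol_injective
  have h1 := congrArg symbol h
  rw [symbol_mul, rep_fn, MvPolynomial.rename_X, map_zero] at h1
  rw [map_zero]
  exact (mul_eq_zero.mp h1).resolve_left (MvPolynomial.X_ne_zero _)

/-- Take a monomial `m` of maximal total degree in the symbol. The coefficient of `ξ_i m` in `ξ_i ·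
symbol P + ∂(symbol P)/∂x_i` is that of `m`, because the derivative could reach `ξ_i m` only from
the monomial `x_i ξ_i m`, whose degree is too large. -/
theorem eq_zero_of_D_mul_eq_zero {i : Fin n ⊕ Fin d} {P : A K n d} (h : D i * P = 0) : P = 0 := by
  classical
  apply symbol_injective
  have h1 := congrArg symbol h
  rw [symbol_mul, rep_D, map_zero] at h1
  rw [map_zero]
  by_contra h0
  obtain ⟨m, hm, hmax⟩ := Finset.exists_max_image (symbol P).support (fun m => m.degree)
    (Finset.nonempty_iff_ne_empty.mpr fun he => h0 (MvPolynomial.support_eq_empty.mp he))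
  have h2 := congrArg (MvPolynomial.coeff (Finsupp.single (.inl (.inr i)) 1 + m)) h1
  rw [MvPolynomial.coeff_add, mul_comm, add_comm _ m, MvPolynomial.coeff_mul_X,
    MvPolynomial.coeff_pderiv] at h2
  have h3 : (symbol P).coeff
      (m + Finsupp.single (.inl (.inr i)) 1 + Finsupp.single (.inl (.inl i)) 1) = 0 := by
    by_contra hne
    have := hmax _ (MvPolynomial.mem_support_iff.mpr hne)
    simp only [map_add, Finsupp.degree_single] at this
    omega
  rw [h3, zero_mul, add_zero] at h2
  exact MvPolynomial.mem_support_iff.mp hm h2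

theorem eq_zero_of_S_mul_eq_zero {j : Fin d} {ν : ℤ} {P : A K n d} (h : S j ν * P = 0) :
    P = 0 := by
  have key : ∀ (a : A K n d), (∀ P, a * P = 0 → P = 0) → ∀ (k : ℕ) (P : A K n d),
      a ^ k * P = 0 → P = 0 := by
    intro a ha k
    induction k with
    | zero => intro P hP; simpa using hP
    | succ k ih =>
      intro P hP
      rw [pow_succ, mul_assoc] at hP
      exact ha _ (ih _ hP)
  rw [S] at h
  split_ifs at h
  · exact key _ (fun P => eq_zero_of_D_mul_eq_zero) _ _ h
  · exact key _ (fun P => eq_zero_of_X_mul_eq_zero) _ _ h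

theorem eq_zero_of_prodS_mul_eq_zero {ν : Fin d → ℤ} {P : A K n d} (h : prodS ν * P = 0) :
    P = 0 := by
  have key : ∀ (l : List (A K n d)), (∀ a ∈ l, ∀ P, a * P = 0 → P = 0) → ∀ P : A K n d,
      l.prod * P = 0 → P = 0 := by
    intro l
    induction l with
    | nil => intro _ P hP; simpa using hP
    | cons a l ih =>
      intro hl P hP
      rw [List.prod_cons, mul_assoc] at hP
      exact ih (fun b hb => hl b (List.mem_cons_of_mem _ hb)) _ (hl a List.mem_cons_self _ hP)
  refine key _ (fun a ha P hP => ?_) P h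
  obtain ⟨i, rfl⟩ := List.mem_ofFn.mp ha
  exact eq_zero_of_S_mul_eq_zero hP

/-- Part (2) does not assume homogeneity of `P`; it follows. The product has weight zero and `prodS
ν` has weight `ν`, so comparing components and cancelling `prodS ν` leaves only the component of `P`
of weight `-ν`. -/
theorem hasWt_of_prodS_mul_eq_euler {ν : Fin d → ℤ} {P : A K n d} {Q : As K n d}
    (h : prodS ν * P = euler Q) : HasWt (-ν) P := by
  have h1 : ∀ g, component wt Empty.elim g (euler Q) =
      prodS ν * component wt Empty.elim (-ν + g) P := by
    intro g
    rw [← h, (hasWt_prodS ν).component_mul]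
  refine hasWeight_of_component_eq_zero (fun g hg => ?_) ?_
  · have h2 := h1 (ν + g)
    rw [neg_add_cancel_left, (hasWt_euler Q).component_of_ne] at h2
    · exact eq_zero_of_prodS_mul_eq_zero h2.symm
    · intro h3
      exact hg (eq_neg_of_add_eq_zero_right h3)
  · have h2 := h1 0
    rw [(hasWt_euler Q).component_eq, ← h, add_zero, eq_comm, ← sub_eq_zero, ← mul_sub] at h2
    exact sub_eq_zero.mp (eq_zero_of_prodS_mul_eq_zero h2)

end Procedure

namespace DiffOp

variable {k R : Type*} [CommRing k] [CommRing R] [Algebra k R] {ι : Type*}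
  {δ : ι → Derivation k R R} {τ : Type*}

theorem central_comm (j : τ) (p : DiffOp δ τ) : Commute (central δ τ j) p := by
  induction p using induction_left with
  | one => exact Commute.one_right _
  | add p q hp hq => exact hp.add_right hq
  | coeff_mul r p hp => exact (central_coeff j r).mul_right hp
  | der_mul i p hp => exact (central_der j i).mul_right hp
  | central_mul k p hp => exact (central_central j k).mul_right hp

end DiffOp

namespace Procedure

open Weyl

variable {K : Type*} [Field K] {n d : ℕ}

theorem commute_Z {ι τ : Type*} (j : τ) (p : Weyl K ι τ) : Commute (Z j) p :=
  DiffOp.central_comm j p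

theorem Z_mul_eq (j : Fin d ⊕ Fin d) (p : Auv K n d) : Z j * p = p * Z j :=
  (commute_Z j p).eq

/-! ### The ideal of the graph embedding -/

/-- The left ideal of `A_{n+d}` generated by `t_j - f_j` and
`∂_{x_i} + ∑_j (∂f_j/∂x_i) ∂_{t_j}`. -/
def graphIdeal (f : Fin d → MvPolynomial (Fin n) K) : Ideal (A K n d) :=
  Ideal.span
    (Set.range (fun j : Fin d => fn (MvPolynomial.X (.inr j)) - fn (inX (f j))) ∪
      Set.range (fun i : Fin n =>
        D (.inl i) + ∑ j, fn (inX (MvPolynomial.pderiv i (f j))) * D (.inr j)))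

/-- The specialization `u = v = 1` sends each generator of `I` to a generator of the graph ideal or
to zero, and it is a left inverse of `incl`. -/
theorem mem_graphIdeal_of_incl_mem {f : Fin d → MvPolynomial (Fin n) K} {P : A K n d}
    (h : incl P ∈ ideal f) : P ∈ graphIdeal f := by
  have key : ideal f ≤ (graphIdeal f).comap specialize := by
    rw [ideal, Ideal.span_le]
    rintro _ ((⟨j, rfl⟩ | ⟨i, rfl⟩) | ⟨j, rfl⟩)
    · rw [SetLike.mem_coe, Ideal.mem_comap, map_sub, map_mul, specialize_fn, specialize_fn,
        specialize_Z, one_mul]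
      exact Ideal.subset_span (Or.inl ⟨j, rfl⟩)
    · rw [SetLike.mem_coe, Ideal.mem_comap, map_add, map_sum]
      simp only [map_mul, specialize_fn, specialize_Z, specialize_D, mul_one]
      exact Ideal.subset_span (Or.inr ⟨i, rfl⟩)
    · rw [SetLike.mem_coe, Ideal.mem_comap, map_sub, map_mul, specialize_Z, specialize_Z, map_one,
        mul_one, sub_self]
      exact zero_mem _
  have h1 := key h
  rwa [Ideal.mem_comap, specialize_incl] at h1

/-- On a module over `A_{n+d}[u, v]` on which the `u_j v_j` act as the identity, `A_{n+d}` also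
acts by `t_j ↦ t_j v_j` and `∂_{t_j} ↦ ∂_{t_j} u_j`. -/
theorem exists_rescaled_action {E : Type*} [Ring E] (Λ : Auv K n d →+* E)
    (huv : ∀ j : Fin d, Λ (Z (.inl j) * Z (.inr j)) = 1) :
    ∃ Ψ : A K n d →+* E, (∀ h, Ψ (fn (inX h)) = Λ (fn (inX h))) ∧
      (∀ j, Ψ (fn (MvPolynomial.X (.inr j))) = Λ (fn (MvPolynomial.X (.inr j)) * Z (.inr j))) ∧
      (∀ i, Ψ (D (.inl i)) = Λ (D (.inl i))) ∧
      ∀ j, Ψ (D (.inr j)) = Λ (D (.inr j) * Z (.inl j)) := by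
  -- Setting `u = v = 1` at the indices of `x` allows a uniform treatment of `x` and `t`.
  obtain ⟨u, hul, hur⟩ : ∃ u : Fin n ⊕ Fin d → Auv K n d,
      (∀ i, u (.inl i) = 1) ∧ ∀ j, u (.inr j) = Z (.inl j) :=
    ⟨Sum.elim 1 fun j => Z (.inl j), fun _ => rfl, fun _ => rfl⟩
  obtain ⟨v, hvl, hvr⟩ : ∃ v : Fin n ⊕ Fin d → Auv K n d,
      (∀ i, v (.inl i) = 1) ∧ ∀ j, v (.inr j) = Z (.inr j) :=
    ⟨Sum.elim 1 fun j => Z (.inr j), fun _ => rfl, fun _ => rfl⟩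
  have hu : ∀ i p, Commute (u i) p := by
    rintro (i | j) p
    · rw [hul]; exact Commute.one_left p
    · rw [hur]; exact commute_Z _ p
  have hv : ∀ i p, Commute (v i) p := by
    rintro (i | j) p
    · rw [hvl]; exact Commute.one_left p
    · rw [hvr]; exact commute_Z _ p
  have huv' : ∀ i, Λ (u i * v i) = 1 := by
    rintro (i | j)
    · rw [hul, hvl, mul_one, map_one]
    · rw [hur, hvr, huv]
  have hc : ∀ {a b w w' : Auv K n d}, Commute a b → (∀ p, Commute w p) → (∀ p, Commute w' p) →
      Commute (Λ (a * w)) (Λ (b * w')) := fun hab hw hw' =>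
    ((hab.mul_right (hw' _).symm).mul_left (hw _)).map Λ
  obtain ⟨Ψ, hΨC, hΨX, hΨD, -⟩ := exists_ringHom (τ := Empty)
    (Λ.comp ((DiffOp.coeff _ _).comp MvPolynomial.C))
    (fun i => Λ (fn (MvPolynomial.X i) * v i)) (fun i => Λ (D i * u i)) Empty.elim
    (fun i c => by
      have := hc (fn_comm (MvPolynomial.X i) (MvPolynomial.C c)) (hv i) Commute.one_left
      rwa [mul_one] at this)
    (fun i c => by
      have := hc (D_fn_comm (τ := Fin d ⊕ Fin d) i (MvPolynomial.C c) MvPolynomial.pderiv_C) (hu i)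
        Commute.one_left
      rwa [mul_one] at this)
    (fun j => j.elim)
    (fun i k => hc (fn_comm _ _) (hv i) (hv k))
    (fun i k => hc (DiffOp.der_comm _ _) (hu i) (hu k))
    -- Both products acquire the central factor `u_i v_i`, which acts as the identity, so the
    -- commutator is still `1`.
    (fun i => by
      have e1 : D i * u i * (fn (MvPolynomial.X i) * v i) =
          D i * fn (MvPolynomial.X i) * (u i * v i) := by
        rw [mul_assoc, ← mul_assoc (u i), (hu i _).eq, mul_assoc, ← mul_assoc]
      have e2 : fn (MvPolynomial.X i) * v i * (D i * u i) =
          fn (MvPolynomial.X i) * D i * (u i * v i) := by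
        rw [mul_assoc, ← mul_assoc (v i), (hv i _).eq, mul_assoc, (hv i _).eq, ← mul_assoc]
      rw [← map_mul, ← map_mul, e1, e2, map_mul, map_mul Λ _ (u i * v i), huv' i, mul_one, mul_one,
        D_fn, MvPolynomial.pderiv_X_self, fn_one, map_add, map_one])
    (fun i k hik => hc (D_fn_comm _ _ (MvPolynomial.pderiv_X_of_ne hik.symm)) (hu i) (hv k))
    (fun j => j.elim) (fun j => j.elim) (fun j => j.elim)
  refine ⟨Ψ, fun h => ?_, fun j => ?_, fun i => ?_, fun j => ?_⟩
  · induction h using MvPolynomial.induction_on with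
    | C c =>
      rw [inX, MvPolynomial.rename_C, hΨC]
      rfl
    | add p q hp hq => rw [inX, map_add, fn_add, fn_add, map_add, map_add, hp, hq]
    | mul_X p i hp =>
      rw [inX, map_mul, fn_mul, fn_mul, map_mul, map_mul, hp, MvPolynomial.rename_X, hΨX, hvl,
        mul_one]
  · rw [hΨX, hvr]
  · rw [hΨD, hul, mul_one]
  · rw [hΨD, hur]

/-- Rescaling does not affect weight zero: `t_j v_j ∂_{t_j} u_j = t_j ∂_{t_j} (u_j v_j)`, and `u_j
v_j` acts as the identity. -/
theorem map_euler_eq_map_incl {E : Type*} [Ring E] (Λ : Auv K n d →+* E)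
    (huv : ∀ j : Fin d, Λ (Z (.inl j) * Z (.inr j)) = 1) (Ψ : A K n d →+* E)
    (hX : ∀ h, Ψ (fn (inX h)) = Λ (fn (inX h)))
    (ht : ∀ j, Ψ (fn (MvPolynomial.X (.inr j))) = Λ (fn (MvPolynomial.X (.inr j)) * Z (.inr j)))
    (hD : ∀ i, Ψ (D (.inl i)) = Λ (D (.inl i)))
    (hDt : ∀ j, Ψ (D (.inr j)) = Λ (D (.inr j) * Z (.inl j))) (q : As K n d) :
    Ψ (euler q) = Λ (incl (euler q)) := by
  have h : Ψ.comp euler = (Λ.comp incl).comp euler := by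
    refine DiffOp.ringHom_ext (fun r => ?_) (fun i => ?_) (fun j => ?_)
    · change Ψ (euler (fn r)) = Λ (incl (euler (fn r)))
      rw [euler_fn, incl_fn, hX]
    · change Ψ (euler (D i)) = Λ (incl (euler (D i)))
      rw [euler_D, incl_D, hD]
    · change Ψ (euler (Z j)) = Λ (incl (euler (Z j)))
      have e : fn (MvPolynomial.X (.inr j)) * Z (.inr j) * (D (.inr j) * Z (.inl j)) =
          (fn (MvPolynomial.X (.inr j)) * D (.inr j) * (Z (.inl j) * Z (.inr j)) : Auv K n d) := by
        rw [mul_assoc, Z_mul_eq (.inr j), mul_assoc (D _), ← mul_assoc]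
      rw [euler_Z, map_mul, map_mul, map_mul, incl_fn, incl_D, ht, hDt, ← map_mul, e, map_mul, huv,
        mul_one, map_mul]
  exact congrArg (fun F => F q) h

/-- Homogenization: the homogeneous elements of weight `0` of the graph ideal lie in `I`. -/
theorem incl_euler_mem {f : Fin d → MvPolynomial (Fin n) K} {q : As K n d}
    (hq : euler q ∈ graphIdeal f) : incl (euler q) ∈ ideal f := by
  -- `I` is only a left ideal, so `A_{n+d}[u, v] / I` is used as a left module.
  let M := @HasQuotient.Quotient _ _ Submodule.hasQuotient (ideal f)
  let Λ : Auv K n d →+* Module.End ℤ M := Module.toModuleEnd ℤ M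
  let e : Auv K n d → M := Submodule.Quotient.mk (p := ideal f)
  have he : ∀ p, e p = 0 ↔ p ∈ ideal f := fun p => Submodule.Quotient.mk_eq_zero _
  have hΛ : ∀ p q, Λ p (e q) = e (p * q) := fun p q => rfl
  have he_sub : ∀ p q, p - q ∈ ideal f → e p = e q := fun p q h =>
    (Submodule.Quotient.eq _).mpr h
  have huvI : ∀ (j : Fin d) (p : Auv K n d), p * (Z (.inl j) * Z (.inr j)) - p ∈ ideal f := by
    intro j p
    have h1 : 1 - Z (.inl j) * Z (.inr j) ∈ ideal f := Ideal.subset_span (Or.inr ⟨j, rfl⟩)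
    have h2 := (ideal f).neg_mem (Ideal.mul_mem_left _ p h1)
    rwa [mul_sub, mul_one, neg_sub] at h2
  -- The relation `1 - u_j v_j` kills only the class of `1` a priori; centrality extends this to
  -- every class.
  have huv : ∀ j : Fin d, Λ (Z (.inl j) * Z (.inr j)) = 1 := by
    intro j
    apply LinearMap.ext
    intro x
    obtain ⟨p, rfl⟩ : ∃ p, e p = x := Submodule.Quotient.mk_surjective _ x
    rw [hΛ, ((commute_Z _ p).mul_left (commute_Z _ p)).eq]
    exact he_sub _ _ (huvI j p)
  obtain ⟨Ψ, hX, ht, hD, hDt⟩ := exists_rescaled_action Λ huv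
  -- The annihilator of a vector is a left ideal, so the generators suffice. For the first kind,
  -- `t_j v_j - f_j = v_j (t_j - u_j f_j) + f_j (u_j v_j - 1)`; the second kind becomes a generator
  -- of `I`.
  have key : ∀ P ∈ graphIdeal f, Ψ P (e 1) = 0 := by
    intro P hP
    induction hP using Submodule.span_induction with
    | mem P hP =>
      rcases hP with ⟨j, rfl⟩ | ⟨i, rfl⟩
      · change Ψ (_ - _) (e 1) = 0
        rw [map_sub, hX, ht, ← map_sub, hΛ, mul_one, he]
        have h1 : Z (.inr j) * (fn (MvPolynomial.X (.inr j)) - Z (.inl j) * fn (inX (f j))) ∈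
            ideal f := Ideal.mul_mem_left _ _ (Ideal.subset_span (Or.inl (Or.inl ⟨j, rfl⟩)))
        have h2 := (ideal f).add_mem h1 (huvI j (fn (inX (f j))))
        convert h2 using 1
        rw [Z_mul_eq (.inl j), mul_sub, Z_mul_eq (.inr j) (fn _), Z_mul_eq (.inr j) (_ * _),
          Z_mul_eq (.inl j) (Z _), Z_mul_eq (.inr j) (Z _), mul_assoc]
        abel
      · change Ψ (_ + _) (e 1) = 0
        simp only [map_add, map_sum, map_mul, hX, hD, hDt]
        simp only [← map_mul, ← map_sum, ← map_add]
        rw [hΛ, mul_one, he]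
        have h1 : D (.inl i) + ∑ j, fn (inX (MvPolynomial.pderiv i (f j))) * Z (.inl j) *
            D (.inr j) ∈ ideal f := Ideal.subset_span (Or.inl (Or.inr ⟨i, rfl⟩))
        simpa only [mul_assoc, Z_mul_eq _ (D _)] using h1
    | zero => rw [map_zero, LinearMap.zero_apply]
    | add P Q _ _ hP hQ => rw [map_add, LinearMap.add_apply, hP, hQ, add_zero]
    | smul a P _ hP =>
      rw [smul_eq_mul, map_mul, Module.End.mul_apply, hP, map_zero]
  have h1 := key _ hq
  rw [map_euler_eq_map_incl Λ huv Ψ hX ht hD hDt, hΛ, mul_one, he] at h1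
  exact h1

end Procedure

namespace Procedure

open Weyl

variable {K : Type*} [Field K] {n d : ℕ}

/-! ### Actions of `A_{n+d}` by shifts -/

/-- `A_{n+d}` acts by `t_j h(s) = g_j h(s + e_j)` and `∂_{t_j} h(s) = - s_j g_j⁻¹ h(s - e_j)`. -/
theorem exists_shift_action {M : Type*} [CommRing M] (σ : (Fin d → ℤ) → M →+* M)
    (hσ : ∀ c c' h, σ c (σ c' h) = σ (c + c') h) (hσ0 : ∀ h, σ 0 h = h) (s : Fin d → M)
    (hs : ∀ c j, σ c (s j) = s j + c j) (a : MvPolynomial (Fin n) K →+* M)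
    (ha : ∀ c r, σ c (a r) = a r) (g g' : Fin d → M) (hg : ∀ c j, σ c (g j) = g j)
    (hg' : ∀ c j, σ c (g' j) = g' j) (hgg' : ∀ j, g j * g' j = 1)
    (N : Fin n → Module.End ℤ M)
    (hNa : ∀ i r h, N i (a r * h) = a r * N i h + a (MvPolynomial.pderiv i r) * h)
    (hNN : ∀ i k h, N i (N k h) = N k (N i h))
    (hNT : ∀ i j h, N i (g j * σ (Pi.single j 1) h) = g j * σ (Pi.single j 1) (N i h))
    (hND : ∀ i j h, N i (g' j * s j * σ (-Pi.single j 1) h) =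
      g' j * s j * σ (-Pi.single j 1) (N i h)) :
    ∃ Ψ : A K n d →+* Module.End ℤ M, (∀ r h, Ψ (fn (inX r)) h = a r * h) ∧
      (∀ j h, Ψ (fn (MvPolynomial.X (.inr j))) h = g j * σ (Pi.single j 1) h) ∧
      (∀ i h, Ψ (D (.inl i)) h = N i h) ∧
      ∀ j h, Ψ (D (.inr j)) h = -(g' j * s j * σ (-Pi.single j 1) h) := by
  obtain ⟨μ, hμ⟩ : ∃ μ : M →+* Module.End ℤ M, ∀ x h, μ x h = x * h :=
    ⟨(Algebra.lmul ℤ M).toRingHom, fun _ _ => rfl⟩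
  obtain ⟨τ', hτ⟩ : ∃ τ' : (Fin d → ℤ) → Module.End ℤ M, ∀ c h, τ' c h = σ c h :=
    ⟨fun c => (σ c).toAddMonoidHom.toIntLinearMap, fun _ _ => rfl⟩
  have hsne : ∀ {j k : Fin d} (z : ℤ), j ≠ k → σ (Pi.single j z) (s k) = s k := by
    intro j k z hjk
    rw [hs, Pi.single_eq_of_ne hjk.symm, Int.cast_zero, add_zero]
  have hsne' : ∀ {j k : Fin d} (z : ℤ), j ≠ k → σ (-Pi.single j z) (s k) = s k := by
    intro j k z hjk
    rw [← Pi.single_neg, hsne _ hjk]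
  obtain ⟨Ψ, hC, hX, hD, -⟩ := exists_ringHom (τ := Empty) (μ.comp (a.comp MvPolynomial.C))
    (Sum.elim (fun i => μ (a (MvPolynomial.X i))) (fun j => μ (g j) * τ' (Pi.single j 1)))
    (Sum.elim N (fun j => -(μ (g' j * s j) * τ' (-Pi.single j 1)))) Empty.elim
    (by
      rintro (i | j) c <;> refine LinearMap.ext fun h => ?_ <;>
        simp [Module.End.mul_apply, hμ, hτ, ha] <;> ring)
    (by
      rintro (i | j) c <;> refine LinearMap.ext fun h => ?_
      · simp [Module.End.mul_apply, hμ, hNa]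
      · simp [Module.End.mul_apply, hμ, hτ, ha]; ring)
    (fun j => j.elim)
    (by
      rintro (i | j) (k | k) <;> refine LinearMap.ext fun h => ?_ <;>
        simp [Module.End.mul_apply, hμ, hτ, ha, hg, hσ]
      · ring
      · ring
      · ring
      · rw [add_comm (Pi.single j 1)]; ring)
    (by
      rintro (i | j) (k | k) <;> refine LinearMap.ext fun h => ?_ <;>
        simp only [Module.End.mul_apply, Sum.elim_inl, Sum.elim_inr, LinearMap.neg_apply, hμ, hτ,
          map_neg, neg_neg]
      · rw [hNN]
      · rw [hND]
      · rw [hND]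
      · by_cases hjk : j = k
        · subst hjk; rfl
        · rw [map_mul, map_mul, map_mul, map_mul, hsne' _ hjk, hsne' _ (Ne.symm hjk), hσ, hσ, hg',
            hg', add_comm (-Pi.single j 1)]
          ring)
    (by
      rintro (i | j) <;> refine LinearMap.ext fun h => ?_
      · simp [Module.End.mul_apply, hμ, hNa]
      -- Here `∂_{t_j} t_j` acts as `-s_j` and `t_j ∂_{t_j}` as `-(s_j + 1)`; their difference is
      -- `1`.
      · simp only [Module.End.mul_apply, Sum.elim_inr, LinearMap.neg_apply, hμ, hτ,
          LinearMap.add_apply, Module.End.one_apply, map_neg, map_mul, hg, hg', hσ, hs,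
          add_neg_cancel, neg_add_cancel, hσ0, Pi.single_eq_same, Int.cast_one]
        linear_combination h * hgg' j)
    (by
      rintro (i | j) (k | k) hne <;> refine LinearMap.ext fun h => ?_
      · have : i ≠ k := fun h => hne (by rw [h])
        simp [Module.End.mul_apply, hμ, hNa, MvPolynomial.pderiv_X_of_ne this.symm]
      · simp [Module.End.mul_apply, hμ, hτ, hNT]
      · simp [Module.End.mul_apply, hμ, hτ, ha]; ring
      · have : j ≠ k := fun h => hne (by rw [h])
        simp only [Module.End.mul_apply, Sum.elim_inr, LinearMap.neg_apply, hμ, hτ,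
          map_neg, map_mul, hg, hg', hσ, hsne _ this.symm]
        rw [add_comm (-Pi.single j 1)]
        ring)
    (fun j => j.elim) (fun j => j.elim) (fun j => j.elim)
  refine ⟨Ψ, fun r => ?_, fun j h => ?_, fun i h => ?_, fun j h => ?_⟩
  · induction r using MvPolynomial.induction_on with
    | C c =>
      intro h
      rw [inX, MvPolynomial.rename_C, hC, RingHom.comp_apply, hμ, RingHom.comp_apply]
    | add p q hp hq =>
      intro h
      rw [inX, map_add, fn_add, map_add, LinearMap.add_apply, hp, hq, map_add, add_mul]
    | mul_X p i hp =>
      intro h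
      rw [inX, map_mul, fn_mul, map_mul, Module.End.mul_apply, hp, MvPolynomial.rename_X, hX,
        Sum.elim_inl, hμ, map_mul, mul_assoc]
  · rw [hX, Sum.elim_inr, Module.End.mul_apply, hμ, hτ]
  · rw [hD, Sum.elim_inl]
  · rw [hD, Sum.elim_inr, LinearMap.neg_apply, Module.End.mul_apply, hμ, hτ]

theorem reflect_fn (r : MvPolynomial (Fin n) K) : reflect (fn r : As K n d) = fn r :=
  DiffOp.lift_coeff _ _ _ _ _ _ _ _ r

theorem reflect_D (i : Fin n) : reflect (D i : As K n d) = D i :=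
  DiffOp.lift_der _ _ _ _ _ _ _ _ i

theorem reflect_Z (j : Fin d) : reflect (Z j : As K n d) = -Z j - 1 :=
  DiffOp.lift_central _ _ _ _ _ _ _ _ j

theorem reflect_reflect (q : As K n d) : reflect (reflect q) = q := by
  have h : (reflect.comp reflect : As K n d →+* As K n d) = RingHom.id _ := by
    refine DiffOp.ringHom_ext (fun r => ?_) (fun i => ?_) (fun j => ?_)
    · exact (congrArg reflect (reflect_fn r)).trans (reflect_fn r)
    · exact (congrArg reflect (reflect_D i)).trans (reflect_D i)
    · refine (congrArg reflect (reflect_Z j)).trans ?_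
      rw [map_sub, map_neg, reflect_Z, map_one, RingHom.id_apply]
      abel
  exact congrArg (fun F => F q) h

/-- For an action as in `exists_shift_action`, `euler` turns into the substitution inverse to
`reflect`. -/
theorem shift_action_euler_reflect {M : Type*} [CommRing M] {σ : (Fin d → ℤ) → M →+* M}
    (hσ : ∀ c c' h, σ c (σ c' h) = σ (c + c') h) (hσ0 : ∀ h, σ 0 h = h) {s : Fin d → M}
    (hs : ∀ c j, σ c (s j) = s j + c j) {g g' : Fin d → M}
    (hg' : ∀ c j, σ c (g' j) = g' j) (hgg' : ∀ j, g j * g' j = 1)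
    {Ψ : A K n d →+* Module.End ℤ M}
    (hT : ∀ j h, Ψ (fn (MvPolynomial.X (.inr j))) h = g j * σ (Pi.single j 1) h)
    (hD : ∀ j h, Ψ (D (.inr j)) h = -(g' j * s j * σ (-Pi.single j 1) h))
    (j : Fin d) (h : M) : Ψ (euler (reflect (Z j))) h = s j * h := by
  rw [reflect_Z, map_sub, map_neg, euler_Z, map_one, map_sub, map_neg, map_mul, map_one,
    LinearMap.sub_apply, LinearMap.neg_apply, Module.End.mul_apply, hD, hT, Module.End.one_apply]
  simp only [map_neg, map_mul, hg', hs, hσ, add_neg_cancel, hσ0, Pi.single_eq_same, Int.cast_one]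
  linear_combination (s j + 1) * h * hgg' j

/-! ### Injectivity of the substitution `s_j ↦ t_j ∂_{t_j}` -/

/-- A shift action with all `f_j` replaced by `1`, on the ring of symbols of `A_n[s]`. Through
`euler` and `reflect` it restores the representation `rep`, which determines an operator. -/
theorem exists_action_euler_reflect_eq_rep :
    ∃ Ψ : A K n d →+* Module.End ℤ (MvPolynomial (GrVar (Fin n) (Fin d)) K),
      ∀ (q : As K n d) h, Ψ (euler (reflect q)) h = rep q h := by
  obtain ⟨σ, hσC, hσl, hσr⟩ : ∃ σ : (Fin d → ℤ) → MvPolynomial (GrVar (Fin n) (Fin d)) K →+*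
      MvPolynomial (GrVar (Fin n) (Fin d)) K, (∀ c k, σ c (MvPolynomial.C k) = MvPolynomial.C k) ∧
      (∀ c i, σ c (MvPolynomial.X (.inl i)) = MvPolynomial.X (.inl i)) ∧
      ∀ c j, σ c (MvPolynomial.X (.inr j)) =
        MvPolynomial.X (.inr j) + ((c j : ℤ) : MvPolynomial (GrVar (Fin n) (Fin d)) K) :=
    ⟨fun c => MvPolynomial.eval₂Hom MvPolynomial.C (Sum.elim (fun i => MvPolynomial.X (.inl i))
      fun j => MvPolynomial.X (.inr j) +
        ((c j : ℤ) : MvPolynomial (GrVar (Fin n) (Fin d)) K)), by simp, by simp, by simp⟩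
  have hσ : ∀ c c' h, σ c (σ c' h) = σ (c + c') h := by
    intro c c' h
    have : (σ c).comp (σ c') = σ (c + c') := by
      refine MvPolynomial.ringHom_ext (fun k => ?_) ?_
      · simp [hσC]
      · rintro (i | j)
        · simp [hσl]
        · simp [hσr, add_assoc]
    exact congrArg (fun F => F h) this
  have hσ0 : ∀ h, σ 0 h = h := by
    intro h
    have : σ 0 = RingHom.id _ := by
      refine MvPolynomial.ringHom_ext (fun k => ?_) ?_
      · simp [hσC]
      · rintro (i | j)
        · simp [hσl]
        · simp [hσr]
    exact congrArg (fun F => F h) this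
  have hσp : ∀ c i h, σ c (MvPolynomial.pderiv (.inl i) h) =
      MvPolynomial.pderiv (.inl i) (σ c h) := by
    intro c i h
    induction h using MvPolynomial.induction_on with
    | C k => simp [hσC]
    | add p q hp hq => simp [hp, hq]
    | mul_X p v hp =>
      rw [Derivation.leibniz, map_mul, Derivation.leibniz, smul_eq_mul, smul_eq_mul, smul_eq_mul,
        smul_eq_mul, map_add, map_mul, map_mul, hp]
      rcases v with v | j
      · rw [hσl]
        by_cases hv : v = i
        · subst hv; simp
        · rw [MvPolynomial.pderiv_X_of_ne (by simpa using hv)]; simp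
      · rw [hσr, MvPolynomial.pderiv_X_of_ne (by simp), map_add,
          MvPolynomial.pderiv_X_of_ne (by simp)]
        simp
  obtain ⟨a, ha⟩ : ∃ a : MvPolynomial (Fin n) K →+* MvPolynomial (GrVar (Fin n) (Fin d)) K,
      ∀ r, a r = MvPolynomial.rename (fun i => .inl (.inl i)) r :=
    ⟨(MvPolynomial.rename _ : MvPolynomial (Fin n) K →ₐ[K] _).toRingHom, fun _ => rfl⟩
  obtain ⟨Ψ, hX, hT, hD, hDt⟩ := exists_shift_action σ hσ hσ0
    (fun j => MvPolynomial.X (.inr j)) hσr a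
    (fun c r => by
      induction r using MvPolynomial.induction_on with
      | C k => simp [ha, hσC]
      | add p q hp hq => simp [hp, hq]
      | mul_X p v hp => rw [map_mul, map_mul, hp, ha (MvPolynomial.X v), MvPolynomial.rename_X, hσl])
    -- With trivial `g_j` and `g_j⁻¹` the operators `t_j`, `∂_{t_j}` only shift `s` and multiply by
    -- `-s_j`, so they commute with the action of `∂_{x_i}`.
    (fun _ => 1) (fun _ => 1) (by simp) (by simp) (by simp)
    (fun i => (rep (D i : As K n d)).restrictScalars ℤ)
    (fun i r h => by
      have := LinearMap.congr_fun (congrArg rep (D_fn (τ := Fin d) i r)) h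
      simp only [map_mul, map_add, Module.End.mul_apply, LinearMap.add_apply, rep_fn] at this
      simpa [ha] using this)
    (fun i k h => by
      have := LinearMap.congr_fun (congrArg rep (DiffOp.der_comm (δ := partials K (Fin n))
        (τ := Fin d) i k).eq) h
      simpa [map_mul, Module.End.mul_apply] using this)
    (fun i j h => by simp [rep_D, hσp, hσl])
    (fun i j h => by
      simp only [LinearMap.coe_restrictScalars, rep_D, one_mul, Derivation.leibniz, hσp, map_add,
        map_mul, hσl, MvPolynomial.pderiv_X_of_ne (show (.inr j : GrVar (Fin n) (Fin d)) ≠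
          .inl (.inl i) by simp), smul_eq_mul, mul_zero, add_zero]
      ring)
  refine ⟨Ψ, fun q => ?_⟩
  induction q using DiffOp.induction_left with
  | one => intro h; simp
  | add p q hp hq => intro h; simp [hp, hq]
  | coeff_mul r p hp =>
    intro h
    have e : Ψ (euler (reflect (fn r))) (rep p h) = rep (fn r) (rep p h) := by
      rw [reflect_fn, euler_fn, hX, rep_fn, ha]
    rw [map_mul, map_mul, map_mul, map_mul, Module.End.mul_apply, Module.End.mul_apply, hp, e]
  | der_mul i p hp =>
    intro h
    have e : Ψ (euler (reflect (D i))) (rep p h) = rep (D i) (rep p h) := by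
      rw [reflect_D, euler_D, hD]
      rfl
    rw [map_mul, map_mul, map_mul, map_mul, Module.End.mul_apply, Module.End.mul_apply, hp, e]
  | central_mul j p hp =>
    intro h
    have e : Ψ (euler (reflect (Z j))) (rep p h) = rep (Z j) (rep p h) := by
      rw [rep_Z]
      exact shift_action_euler_reflect hσ hσ0 hσr (by simp) (by simp) hT hDt j _
    rw [map_mul, map_mul, map_mul, map_mul, Module.End.mul_apply, Module.End.mul_apply, hp, e]

theorem euler_injective : Function.Injective (euler : As K n d →+* A K n d) := by
  obtain ⟨Ψ, hΨ⟩ := exists_action_euler_reflect_eq_rep (K := K) (n := n) (d := d)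
  intro p q hpq
  rw [← reflect_reflect p, ← reflect_reflect q] at hpq ⊢
  congr 1
  apply symbol_injective
  rw [symbol_apply, symbol_apply, ← hΨ, ← hΨ, hpq]

end Procedure

/-! ### Base change of rings of differential operators -/

namespace DiffOp

variable {k R k' R' : Type*} [CommRing k] [CommRing R] [Algebra k R] [CommRing k'] [CommRing R']
  [Algebra k' R'] {ι : Type*} {δ : ι → Derivation k R R} {δ' : ι → Derivation k' R' R'}
  {τ : Type*} (φ : R →+* R') (h : ∀ i r, φ (δ i r) = δ' i (φ r))

theorem map_coeff (r : R) : map φ h (coeff δ τ r) = coeff δ' τ (φ r) :=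
  lift_coeff _ _ _ _ _ _ _ _ r

theorem map_der (i : ι) : map φ h (der δ τ i) = der δ' τ i :=
  lift_der _ _ _ _ _ _ _ _ i

theorem map_central (j : τ) : map φ h (central δ τ j) = central δ' τ j :=
  lift_central _ _ _ _ _ _ _ _ j

/-- After base change, `R⟨Δ⟩[z]` generates `R'⟨Δ⟩[z]` as a left `R'`-module. -/
theorem exists_eq_sum_coeff_mul_map (p : DiffOp δ' τ) :
    ∃ (l : ℕ) (r : Fin l → R') (b : Fin l → DiffOp δ τ),
      p = ∑ i, coeff δ' τ (r i) * map φ h (b i) := by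
  have hadd : ∀ p q : DiffOp δ' τ,
      (∃ (l : ℕ) (r : Fin l → R') (b : Fin l → DiffOp δ τ),
        p = ∑ i, coeff δ' τ (r i) * map φ h (b i)) →
      (∃ (l : ℕ) (r : Fin l → R') (b : Fin l → DiffOp δ τ),
        q = ∑ i, coeff δ' τ (r i) * map φ h (b i)) →
      ∃ (l : ℕ) (r : Fin l → R') (b : Fin l → DiffOp δ τ),
        p + q = ∑ i, coeff δ' τ (r i) * map φ h (b i) := by
    rintro _ _ ⟨l, r, b, rfl⟩ ⟨l', r', b', rfl⟩
    exact ⟨l + l', Fin.append r r', Fin.append b b', by simp [Fin.sum_univ_add]⟩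
  induction p using induction_left with
  | one => exact ⟨1, fun _ => 1, fun _ => 1, by simp⟩
  | add p q hp hq => exact hadd p q hp hq
  | coeff_mul r p hp =>
    obtain ⟨l, r', b, rfl⟩ := hp
    exact ⟨l, fun i => r * r' i, b, by simp [Finset.mul_sum, mul_assoc]⟩
  | der_mul i p hp =>
    obtain ⟨l, r, b, rfl⟩ := hp
    have e : der δ' τ i * ∑ m, coeff δ' τ (r m) * map φ h (b m) =
        ∑ m, coeff δ' τ (r m) * map φ h (der δ τ i * b m) +
        ∑ m, coeff δ' τ (δ' i (r m)) * map φ h (b m) := by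
      rw [Finset.mul_sum, ← Finset.sum_add_distrib]
      refine Finset.sum_congr rfl fun m _ => ?_
      rw [← mul_assoc, der_coeff, add_mul, map_mul, map_der, mul_assoc]
    rw [e]
    exact hadd _ _ ⟨l, r, _, rfl⟩ ⟨l, _, b, rfl⟩
  | central_mul j p hp =>
    obtain ⟨l, r, b, rfl⟩ := hp
    refine ⟨l, r, fun i => central δ τ j * b i, ?_⟩
    rw [Finset.mul_sum]
    refine Finset.sum_congr rfl fun m _ => ?_
    rw [← mul_assoc, (central_coeff j _).eq, map_mul, map_central, mul_assoc]

end DiffOp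

namespace ComplexPower

variable {k R : Type*} [CommRing k] [CommRing R] [Algebra k R] {ι : Type*}
  (δ : ι → Derivation k R R) {d : ℕ} (g : Fin d → R)
  (hδ : ∀ i l r, δ i (δ l r) = δ l (δ i r))

theorem action_coeff (r : R) (h : Mod g) :
    action δ g hδ (DiffOp.coeff δ (Fin d) r) h =
      MvPolynomial.C (algebraMap R (Coeff g) r) * h :=
  LinearMap.congr_fun (DiffOp.lift_coeff _ _ _ _ _ _ _ _ r) h

theorem action_der (i : ι) (h : Mod g) :
    action δ g hδ (DiffOp.der δ (Fin d) i) h = nabla δ g i h :=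
  LinearMap.congr_fun (DiffOp.lift_der _ _ _ _ _ _ _ _ i) h

theorem action_central (j : Fin d) (h : Mod g) :
    action δ g hδ (DiffOp.central δ (Fin d) j) h = MvPolynomial.X j * h :=
  LinearMap.congr_fun (DiffOp.lift_central _ _ _ _ _ _ _ _ j) h

theorem mem_ann {p : DiffOp δ (Fin d)} : p ∈ ann δ g hδ ↔ action δ g hδ p 1 = 0 := Iff.rfl

end ComplexPower

/-! ### The action of `A_{n+d}` on the module generated by `f^s` -/

namespace Procedure

open Weyl ComplexPower

variable {K : Type*} [Field K] {n d : ℕ}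

section Action

variable {k R : Type*} [CommRing k] [CommRing R] [Algebra k R] (δ : Fin n → Derivation k R R)
  (hδ : ∀ i l r, δ i (δ l r) = δ l (δ i r)) (φ : MvPolynomial (Fin n) K →+* R)
  (hφ : ∀ i r, φ (partials K (Fin n) i r) = δ i (φ r)) (f : Fin d → MvPolynomial (Fin n) K)

/-- The action of `A_{n+d}` on `R[s, 1/f] f^s` by `t_j h(s) f^s = h(s + e_j) f_j f^s` and
`Δ_{t_j} h(s) f^s = -s_j h(s - e_j) f_j⁻¹ f^s`. -/
theorem exists_action_mod : ∃ Ψ : A K n d →+* Module.End ℤ (Mod fun j => φ (f j)),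
    (∀ q h, Ψ (euler (reflect q)) h =
      action δ (fun j => φ (f j)) hδ (DiffOp.map φ hφ q) h) ∧
    (∀ r h, Ψ (fn (inX r)) h = MvPolynomial.C (algebraMap R (Coeff fun j => φ (f j)) (φ r)) * h) ∧
    (∀ j r h, Ψ (D (.inr j)) (MvPolynomial.C r * h) = MvPolynomial.C r * Ψ (D (.inr j)) h) ∧
    (∀ j r h, Ψ (fn (MvPolynomial.X (.inr j))) (MvPolynomial.C r * h) =
      MvPolynomial.C r * Ψ (fn (MvPolynomial.X (.inr j))) h) ∧
    ∀ P ∈ graphIdeal f, Ψ P 1 = 0 := by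
  obtain ⟨g, hg⟩ : ∃ g : Fin d → R, g = fun j => φ (f j) := ⟨_, rfl⟩
  have hgj : ∀ j, φ (f j) = g j := fun j => by rw [hg]
  rw [← hg]
  obtain ⟨σ, hσC, hσX⟩ : ∃ σ : (Fin d → ℤ) → Mod g →+* Mod g,
      (∀ c r, σ c (MvPolynomial.C r) = MvPolynomial.C r) ∧
      ∀ c j, σ c (MvPolynomial.X j) = MvPolynomial.X j + ((c j : ℤ) : Mod g) :=
    ⟨fun c => MvPolynomial.eval₂Hom MvPolynomial.C (fun j => MvPolynomial.X j +
        ((c j : ℤ) : Mod g)), by simp, by simp⟩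
  have hσ : ∀ c c' h, σ c (σ c' h) = σ (c + c') h := by
    intro c c' h
    have : (σ c).comp (σ c') = σ (c + c') := by
      refine MvPolynomial.ringHom_ext (fun k => ?_) fun j => ?_
      · simp [hσC]
      · simp [hσX, add_assoc]
    exact congrArg (fun F => F h) this
  have hσ0 : ∀ h, σ 0 h = h := by
    intro h
    have : σ 0 = RingHom.id _ := by
      refine MvPolynomial.ringHom_ext (fun k => ?_) fun j => ?_
      · simp [hσC]
      · simp [hσX]
    exact congrArg (fun F => F h) this
  obtain ⟨Δ, hd⟩ : ∃ Δ : Fin n → Derivation k (Mod g) (Mod g),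
      ∀ i, Δ i = DerExt.poly (Fin d) (DerExt.loc (Submonoid.powers (∏ j, g j)) (δ i)) :=
    ⟨_, fun _ => rfl⟩
  have hdC : ∀ i b, Δ i (MvPolynomial.C b) =
      MvPolynomial.C (DerExt.loc (Submonoid.powers (∏ j, g j)) (δ i) b) := by
    intro i b
    rw [hd, DerExt.poly_C]
  have hdX : ∀ i j, Δ i (MvPolynomial.X j) = 0 := by
    intro i j
    rw [hd, DerExt.poly_X]
  have hσd : ∀ c i h, σ c (Δ i h) = Δ i (σ c h) := by
    intro c i h
    induction h using MvPolynomial.induction_on with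
    | C b => rw [hdC, hσC, hσC, hdC]
    | add p q hp hq => rw [map_add, map_add, map_add, map_add, hp, hq]
    | mul_X p j hp =>
      have e : Δ i (MvPolynomial.X j + ((c j : ℤ) : Mod g)) = 0 := by
        rw [map_add, hdX, Derivation.map_intCast, add_zero]
      rw [Derivation.leibniz, hdX, map_mul, Derivation.leibniz, hσX, e]
      simp [hp, hσX]
  have hunit := isUnit_algebraMap g
  obtain ⟨γ, hγ⟩ : ∃ γ : Fin d → Coeff g, ∀ j, γ j = algebraMap R (Coeff g) (g j) :=
    ⟨_, fun _ => rfl⟩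
  obtain ⟨γ', hγ'⟩ : ∃ γ' : Fin d → Coeff g, ∀ j, γ' j = Ring.inverse (γ j) :=
    ⟨_, fun _ => rfl⟩
  have hγγ' : ∀ j, γ j * γ' j = 1 := by
    intro j
    rw [hγ', hγ]
    exact Ring.mul_inverse_cancel _ (hunit j)
  obtain ⟨lam, hlam⟩ : ∃ lam : Fin n → Fin d → Coeff g, ∀ i j, lam i j = logDer δ g i j :=
    ⟨_, fun _ _ => rfl⟩
  have hdγ : ∀ i j, Δ i (MvPolynomial.C (γ j)) = MvPolynomial.C (γ j * lam i j) := by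
    intro i j
    rw [hdC, hlam, logDer, hγ, DerExt.loc_algebraMap, mul_left_comm, ← hγ, ← hγ', hγγ', mul_one]
  have hdγ' : ∀ i j, Δ i (MvPolynomial.C (γ' j)) = -MvPolynomial.C (γ' j * lam i j) := by
    intro i j
    have h1 : (MvPolynomial.C (γ' j) : Mod g) * MvPolynomial.C (γ j) = 1 := by
      rw [← map_mul, mul_comm, hγγ', map_one]
    rw [Derivation.leibniz_of_mul_eq_one _ h1, hdγ, map_mul, map_mul, smul_eq_mul]
    linear_combination (-MvPolynomial.C (γ' j) * MvPolynomial.C (lam i j)) * h1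
  obtain ⟨θ, hθ⟩ : ∃ θ : Fin n → Mod g, ∀ i, θ i = twist δ g i := ⟨_, fun _ => rfl⟩
  -- The shift of `s_j` by `z` changes the twist by `z` times the logarithmic derivative of `f_j`.
  -- For `z = 1` and `z = -1` this matches the derivatives of the factors `f_j` and `f_j⁻¹`, which
  -- is why `∂_{x_i}` commutes with `t_j` and `∂_{t_j}`.
  have hσθ : ∀ i (z : ℤ) j, σ (Pi.single j z) (θ i) =
      θ i + (z : Mod g) * (MvPolynomial.C (lam i j) : Mod g) := by
    intro i z j
    simp only [hθ, twist, map_sum, map_mul, hσX, hσC, add_mul, Finset.sum_add_distrib, ← hlam]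
    congr 1
    rw [Finset.sum_eq_single j]
    · rw [Pi.single_eq_same]
    · intro b _ hb
      rw [Pi.single_eq_of_ne hb, Int.cast_zero, zero_mul]
    · simp
  have hN : ∀ i h, nabla δ g i h = Δ i h + θ i * h := by
    intro i h
    rw [nabla_apply, hd, hθ]
  obtain ⟨Ψ, hX, hT, hDx, hDt⟩ := exists_shift_action σ hσ hσ0 (fun j => MvPolynomial.X j) hσX
    (MvPolynomial.C.comp ((algebraMap R (Coeff g)).comp φ)) (fun c r => hσC c _)
    (fun j => MvPolynomial.C (γ j)) (fun j => MvPolynomial.C (γ' j)) (fun c j => hσC c _)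
    (fun c j => hσC c _) (fun j => by rw [← map_mul, hγγ', map_one])
    (fun i => (nabla δ g i).toAddMonoidHom.toIntLinearMap)
    (fun i r h => by
      change nabla δ g i _ = _ * nabla δ g i h + _
      rw [hN, hN, Derivation.leibniz, RingHom.comp_apply, hdC, RingHom.comp_apply,
        DerExt.loc_algebraMap, ← hφ, smul_eq_mul, smul_eq_mul, RingHom.comp_apply,
        RingHom.comp_apply]
      ring)
    (fun i l h => LinearMap.congr_fun (nabla_comm δ g hδ i l).eq h)
    (fun i j h => by
      change nabla δ g i _ = _ * σ _ (nabla δ g i h)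
      have h1 := hσθ i 1 j
      rw [Int.cast_one, one_mul] at h1
      rw [hN, hN, Derivation.leibniz, hdγ, map_add, map_mul, hσd, map_mul (σ _) (θ i), h1,
        smul_eq_mul, smul_eq_mul]
      ring)
    (fun i j h => by
      change nabla δ g i _ = _ * σ _ (nabla δ g i h)
      have h1 : σ (-Pi.single j 1) (θ i) = θ i - MvPolynomial.C (lam i j) := by
        rw [← Pi.single_neg, hσθ]
        push_cast
        ring
      rw [hN, hN, Derivation.leibniz, Derivation.leibniz, hdγ', hdX, map_add, map_mul, hσd, map_mul (σ _) (θ i), h1,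
        smul_eq_mul, smul_eq_mul, smul_eq_mul, smul_eq_mul]
      ring)
  refine ⟨Ψ, fun q => ?_, hX, fun j r h => ?_, fun j r h => ?_, fun P hP => ?_⟩
  · induction q using DiffOp.induction_left with
    | one => intro h; simp
    | add p q hp hq => intro h; simp [hp, hq]
    | coeff_mul r p hp =>
      intro h
      have e : ∀ h, Ψ (euler (reflect (fn r))) h =
          action δ g hδ (DiffOp.map φ hφ (DiffOp.coeff _ _ r)) h := by
        intro h
        rw [reflect_fn, euler_fn, hX, DiffOp.map_coeff, action_coeff]
        rfl
      rw [map_mul, map_mul, map_mul, map_mul, map_mul, Module.End.mul_apply,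
        Module.End.mul_apply, hp, e]
    | der_mul i p hp =>
      intro h
      have e : ∀ h, Ψ (euler (reflect (D i))) h =
          action δ g hδ (DiffOp.map φ hφ (DiffOp.der _ _ i)) h := by
        intro h
        rw [reflect_D, euler_D, hDx, DiffOp.map_der, action_der]
        rfl
      rw [map_mul, map_mul, map_mul, map_mul, map_mul, Module.End.mul_apply,
        Module.End.mul_apply, hp, e]
    | central_mul j p hp =>
      intro h
      have e : ∀ h, Ψ (euler (reflect (Z j))) h =
          action δ g hδ (DiffOp.map φ hφ (DiffOp.central _ _ j)) h := by
        intro h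
        rw [DiffOp.map_central, action_central]
        exact shift_action_euler_reflect hσ hσ0 hσX (fun c j => hσC c _)
          (fun j => by rw [← map_mul, hγγ', map_one]) hT hDt j h
      rw [map_mul, map_mul, map_mul, map_mul, map_mul, Module.End.mul_apply,
        Module.End.mul_apply, hp, e]
  · rw [hDt, hDt, map_mul, hσC]
    ring
  · rw [hT, hT, map_mul, hσC]
    ring
  -- On `f^s` itself, `t_j` gives `f_j`, `∂_{t_j}` gives `-s_j / f_j`, and `∂_{x_i}` gives `∑_j s_j
  -- (∂f_j/∂x_i) / f_j`.
  · induction hP using Submodule.span_induction with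
    | mem P hP =>
      rcases hP with ⟨j, rfl⟩ | ⟨i, rfl⟩
      · change Ψ (_ - _) 1 = 0
        rw [map_sub, LinearMap.sub_apply, hX, hT, map_one, hγ, ← hgj]
        exact sub_self _
      · change Ψ (_ + _) 1 = 0
        rw [map_add, map_sum, LinearMap.add_apply, LinearMap.sum_apply, hDx]
        change nabla δ g i 1 + _ = 0
        rw [hN, Derivation.map_one_eq_zero, zero_add, mul_one, hθ, twist, ← Finset.sum_add_distrib]
        refine Finset.sum_eq_zero fun j _ => ?_
        rw [map_mul, Module.End.mul_apply, hDt, hX, map_one, logDer, ← hγ, ← hγ', RingHom.comp_apply,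
          RingHom.comp_apply]
        have h1 := hφ i (f j)
        rw [hgj] at h1
        rw [← h1, map_mul]
        ring
    | zero => rw [map_zero, LinearMap.zero_apply]
    | add P Q _ _ hP hQ => rw [map_add, LinearMap.add_apply, hP, hQ, add_zero]
    | smul a P _ hP => rw [smul_eq_mul, map_mul, Module.End.mul_apply, hP, map_zero]

/-- If `Q(x, Δ_x, t_1 Δ_{t_1}, …)` lies in the graph ideal, then `Q(x, Δ_x, -s_1 - 1, …)`
annihilates `f^s`. -/
theorem map_reflect_mem_ann {q : As K n d} (hq : euler q ∈ graphIdeal f) :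
    DiffOp.map φ hφ (reflect q) ∈ ann δ (fun j => φ (f j)) hδ := by
  obtain ⟨Ψ, hΨ, -, -, -, h0⟩ := exists_action_mod δ hδ φ hφ f
  rw [mem_ann, ← hΨ, reflect_reflect]
  exact h0 _ hq

end Action

end Procedure

/-! ### Polynomial rings: derivations, faithful action and flat change of coefficients -/

/-- An element whose commutators with the generators of a polynomial ring are given by a
derivation acts on the whole ring by this derivation. -/
theorem MvPolynomial.mul_map_eq_of_derivation {k R E σ : Type*} [CommRing k] [CommRing R]
    [Algebra k R] [Ring E] (e : MvPolynomial σ R →+* E) (a : E)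
    (δ : Derivation k (MvPolynomial σ R) (MvPolynomial σ R))
    (hC : ∀ r, a * e (C r) = e (C r) * a + e (δ (C r)))
    (hX : ∀ j, a * e (X j) = e (X j) * a + e (δ (X j))) (p : MvPolynomial σ R) :
    a * e p = e p * a + e (δ p) := by
  induction p using MvPolynomial.induction_on with
  | C r => exact hC r
  | add p q hp hq =>
    simp only [map_add, mul_add, add_mul, hp, hq]
    abel
  | mul_X p j hp =>
    rw [Derivation.leibniz, smul_eq_mul, smul_eq_mul, map_mul, ← mul_assoc, hp, add_mul, mul_assoc,
      hX, mul_add, map_add, map_mul, mul_comm (X j), map_mul, mul_assoc]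
    abel

/-- Nonzero exponents are invertible in a `ℚ`-algebra; this is where characteristic zero enters. -/
theorem MvPolynomial.eq_zero_of_pderiv_eq_zero {R σ : Type*} [CommRing R] [Algebra ℚ R]
    {p : MvPolynomial σ R} (h : ∀ j, pderiv j p = 0) : p = C (coeff 0 p) := by
  classical
  ext m
  rw [coeff_C]
  split_ifs with hm
  · rw [hm]
  · obtain ⟨j, hj⟩ : ∃ j, m j ≠ 0 := by
      by_contra! h0
      exact hm (Finsupp.ext fun j => (h0 j).symm)
    have h1 := congrArg (coeff (m - Finsupp.single j 1)) (h j)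
    have hle : Finsupp.single j 1 ≤ m := by
      rw [Finsupp.single_le_iff]
      omega
    rw [coeff_pderiv, tsub_add_cancel_of_le hle, coeff_zero] at h1
    have hu : IsUnit (((m - Finsupp.single j 1 : σ →₀ ℕ) j : R) + 1) := by
      have h2 : IsUnit (((m - Finsupp.single j 1 : σ →₀ ℕ) j + 1 : ℕ) : ℚ) :=
        IsUnit.mk0 _ (Nat.cast_ne_zero.mpr (Nat.succ_ne_zero _))
      have h3 := h2.map (algebraMap ℚ R)
      rwa [map_natCast, Nat.cast_add, Nat.cast_one] at h3
    exact hu.mul_left_eq_zero.mp h1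

theorem MvPolynomial.totalDegree_pderiv_le {R σ : Type*} [CommRing R]
    (p : MvPolynomial σ R) (j : σ) (N : ℕ) (hp : p.totalDegree ≤ N + 1) :
    (pderiv j p).totalDegree ≤ N := by
  classical
  rw [totalDegree, Finset.sup_le_iff]
  intro m hm
  rw [mem_support_iff, coeff_pderiv] at hm
  have h1 : m + Finsupp.single j 1 ∈ p.support :=
    mem_support_iff.mpr (left_ne_zero_of_mul hm)
  have h2 := (le_totalDegree h1).trans hp
  rw [Finsupp.sum_add_index' (fun _ => rfl) (fun _ _ _ => rfl), Finsupp.sum_single_index rfl] at h2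
  omega

/-- If `[ν_j, Ω(H)] = -Ω(∂H/∂X_j)` and `ν_j e = 0`, then `H ↦ Ω(H) e` is injective as soon as it is
injective on constants. -/
theorem MvPolynomial.eq_zero_of_apply_eq_zero {R M σ : Type*} [CommRing R] [Algebra ℚ R]
    [AddCommGroup M] (Ω : MvPolynomial σ R →+* Module.End ℤ M) (ν : σ → Module.End ℤ M) (e : M)
    (he : ∀ j, ν j e = 0) (hν : ∀ j p, ν j * Ω p = Ω p * ν j + Ω (-pderiv j p))
    (hC : ∀ r, Ω (C r) e = 0 → r = 0) {p : MvPolynomial σ R} (hp : Ω p e = 0) : p = 0 := by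
  have key : ∀ (N : ℕ) (p : MvPolynomial σ R), p.totalDegree ≤ N → Ω p e = 0 → p = 0 := by
    intro N
    induction N with
    | zero =>
      intro p hN hp
      have h1 := totalDegree_eq_zero_iff_eq_C.mp (Nat.le_zero.mp hN)
      rw [h1] at hp ⊢
      rw [hC _ hp, C_0]
    | succ N ih =>
      intro p hN hp
      -- Applying `ν_j` to `Ω p e = 0` gives the same relation for `∂p/∂X_j`, which has smaller
      -- degree.
      have h1 : ∀ j, pderiv j p = 0 := by
        intro j
        refine ih _ (totalDegree_pderiv_le p j N hN) ?_
        have h2 := LinearMap.congr_fun (hν j p) e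
        rw [LinearMap.add_apply, Module.End.mul_apply, Module.End.mul_apply, hp, he, map_zero,
          map_zero, zero_add, map_neg, LinearMap.neg_apply] at h2
        exact neg_eq_zero.mp h2.symm
      have h2 := eq_zero_of_pderiv_eq_zero h1
      rw [h2] at hp ⊢
      rw [hC _ hp, C_0]
  exact key _ p le_rfl hp

open scoped TensorProduct in
/-- The equational criterion for polynomials and a flat change of coefficients. -/
theorem MvPolynomial.exists_of_sum_C_mul_map_eq_zero {S R σ : Type*} [CommRing S] [CommRing R]
    (φ : S →+* R) (hφ : φ.Flat) {l : ℕ} (r : Fin l → R) (H : Fin l → MvPolynomial σ S)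
    (h : ∑ i, C (r i) * map φ (H i) = 0) :
    ∃ (m : ℕ) (a : Fin l → Fin m → S) (y : Fin m → R),
      (∀ i, r i = ∑ k, φ (a i k) * y k) ∧ ∀ k, ∑ i, C (a i k) * H i = 0 := by
  let _ := φ.toAlgebra
  have : Module.Flat S R := hφ
  -- Under `R ⊗ S[X] ≅ R[X]` the given relation says that a tensor vanishes, and flatness makes it
  -- vanish for trivial reasons.
  have h0 : ∑ i, H i ⊗ₜ[S] r i = 0 := by
    apply (TensorProduct.comm S _ _).injective
    apply (algebraTensorAlgEquiv (σ := σ) S R).injective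
    rw [map_zero, map_zero, map_sum, map_sum, ← h]
    refine Finset.sum_congr rfl fun i _ => ?_
    rw [TensorProduct.comm_tmul, algebraTensorAlgEquiv_tmul, ← C_mul']
    rfl
  obtain ⟨m, a, y, h1, h2⟩ :=
    TensorProduct.vanishesTrivially_of_sum_tmul_eq_zero_of_rTensor_injective S
      (Module.Flat.rTensor_preserves_injective_linearMap _ (Submodule.subtype_injective _)) h0
  refine ⟨m, a, y, fun i => ?_, fun k => ?_⟩
  · rw [h1 i]
    exact Finset.sum_congr rfl fun k _ => Algebra.smul_def _ _
  · rw [← h2 k]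
    exact Finset.sum_congr rfl fun i _ => C_mul'

attribute [local instance] MvPolynomial.algebraMvPolynomial in
-- `K[X] → L[X]` is the base change of the extension `K → L`, which is flat because `K` is a field.
theorem MvPolynomial.flat_map {K L σ : Type*} [Field K] [Field L] (φ : K →+* L) :
    (map φ : MvPolynomial σ K →+* MvPolynomial σ L).Flat := by
  let _ := φ.toAlgebra
  have : Module.Flat (MvPolynomial σ K) (MvPolynomial σ L) :=
    Module.Flat.isBaseChange K _ L _
      (Algebra.IsPushout.out (R := K) (S := MvPolynomial σ K) (R' := L) (S' := MvPolynomial σ L))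
  exact (RingHom.flat_algebraMap_iff (R := MvPolynomial σ K) (S := MvPolynomial σ L)).mpr this

namespace Procedure

open Weyl ComplexPower

/-- The action by multiplication. -/
theorem exists_ringHom_mul {R M : Type*} [CommRing R] [CommRing M] (φ : R →+* M) :
    ∃ μ : R →+* Module.End ℤ M, ∀ r h, μ r h = φ r * h :=
  ⟨(Algebra.lmul ℤ M).toRingHom.comp φ, fun _ _ => rfl⟩

variable {K : Type*} [Field K] {n d : ℕ}

/-! ### Normal forms modulo the graph ideal -/

theorem pderiv_inr_inX (j : Fin d) (h : MvPolynomial (Fin n) K) :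
    MvPolynomial.pderiv (.inr j : Fin n ⊕ Fin d) (inX h) = 0 := by
  apply MvPolynomial.pderiv_eq_zero_of_notMem_vars
  intro hm
  simpa using MvPolynomial.vars_rename Sum.inl h hm

theorem exists_ringHom_polynomial : ∃ e : MvPolynomial (Fin d) (MvPolynomial (Fin n) K) →+* A K n d,
    (∀ r, e (MvPolynomial.C r) = fn (inX r)) ∧ ∀ j, e (MvPolynomial.X j) = D (.inr j) :=
  MvPolynomial.exists_ringHom_of_commute
    ((DiffOp.coeff _ _).comp (MvPolynomial.rename Sum.inl :
      MvPolynomial (Fin n) K →ₐ[K] MvPolynomial (Fin n ⊕ Fin d) K).toRingHom)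
    (fun j => D (.inr j)) (fun j r => D_fn_comm _ _ (pderiv_inr_inX j r))
    (fun _ _ => DiffOp.der_comm _ _)

/-- Modulo the graph ideal every operator is a polynomial in `x, ∂_t`. -/
theorem exists_sub_mem_graphIdeal (f : Fin d → MvPolynomial (Fin n) K)
    {e : MvPolynomial (Fin d) (MvPolynomial (Fin n) K) →+* A K n d}
    (heC : ∀ r, e (MvPolynomial.C r) = fn (inX r)) (heX : ∀ j, e (MvPolynomial.X j) = D (.inr j))
    (P : A K n d) : ∃ H, P - e H ∈ graphIdeal f := by
  -- If `a ≡ e F` and commutation with `a` acts on `K[x][∂_t]` by a derivation `δ`, then `a e(H) =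
  -- e(H) a + e(δ H) ≡ e(H F + δ H)`. The factor `a` must first be moved to the right because the
  -- congruence is modulo a left ideal.
  have step : ∀ (a : A K n d) (δ : Derivation K (MvPolynomial (Fin d) (MvPolynomial (Fin n) K))
      (MvPolynomial (Fin d) (MvPolynomial (Fin n) K))) (F : MvPolynomial (Fin d) _),
      (∀ r, a * fn (inX r) = fn (inX r) * a + e (δ (MvPolynomial.C r))) →
      (∀ j, a * D (.inr j) = D (.inr j) * a + e (δ (MvPolynomial.X j))) →
      a - e F ∈ graphIdeal f → ∀ P, (∃ H, P - e H ∈ graphIdeal f) →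
        ∃ H, a * P - e H ∈ graphIdeal f := by
    rintro a δ F hC hX hF P ⟨H, hH⟩
    refine ⟨H * F + δ H, ?_⟩
    have h1 := MvPolynomial.mul_map_eq_of_derivation e a δ
      (fun r => by rw [heC]; exact hC r) (fun j => by rw [heX]; exact hX j) H
    have h2 := (graphIdeal f).add_mem (Ideal.mul_mem_left _ a hH) (Ideal.mul_mem_left _ (e H) hF)
    convert h2 using 1
    rw [mul_sub, mul_sub, h1, map_add, map_mul]
    abel
  have hsub : ∀ {a b : A K n d}, a = b → a - b ∈ graphIdeal f := by
    rintro a _ rfl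
    rw [sub_self]
    exact zero_mem _
  have hcomm : ∀ {a b : A K n d}, Commute a b → a * b = b * a + e 0 := by
    intro a b h
    rw [map_zero, add_zero, h.eq]
  induction P using Weyl.induction_left with
  | one => exact ⟨1, hsub (map_one e).symm⟩
  | add P Q hP hQ =>
    obtain ⟨H, hH⟩ := hP
    obtain ⟨H', hH'⟩ := hQ
    refine ⟨H + H', ?_⟩
    rw [map_add, add_sub_add_comm]
    exact add_mem hH hH'
  | C_mul c P hP =>
    refine step _ 0 (MvPolynomial.C (MvPolynomial.C c)) (fun r => hcomm (fn_comm _ _))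
      (fun j => hcomm (D_fn_comm _ _ MvPolynomial.pderiv_C).symm) (hsub ?_) P hP
    rw [heC, inX, MvPolynomial.rename_C]
  | X_mul i P hP =>
    rcases i with i | j
    · refine step _ 0 (MvPolynomial.C (MvPolynomial.X i)) (fun r => hcomm (fn_comm _ _))
        (fun j => hcomm (D_fn_comm _ _ (MvPolynomial.pderiv_X_of_ne (by simp))).symm)
        (hsub ?_) P hP
      rw [heC, inX, MvPolynomial.rename_X]
    -- `t_j ≡ f_j`, and `[t_j, ∂_{t_j}] = -1` gives the derivation `-∂/∂X_j`.
    · refine step _ (-(MvPolynomial.pderiv (R := MvPolynomial (Fin n) K) j).restrictScalars K)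
        (MvPolynomial.C (f j))
        (fun r => ?_) (fun k => ?_) ?_ P hP
      · rw [Derivation.neg_apply, Derivation.restrictScalars_apply, MvPolynomial.pderiv_C, neg_zero]
        exact hcomm (fn_comm _ _)
      · rw [Derivation.neg_apply, Derivation.restrictScalars_apply, map_neg, D_fn]
        by_cases hjk : j = k
        · subst hjk
          rw [MvPolynomial.pderiv_X_self, MvPolynomial.pderiv_X_self, fn_one, map_one]
          abel
        · rw [MvPolynomial.pderiv_X_of_ne (Ne.symm hjk),
            MvPolynomial.pderiv_X_of_ne (by simpa using hjk), map_zero, fn_zero]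
          abel
      · rw [heC]
        exact Ideal.subset_span (Or.inl ⟨j, rfl⟩)
  | D_mul i P hP =>
    rcases i with i | j
    · refine step _ (DerExt.poly (Fin d) (partials K (Fin n) i))
        (-∑ j, MvPolynomial.C (MvPolynomial.pderiv i (f j)) * MvPolynomial.X j)
        (fun r => ?_) (fun k => ?_) ?_ P hP
      · rw [D_fn, DerExt.poly_C, heC, inX, inX,
          MvPolynomial.pderiv_rename Sum.inl_injective]
      · rw [DerExt.poly_X]
        exact hcomm (DiffOp.der_comm _ _)
      · rw [map_neg, sub_neg_eq_add, map_sum]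
        simp only [map_mul, heC, heX]
        exact Ideal.subset_span (Or.inr ⟨i, rfl⟩)
    · exact step _ 0 (MvPolynomial.X j) (fun r => hcomm (D_fn_comm _ _ (pderiv_inr_inX j r)))
        (fun k => hcomm (DiffOp.der_comm _ _)) (hsub (heX j).symm) P hP
  | Z_mul j => exact j.elim

/-! ### The annihilator is generated over `R` by the weight zero part of the graph ideal -/

section Action

variable {k R : Type*} [CommRing k] [CommRing R] [Algebra k R] (δ : Fin n → Derivation k R R)
  (hδ : ∀ i l r, δ i (δ l r) = δ l (δ i r)) (φ : MvPolynomial (Fin n) K →+* R)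
  (hφ : ∀ i r, φ (partials K (Fin n) i r) = δ i (φ r)) (f : Fin d → MvPolynomial (Fin n) K)

/-- The elements of `R[∂_t]` act faithfully on `f^s`. -/
theorem sum_C_mul_map_eq_zero [Algebra ℚ R] {M : Type*} [CommRing M]
    (Ψ : A K n d →+* Module.End ℤ M) (a : R →+* M) (hX : ∀ r h, Ψ (fn (inX r)) h = a (φ r) * h)
    (hDC : ∀ j r h, Ψ (D (.inr j)) (a r * h) = a r * Ψ (D (.inr j)) h)
    (hTC : ∀ j r h, Ψ (fn (MvPolynomial.X (.inr j))) (a r * h) =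
      a r * Ψ (fn (MvPolynomial.X (.inr j))) h)
    (h0 : ∀ P ∈ graphIdeal f, Ψ P 1 = 0) (ha : ∀ r, a r = 0 → r = 0)
    {e : MvPolynomial (Fin d) (MvPolynomial (Fin n) K) →+* A K n d}
    (heC : ∀ r, e (MvPolynomial.C r) = fn (inX r)) (heX : ∀ j, e (MvPolynomial.X j) = D (.inr j))
    {l : ℕ} (r : Fin l → R) (H : Fin l → MvPolynomial (Fin d) (MvPolynomial (Fin n) K))
    (h : ∑ i, a (r i) * Ψ (e (H i)) 1 = 0) :
    ∑ i, MvPolynomial.C (r i) * MvPolynomial.map φ (H i) = 0 := by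
  obtain ⟨μ, hμ⟩ := exists_ringHom_mul a
  -- The action of `R[X]` in which `X_j` acts as `∂_{t_j}`, possible because `∂_{t_j}` acts
  -- `R`-linearly.
  obtain ⟨Ω, hΩC, hΩX⟩ := MvPolynomial.exists_ringHom_of_commute μ (fun j => Ψ (D (.inr j)))
    (fun j r => LinearMap.ext fun h => by
      rw [Module.End.mul_apply, Module.End.mul_apply, hμ, hμ, hDC])
    (fun i j => (DiffOp.der_comm _ _).map Ψ)
  have hΩe : ∀ H, Ψ (e H) = Ω (MvPolynomial.map φ H) := by
    intro H
    have : Ψ.comp e = Ω.comp (MvPolynomial.map φ) := by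
      refine MvPolynomial.ringHom_ext (fun r => ?_) fun j => ?_
      · refine LinearMap.ext fun h => ?_
        rw [RingHom.comp_apply, RingHom.comp_apply, heC, MvPolynomial.map_C, hΩC, hX, hμ]
      · rw [RingHom.comp_apply, RingHom.comp_apply, heX, MvPolynomial.map_X, hΩX]
    exact congrArg (fun F => F H) this
  have hgen : ∀ j, fn (MvPolynomial.X (.inr j)) - fn (inX (f j)) ∈ graphIdeal f :=
    fun j => Ideal.subset_span (Or.inl ⟨j, rfl⟩)
  -- `t_j - f_j` kills `f^s`, commutes with `R`, and its commutator with `∂_{t_k}` is `-1` for `k =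
  -- j` and `0` otherwise: it differentiates polynomials in `∂_t`.
  obtain ⟨ν, hν⟩ : ∃ ν : Fin d → Module.End ℤ M,
      ∀ j, ν j = Ψ (fn (MvPolynomial.X (.inr j)) - fn (inX (f j))) := ⟨_, fun _ => rfl⟩
  have he : ∀ j, ν j 1 = 0 := by
    intro j
    rw [hν]
    exact h0 _ (hgen j)
  refine MvPolynomial.eq_zero_of_apply_eq_zero Ω ν 1 he (fun j p => ?_) (fun c hc => ?_) ?_
  · rw [← Derivation.neg_apply, hν]
    refine MvPolynomial.mul_map_eq_of_derivation Ω _ (-MvPolynomial.pderiv j)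
      (fun c => ?_) (fun i => ?_) p
    · rw [Derivation.neg_apply, MvPolynomial.pderiv_C, neg_zero, map_zero, add_zero, hΩC]
      refine LinearMap.ext fun h => ?_
      rw [map_sub, Module.End.mul_apply, Module.End.mul_apply, LinearMap.sub_apply,
        LinearMap.sub_apply, hX, hX, hμ, hμ, hTC]
      ring
    · rw [Derivation.neg_apply, map_neg, hΩX, ← map_mul, ← map_mul, sub_mul, mul_sub, D_fn,
        (D_fn_comm _ _ (pderiv_inr_inX i (f j))).eq]
      by_cases hji : j = i
      · subst hji
        rw [MvPolynomial.pderiv_X_self, MvPolynomial.pderiv_X_self, fn_one, map_one]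
        simp only [map_sub, map_add, map_one]
        abel
      · rw [MvPolynomial.pderiv_X_of_ne (Ne.symm hji),
          MvPolynomial.pderiv_X_of_ne (by simpa using hji), map_zero, fn_zero, add_zero, neg_zero,
          add_zero]
  · rw [hΩC, hμ, mul_one] at hc
    exact ha c hc
  · rw [map_sum, LinearMap.sum_apply, ← h]
    refine Finset.sum_congr rfl fun i _ => ?_
    rw [map_mul, Module.End.mul_apply, hΩC, hμ, hΩe]

/-- Normal forms turn annihilation of `f^s` into a linear relation with coefficients in `R` between
polynomials over `K[x]`; flatness then expresses it through relations with coefficients in `K[x]`.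
-/
theorem exists_eq_sum_of_mem_ann [Algebra ℚ R] (hflat : φ.Flat)
    (hinj : ∀ r, algebraMap R (Coeff fun j => φ (f j)) r = 0 → r = 0) {p : DiffOp δ (Fin d)}
    (hp : p ∈ ann δ (fun j => φ (f j)) hδ) :
    ∃ (m : ℕ) (y : Fin m → R) (q : Fin m → As K n d),
      (∀ i, euler (reflect (q i)) ∈ graphIdeal f) ∧
      p = ∑ i, DiffOp.coeff δ (Fin d) (y i) * DiffOp.map φ hφ (q i) := by
  obtain ⟨Ψ, hΨ, hX, hDC, hTC, h0⟩ := exists_action_mod δ hδ φ hφ f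
  obtain ⟨e, heC, heX⟩ := exists_ringHom_polynomial (K := K) (n := n) (d := d)
  obtain ⟨l, r, b, rfl⟩ := DiffOp.exists_eq_sum_coeff_mul_map φ hφ p
  choose H hH using fun i => exists_sub_mem_graphIdeal f heC heX (euler (reflect (b i)))
  have hzero : ∑ i, MvPolynomial.C (r i) * MvPolynomial.map φ (H i) = 0 := by
    refine sum_C_mul_map_eq_zero φ f Ψ (MvPolynomial.C.comp (algebraMap R (Coeff fun j => φ (f j))))
      hX (fun j r => hDC j _) (fun j r => hTC j _) h0
      (fun r hr => hinj r (MvPolynomial.C_eq_zero.mp hr)) heC heX r H ?_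
    rw [mem_ann, map_sum, LinearMap.sum_apply] at hp
    rw [← hp]
    refine Finset.sum_congr rfl fun i _ => ?_
    have h1 := h0 _ (hH i)
    rw [map_sub, LinearMap.sub_apply, sub_eq_zero, hΨ] at h1
    rw [map_mul, Module.End.mul_apply, ← h1, action_coeff, RingHom.comp_apply]
  obtain ⟨m, a, y, hr, hH0⟩ := MvPolynomial.exists_of_sum_C_mul_map_eq_zero φ hflat r H hzero
  -- The coefficients of the relations over `K[x]` are applied to the operators `b_l` in place of
  -- their normal forms `H_l`; the resulting normal forms are zero.
  refine ⟨m, y, fun i => ∑ l, fn (a l i) * b l, fun i => ?_, ?_⟩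
  · have h1 : ∑ l, fn (inX (a l i)) * (euler (reflect (b l)) - e (H l)) ∈ graphIdeal f :=
      sum_mem fun l _ => Ideal.mul_mem_left _ _ (hH l)
    have h2 := congrArg e (hH0 i)
    rw [map_sum, map_zero] at h2
    simp only [map_mul, heC] at h2
    simp only [mul_sub, Finset.sum_sub_distrib] at h1
    rw [h2, sub_zero] at h1
    rw [map_sum, map_sum]
    simpa only [map_mul, reflect_fn, euler_fn] using h1
  · simp only [map_sum, map_mul, Finset.mul_sum]
    rw [Finset.sum_comm]
    refine Finset.sum_congr rfl fun l _ => ?_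
    rw [hr, map_sum, Finset.sum_mul]
    refine Finset.sum_congr rfl fun i _ => ?_
    rw [DiffOp.map_coeff, mul_comm (φ _), map_mul, mul_assoc]

end Action

/-! ### The weight zero part of the ideal -/

/-- The operators `Q_P` generate the weight zero part of the left ideal generated by the `P`. -/
theorem mem_span_of_euler_mem_span {S : Set (A K n d)} {ν : A K n d → Fin d → ℤ}
    {Q : A K n d → As K n d} (hQ : ∀ P ∈ S, prodS (ν P) * P = euler (Q P)) {q : As K n d}
    (hq : euler q ∈ Ideal.span S) : q ∈ Ideal.span (Q '' S) := by
  have key : ∃ b ∈ Ideal.span (Q '' S), component wt Empty.elim 0 (euler q) = euler b := by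
    obtain ⟨m, a, P, h⟩ := Submodule.mem_span_set'.mp hq
    rw [← h]
    refine Finset.sum_induction _
      (fun x => ∃ b ∈ Ideal.span (Q '' S), component wt Empty.elim 0 x = euler b) ?_ ?_ ?_
    · rintro x y ⟨b, hb, hx⟩ ⟨b', hb', hy⟩
      exact ⟨b + b', add_mem hb hb', by rw [component_add, hx, hy, map_add]⟩
    · refine ⟨0, zero_mem _, ?_⟩
      have h1 := component_add (w := wt (n := n) (d := d)) (η := Empty.elim) 0 (0 : A K n d) 0
      rw [add_zero, left_eq_add] at h1
      rw [h1, map_zero]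
    · rintro i -
      have hP := hQ _ (P i).2
      -- `P` has weight `-ν(P)`, so the weight zero part of `a_i P` is the component of `a_i` of
      -- weight `ν(P)` times `P`. That component ends in `prodS (ν P)`, which turns `P` into `euler
      -- (Q P)`.
      obtain ⟨b, hb⟩ := exists_component_eq (a i) (ν (P i))
      refine ⟨b * Q (P i), Ideal.mul_mem_left _ _ (Ideal.subset_span ⟨_, (P i).2, rfl⟩), ?_⟩
      rw [smul_eq_mul, (hasWt_of_prodS_mul_eq_euler hP).component_mul_right, sub_neg_eq_add,
        zero_add, hb, mul_assoc, hP, map_mul]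
  obtain ⟨b, hb, h⟩ := key
  rw [(hasWt_euler q).component_eq] at h
  rwa [euler_injective h]

/-! ### Localization -/

section Local

variable {L : Type*} [Field L] [Algebra K L] (T : Submonoid (MvPolynomial (Fin n) L))

theorem flat_toLoc : (toLoc T : MvPolynomial (Fin n) K →+* Localization T).Flat :=
  (MvPolynomial.flat_map (algebraMap K L)).comp
    ((RingHom.flat_algebraMap_iff).mpr (IsLocalization.flat (Localization T) T))

/-- For `0 ∉ T` the ring `T⁻¹ L[x]` is a domain containing `K[x]`, so the product of the `f_j`
remains nonzero in it and inverting this product loses nothing. -/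
theorem eq_zero_of_algebraMap_coeff_eq_zero (hT : 0 ∉ T) {f : Fin d → MvPolynomial (Fin n) K}
    (hf : ∀ j, f j ≠ 0) {r : Localization T}
    (hr : algebraMap (Localization T) (Coeff fun j => toLoc T (f j)) r = 0) : r = 0 := by
  have hT' : T ≤ nonZeroDivisors (MvPolynomial (Fin n) L) := le_nonZeroDivisors_of_noZeroDivisors hT
  have : IsDomain (Localization T) := IsLocalization.isDomain_localization hT'
  have h1 : (∏ j, toLoc T (f j)) ≠ 0 := by
    refine Finset.prod_ne_zero_iff.mpr fun j _ h => hf j ?_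
    have h2 : MvPolynomial.map (algebraMap K L) (f j) = 0 :=
      (IsLocalization.injective (Localization T) hT') (h.trans (map_zero _).symm)
    exact (map_eq_zero_iff _ (MvPolynomial.map_injective _ (algebraMap K L).injective)).mp h2
  have h3 : Submonoid.powers (∏ j, toLoc T (f j)) ≤ nonZeroDivisors (Localization T) :=
    powers_le_nonZeroDivisors_of_noZeroDivisors h1
  exact (IsLocalization.injective (Coeff fun j => toLoc T (f j)) h3) (hr.trans (map_zero _).symm)

theorem subsingleton_DXs (hT : 0 ∈ T) : Subsingleton (DXs T d) := by
  have h1 : (1 : Localization T) = 0 := by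
    rw [← map_one (algebraMap (MvPolynomial (Fin n) L) (Localization T)),
      ← map_zero (algebraMap (MvPolynomial (Fin n) L) (Localization T)),
      IsLocalization.eq_iff_exists T]
    exact ⟨⟨0, hT⟩, by simp⟩
  refine subsingleton_of_zero_eq_one ?_
  rw [← map_one (DiffOp.coeff (locPartials L T) (Fin d)), h1, map_zero]

end Local

end Procedure

/-! ### The main theorem -/

theorem proposition4p2 {K L : Type*} [Field K] [CharZero K] [Field L] [Algebra K L] (n d : ℕ)
    (f : Fin d → MvPolynomial (Fin n) K) (hf : ∀ j, f j ≠ 0)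
    (ord : MonomialOrder (Procedure.Var n d)) (hord : Procedure.Eliminates ord)
    (G : Set (Procedure.Auv K n d)) (hG : Weyl.IsGroebner ord (Procedure.ideal f) G) :
    ((Weyl.IsReduced ord G ∨
        ∀ P : Procedure.A K n d, Procedure.incl P ∈ G →
          Procedure.IsHomogeneous (Procedure.incl P)) →
      ∀ P : Procedure.A K n d, Procedure.incl P ∈ G →
        ∃ (ν : Fin d → ℤ) (Q : Procedure.As K n d),
          Procedure.prodS ν * P = Procedure.euler Q) ∧
    ∀ (ν : Procedure.A K n d → Fin d → ℤ) (Q : Procedure.A K n d → Procedure.As K n d),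
      (∀ P : Procedure.A K n d, Procedure.incl P ∈ G →
        Procedure.prodS (ν P) * P = Procedure.euler (Q P)) →
      ∀ T : Submonoid (MvPolynomial (Fin n) L),
        Ideal.span ((fun P => Procedure.toDXs T (Procedure.reflect (Q P))) ''
            {P : Procedure.A K n d | Procedure.incl P ∈ G}) =
          Procedure.annihilator T f := by
  refine ⟨fun h P hP => ?_, fun ν Q hQ T => le_antisymm ?_ fun p hp => ?_⟩
  · obtain ⟨g, hg⟩ : ∃ g, Procedure.HasWt g P := by
      rcases h with h | h
      · exact Procedure.hasWt_of_isReduced hG h hP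
      · exact (h P hP).hasWt
    exact ⟨-g, hg.exists_prodS_mul_eq_euler⟩
  · rw [Ideal.span_le]
    rintro _ ⟨P, hP, rfl⟩
    refine Procedure.map_reflect_mem_ann _ (Procedure.locPartials_comm T) (Procedure.toLoc T) _ f ?_
    rw [← hQ P hP]
    exact Ideal.mul_mem_left _ _ (Procedure.mem_graphIdeal_of_incl_mem (hG.2.1 hP))
  -- If `0 ∈ T`, the localization is zero and so is its ring of operators; this case is separated
  -- because the injectivity used below fails to be available.
  · by_cases hT : (0 : MvPolynomial (Fin n) L) ∈ T
    · have := Procedure.subsingleton_DXs (d := d) T hT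
      rw [Subsingleton.elim p 0]
      exact zero_mem _
    · have : CharZero L := charZero_of_injective_algebraMap (algebraMap K L).injective
      let _ : Algebra ℚ (Localization T) :=
        ((algebraMap L (Localization T)).comp (algebraMap ℚ L)).toAlgebra
      obtain ⟨m, y, q, hq, rfl⟩ := Procedure.exists_eq_sum_of_mem_ann (Procedure.locPartials L T)
        (Procedure.locPartials_comm T) (Procedure.toLoc T)
        (by
          intro i r
          simp [Procedure.toLoc, Procedure.locPartials, partials, MvPolynomial.pderiv_map])
        f (Procedure.flat_toLoc T)
        (fun r => Procedure.eq_zero_of_algebraMap_coeff_eq_zero T hT hf) hp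
      refine sum_mem fun i _ => Ideal.mul_mem_left _ _ ?_
      -- Here `reflect (q i)` is a left combination of the `Q P`; as `reflect` is an involution,
      -- applying it once more expresses `q i` through the operators `reflect (Q P)`.
      have h1 := Procedure.mem_span_of_euler_mem_span (S := {P | Procedure.incl P ∈ G}) hQ
        (Procedure.mem_span_of_incl_mem hord hG (Procedure.incl_euler_mem (hq i)))
      have h2 := Ideal.mem_map_of_mem ((Procedure.toDXs T).comp Procedure.reflect) h1
      rw [Ideal.map_span, Set.image_image, RingHom.comp_apply, Procedure.reflect_reflect] at h2
      exact h2

end
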